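/- Let $k$ be a field of characteristic zero containing a primitive cube root of unity $q$. Let $S_3=\{e,u,u^2,s,us,u^2s\}$ with $u=(123)$, $s=(12)$, and let $A=D(S_3)=k(S_3)\rtimes kS_3$ be the Hopf algebra with basis $\delta_t\otimes v$ ($t,v\in S_3$), $$(\delta_t\otimes v)(\delta_{t'}\otimes v')=\delta_{v^{-1}tv,\,t'}\;\delta_t\otimes vv',\qquad \Delta(\delta_t\otimes v)=\sum_{ab=t}(\delta_a\otimes v)\otimes(\delta_b\otimes v),\qquad \varepsilon(\delta_t\otimes v)=\delta_{t,e}.$$ A bicovariant differential calculus on $A$ is an $A$-bimodule and $A$-bicomodule $\Omega^1$ whose coactions are bimodule maps, with a bicomodule map $d:A\to\Omega^1$ satisfying the Leibniz rule and such that the elements $a\,db$ span $\Omega^1$. It is irreducible if it is nonzero and has no proper nonzero quotient. Two calculi are called equivalent if their $\Omega^1$ are isomorphic as bimodules and bicomodules (the isomorphism need not intertwine the maps $d$). Let $\Lambda^1\subset\Omega^1$ be the space of left-invariant 1-forms; $\dim\Lambda^1$ is the dimension of the calculus. Let $\varpi:A\to\Lambda^1$, $\varpi(a)=S(a_{(1)})\,d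 a_{(2)}$; the quantum tangent space $L\subset A^*$ is the space of functionals vanishing on $\ker\varpi$, and it is dual to $\Lambda^1$. Let $\Psi(x\otimes y)=y_{(0)}\otimes S(y_{(1)})\,x\,y_{(2)}$ be the braiding on $\Lambda^1\otimes\Lambda^1$, where $\Delta_R y=y_{(0)}\otimes y_{(1)}$ is the right coaction, and let $\Omega^2=A\otimes\Lambda^2$, $\Lambda^2=(\Lambda^1\otimes\Lambda^1)/\ker(\mathrm{id}-\Psi)$, with $d:\Omega^1\to\Omega^2$ given by $d(a\,db)=da\wedge db$. Let $H^0=\ker(d:A\to\Omega^1)$ and $H^1=\ker(d:\Omega^1\to\Omega^2)/dA$. **Theorem.** Up to equivalence there are exactly eight irreducible bicovariant differential calculi on $D(S_3)$, of dimensions $1,2,2,2,4,3,3,6$. The 6-dimensional class contains a calculus $\mathcal C$ whose quantum tangent space $L$ is spanned by the linearly independent functionals $f_0,\dots,f_5$, where, writing $\underline v.t$ for the functional $a\mapsto(\text{coefficient of }\delta_t\otimes v\text{ in }a)-\delta_{v,e}\,\varepsilon(a)$, $$\begin{aligned} f_0&=\underline e.s+q^2\,\underline u.u^2s+q\,\underline{u^2}.us,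 & f_3&=\underline s.s+q\,\underline{u^2s}.us+q^2\,\underline{us}.u^2s,\\ f_1&=\underline u.s+q^2\,\underline{u^2}.u^2s+q\,\underline e.us, & f_4&=\underline{u^2s}.s+q\,\underline{us}.us+q^2\,\underline s.u^2s,\\ f_2&=\underline{u^2}.s+q^2\,\underline e.u^2s+q\,\underline u.us, & f_5&=\underline{us}.s+q\,\underline s.us+q^2\,\underline{u^2s}.u^2s. \end{aligned}$$ The calculus $\mathcal C$ has $H^0=k\cdot1$, and it is up to equivalence the only irreducible bicovariant calculus with this property: every irreducible bicovariant calculus on $D(S_3)$ with $H^0=k\cdot 1$ is equivalent to $\mathcal C$. Moreover, if $e_0,\dots,e_5$ is the basis of $\Lambda^1$ for $\mathcal C$ dual to $f_0,\dots,f_5$, then $H^1=k\,\theta\oplus k\,\bar\theta$ is 2-dimensional, spanned by the classes of $$\theta=e_0+q\,e_1+q^2e_2,\qquad \bar\theta=e_3+q^{-1}e_4+q^{-2}e_5 .$$ -/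

import Mathlib

open scoped TensorProduct

universe u v w w'

noncomputable section

/-! ## The quantum double `D(G) = k(G) ⋊ kG` of a finite group -/

/-- The vector space `k(G) ⊗ kG`, with basis `δ_s ⊗ u` indexed by the pairs `(s, u)`. -/
def QuantumDouble (k : Type u) (G : Type v) [Field k] : Type (max u v) := (G × G) →₀ k

namespace QuantumDouble

variable {k : Type u} {G : Type v} [Field k]

instance : AddCommGroup (QuantumDouble k G) := inferInstanceAs (AddCommGroup ((G × G) →₀ k))
instance : Module k (QuantumDouble k G) := inferInstanceAs (Module k ((G × G) →₀ k))

/-- The basis `δ_s ⊗ u`. -/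
def basis : Module.Basis (G × G) k (QuantumDouble k G) :=
  Module.Basis.ofRepr (LinearEquiv.refl k ((G × G) →₀ k))

variable (k) in
/-- The basis element `δ_s ⊗ u`. -/
def delta (s u : G) : QuantumDouble k G := basis (s, u)

/-- The linear map with prescribed values on the basis elements `δ_s ⊗ u`. -/
def lift {V : Type*} [AddCommGroup V] [Module k V] (f : G → G → V) : QuantumDouble k G →ₗ[k] V :=
  basis.constr k fun x => f x.1 x.2

@[simp]
theorem lift_delta {V : Type*} [AddCommGroup V] [Module k V] (f : G → G → V) (s u : G) :
    lift f (delta k s u) = f s u := by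
  simp [lift, delta]

theorem hom_ext {V : Type*} [AddCommGroup V] [Module k V] {f g : QuantumDouble k G →ₗ[k] V}
    (h : ∀ s u, f (delta k s u) = g (delta k s u)) : f = g :=
  basis.ext fun x => h x.1 x.2

variable [Group G] [DecidableEq G]

/-- The product `(δ_s ⊗ u)(δ_t ⊗ v) = δ_{s◁u,t} δ_s ⊗ uv`, where `s◁u = u⁻¹su`. -/
def mulMap : QuantumDouble k G →ₗ[k] QuantumDouble k G →ₗ[k] QuantumDouble k G :=
  lift fun s u => lift fun t v => if u⁻¹ * s * u = t then delta k s (u * v) else 0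

instance : Mul (QuantumDouble k G) := ⟨fun a b => mulMap a b⟩

theorem mul_def (a b : QuantumDouble k G) : a * b = mulMap a b := rfl

theorem delta_mul_delta (s u t v : G) :
    delta k s u * delta k t v = if u⁻¹ * s * u = t then delta k s (u * v) else 0 := by
  simp [mul_def, mulMap]


theorem mul_assoc' (a b c : QuantumDouble k G) : a * b * c = a * (b * c) := by
  have h1 : ∀ s u t v x w, delta k s u * delta k t v * delta k x w =
      delta k s u * (delta k t v * delta k (x : G) w) := by
    intro s u t v x w
    simp only [delta_mul_delta]
    by_cases h : u⁻¹ * s * u = t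
    · subst h
      by_cases h' : v⁻¹ * (u⁻¹ * s * u) * v = x
      · subst h'
        simp [delta_mul_delta, mul_assoc]
      · rw [if_pos rfl, if_neg h', delta_mul_delta, if_neg, mul_def, map_zero]
        simpa [mul_assoc] using h'
    · rw [if_neg h, mul_def, map_zero, LinearMap.zero_apply]
      split_ifs
      · rw [delta_mul_delta, if_neg h]
      · rw [mul_def, map_zero]
  have h2 : ∀ (a : QuantumDouble k G) (t v x w : G),
      a * delta k t v * delta k x w = a * (delta k t v * delta k x w) := by
    intro a t v x w
    have : mulMap.flip (delta k x w) ∘ₗ mulMap.flip (delta k t v) =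
        mulMap.flip (delta k t v * delta k x w) := hom_ext fun s u => h1 s u t v x w
    exact LinearMap.congr_fun this a
  have h3 : ∀ (a b : QuantumDouble k G) (x w : G),
      a * b * delta k x w = a * (b * delta k x w) := by
    intro a b x w
    have : mulMap.flip (delta k x w) ∘ₗ mulMap a = mulMap a ∘ₗ mulMap.flip (delta k x w) :=
      hom_ext fun t v => h2 a t v x w
    exact LinearMap.congr_fun this b
  have h4 : mulMap (a * b) = mulMap a ∘ₗ mulMap b := hom_ext fun x w => h3 a b x w
  exact LinearMap.congr_fun h4 c

variable [Fintype G]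

/-- The unit `1 = ∑ₛ δ_s ⊗ e`. -/
instance : One (QuantumDouble k G) := ⟨∑ s, delta k s 1⟩

theorem one_def : (1 : QuantumDouble k G) = ∑ s, delta k s 1 := rfl

theorem one_mul' (a : QuantumDouble k G) : 1 * a = a := by
  have h : mulMap (1 : QuantumDouble k G) = LinearMap.id := by
    refine hom_ext fun t v => ?_
    rw [one_def, map_sum, LinearMap.sum_apply]
    simp [mulMap]
  exact LinearMap.congr_fun h a

theorem mul_one' (a : QuantumDouble k G) : a * 1 = a := by
  have h : mulMap.flip (1 : QuantumDouble k G) = LinearMap.id := by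
    refine hom_ext fun t v => ?_
    rw [one_def, map_sum, LinearMap.sum_apply]
    simp [mulMap]
  exact LinearMap.congr_fun h a

instance : Ring (QuantumDouble k G) :=
  { (inferInstance : AddCommGroup (QuantumDouble k G)) with
    mul := (· * ·)
    one := 1
    one_mul := one_mul'
    mul_one := mul_one'
    mul_assoc := mul_assoc'
    left_distrib := fun a b c => by simp [mul_def]
    right_distrib := fun a b c => by simp [mul_def]
    zero_mul := fun a => by simp [mul_def]
    mul_zero := fun a => by simp [mul_def] }

instance : Algebra k (QuantumDouble k G) :=
  Algebra.ofModule (fun r a b => by simp [mul_def]) (fun r a b => by simp [mul_def])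

/-- The coproduct `Δ(δ_s ⊗ u) = ∑_{ab=s} δ_a ⊗ u ⊗ δ_b ⊗ u` and the counit `ε(δ_s ⊗ u) = δ_{s,e}`. -/
instance : CoalgebraStruct k (QuantumDouble k G) where
  comul := lift fun s u => ∑ a, delta k a u ⊗ₜ[k] delta k (a⁻¹ * s) u
  counit := lift fun s _ => if s = 1 then 1 else 0

theorem comul_delta (s u : G) :
    CoalgebraStruct.comul (R := k) (delta k s u) =
      ∑ a, delta k a u ⊗ₜ[k] delta k (a⁻¹ * s) u :=
  lift_delta _ s u

theorem counit_delta (s u : G) :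
    CoalgebraStruct.counit (R := k) (delta k s u) = if s = 1 then 1 else 0 :=
  lift_delta _ s u

instance : Coalgebra k (QuantumDouble k G) where
  coassoc := by
    refine hom_ext fun s u => ?_
    simp only [LinearMap.comp_apply, comul_delta, map_sum, LinearMap.rTensor_tmul,
      LinearMap.lTensor_tmul, TensorProduct.sum_tmul, TensorProduct.tmul_sum,
      LinearEquiv.coe_coe, TensorProduct.assoc_tmul]
    rw [Finset.sum_comm]
    refine Finset.sum_congr rfl fun a _ => ?_
    refine Fintype.sum_equiv (Equiv.mulLeft a⁻¹) _ _ fun b => ?_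
    simp [mul_assoc]
  rTensor_counit_comp_comul := by
    refine hom_ext fun s u => ?_
    simp [comul_delta, counit_delta, TensorProduct.ite_tmul]
  lTensor_counit_comp_comul := by
    refine hom_ext fun s u => ?_
    simp [comul_delta, counit_delta, TensorProduct.tmul_ite, inv_mul_eq_one]

theorem comul_mul' (a b : QuantumDouble k G) :
    CoalgebraStruct.comul (R := k) (a * b) =
      CoalgebraStruct.comul (R := k) a * CoalgebraStruct.comul (R := k) b := by
  have h : mulMap.compr₂ (CoalgebraStruct.comul (R := k) (A := QuantumDouble k G)) =
      (LinearMap.mul k _).compl₁₂ CoalgebraStruct.comul CoalgebraStruct.comul := by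
    refine hom_ext fun s u => hom_ext fun t v => ?_
    simp only [LinearMap.compr₂_apply, LinearMap.compl₁₂_apply, ← mul_def, delta_mul_delta,
      comul_delta, LinearMap.mul_apply', Finset.sum_mul, Finset.mul_sum,
      Algebra.TensorProduct.tmul_mul_tmul, TensorProduct.ite_tmul]
    rw [Finset.sum_comm]
    by_cases hs : u⁻¹ * s * u = t
    · subst hs
      rw [if_pos rfl, comul_delta]
      refine Finset.sum_congr rfl fun a _ => ?_
      rw [Finset.sum_eq_single (u⁻¹ * a * u)]
      · rw [if_pos rfl, if_pos (by group)]
      · intro b _ hb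
        rw [if_neg (Ne.symm hb)]
      · simp
    · rw [if_neg hs, map_zero]
      refine (Finset.sum_eq_zero fun a _ => Finset.sum_eq_zero fun b _ => ?_).symm
      split_ifs with h1 h2
      · exfalso
        apply hs
        rw [← h1] at h2
        have h3 : (u⁻¹ * a * u) * (u⁻¹ * (a⁻¹ * s) * u) = t := by rw [h2]; group
        rw [← h3]; group
      · rw [TensorProduct.tmul_zero]
      · rfl
  exact LinearMap.congr_fun₂ h a b

theorem counit_mul' (a b : QuantumDouble k G) :
    CoalgebraStruct.counit (R := k) (a * b) =
      CoalgebraStruct.counit (R := k) a * CoalgebraStruct.counit (R := k) b := by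
  have h : mulMap.compr₂ (CoalgebraStruct.counit (R := k) (A := QuantumDouble k G)) =
      (LinearMap.mul k k).compl₁₂ CoalgebraStruct.counit CoalgebraStruct.counit := by
    refine hom_ext fun s u => hom_ext fun t v => ?_
    simp only [LinearMap.compr₂_apply, LinearMap.compl₁₂_apply, ← mul_def, delta_mul_delta,
      counit_delta, LinearMap.mul_apply']
    by_cases hs : s = 1
    · subst hs
      by_cases ht : t = 1
      · simp [ht, counit_delta]
      · simp [ht, Ne.symm ht]
    · by_cases ht : u⁻¹ * s * u = t
      · simp [ht, hs, counit_delta]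
      · simp [ht, hs]
  exact LinearMap.congr_fun₂ h a b

instance : Bialgebra k (QuantumDouble k G) :=
  Bialgebra.mk' k (QuantumDouble k G)
    (by simp [one_def, counit_delta])
    (fun {a b} => counit_mul' a b)
    (by
      simp only [one_def, map_sum, comul_delta, Algebra.TensorProduct.one_def,
        TensorProduct.sum_tmul, TensorProduct.tmul_sum]
      rw [Finset.sum_comm]
      conv_rhs => rw [Finset.sum_comm]
      refine Finset.sum_congr rfl fun a _ => ?_
      exact Fintype.sum_equiv (Equiv.mulLeft a⁻¹) _ _ fun b => rfl)
    (fun {a b} => comul_mul' a b)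

/-- The antipode `S(δ_s ⊗ u) = δ_{(s◁u)⁻¹} ⊗ u⁻¹`. -/
instance : HopfAlgebra k (QuantumDouble k G) where
  antipode := lift fun s u => delta k (u⁻¹ * s * u)⁻¹ u⁻¹
  mul_antipode_rTensor_comul := by
    refine hom_ext fun s u => ?_
    simp only [LinearMap.comp_apply, comul_delta, counit_delta, map_sum, LinearMap.rTensor_tmul,
      lift_delta, LinearMap.mul'_apply, delta_mul_delta, Algebra.linearMap_apply]
    by_cases hs : s = 1
    · subst hs
      rw [if_pos rfl, map_one, one_def]
      refine Fintype.sum_equiv ((Equiv.inv G).trans (MulAut.conj u⁻¹).toEquiv) _ _ fun a => ?_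
      rw [if_pos (by group)]
      simp [mul_assoc]
    · rw [if_neg hs, map_zero]
      refine Finset.sum_eq_zero fun a _ => if_neg fun h => hs ?_
      have : a⁻¹ = a⁻¹ * s := by rw [← h]; group
      simpa using this
  mul_antipode_lTensor_comul := by
    refine hom_ext fun s u => ?_
    simp only [LinearMap.comp_apply, comul_delta, counit_delta, map_sum, LinearMap.lTensor_tmul,
      lift_delta, LinearMap.mul'_apply, delta_mul_delta, Algebra.linearMap_apply]
    by_cases hs : s = 1
    · subst hs
      rw [if_pos rfl, map_one, one_def]
      refine Finset.sum_congr rfl fun a _ => ?_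
      rw [if_pos (by group), mul_inv_cancel]
    · rw [if_neg hs, map_zero]
      refine Finset.sum_eq_zero fun a _ => if_neg fun h => hs ?_
      have h2 : s⁻¹ = 1 := by
        have : u * (u⁻¹ * a * u) * u⁻¹ = u * (u⁻¹ * (a⁻¹ * s) * u)⁻¹ * u⁻¹ := by rw [h]
        have h3 : a = s⁻¹ * a := by
          calc a = u * (u⁻¹ * a * u) * u⁻¹ := by group
            _ = _ := this
            _ = s⁻¹ * a := by group
        simpa using h3
      simpa using h2

end QuantumDouble

/-! ## Bicovariant differential calculi over a Hopf algebra -/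

/-- A bicovariant first order differential calculus `(Ω¹, d)` over a Hopf algebra `A`: an
`A`-`A`-bimodule and `A`-`A`-bicomodule `Ω¹` whose coactions are bimodule maps, and a bicomodule map
`d : A → Ω¹` with the Leibniz rule such that `a ⊗ b ↦ a db` is surjective. -/
structure BicovariantCalculus (k : Type u) [Field k] (A : Type v) [Ring A] [HopfAlgebra k A] where
  /-- The space of 1-forms `Ω¹`. -/
  carrier : Type w
  [addCommGroup : AddCommGroup carrier]
  [module : Module k carrier]
  /-- The left action, `lact a ω = a ω`. -/
  lact : A →ₗ[k] carrier →ₗ[k] carrier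
  /-- The right action, `ract a ω = ω a`. -/
  ract : A →ₗ[k] carrier →ₗ[k] carrier
  one_lact : ∀ ω, lact 1 ω = ω
  mul_lact : ∀ a b ω, lact (a * b) ω = lact a (lact b ω)
  one_ract : ∀ ω, ract 1 ω = ω
  mul_ract : ∀ a b ω, ract (a * b) ω = ract b (ract a ω)
  lact_ract : ∀ a b ω, lact a (ract b ω) = ract b (lact a ω)
  /-- The left coaction `Δ_L : Ω¹ → A ⊗ Ω¹`. -/
  coactL : carrier →ₗ[k] A ⊗[k] carrier
  /-- The right coaction `Δ_R : Ω¹ → Ω¹ ⊗ A`. -/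
  coactR : carrier →ₗ[k] carrier ⊗[k] A
  coactL_coassoc : ∀ ω, TensorProduct.assoc k A A carrier
    ((Coalgebra.comul (R := k) (A := A)).rTensor carrier (coactL ω)) = coactL.lTensor A (coactL ω)
  coactL_counit : ∀ ω, TensorProduct.lid k carrier
    ((Coalgebra.counit (R := k) (A := A)).rTensor carrier (coactL ω)) = ω
  coactR_coassoc : ∀ ω, TensorProduct.assoc k carrier A A (coactR.rTensor A (coactR ω)) =
    (Coalgebra.comul (R := k) (A := A)).lTensor carrier (coactR ω)
  coactR_counit : ∀ ω, TensorProduct.rid k carrier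
    ((Coalgebra.counit (R := k) (A := A)).lTensor carrier (coactR ω)) = ω
  coact_comm : ∀ ω, TensorProduct.assoc k A carrier A (coactL.rTensor A (coactR ω)) =
    coactR.lTensor A (coactL ω)
  coactL_lact : ∀ a ω, coactL (lact a ω) =
    TensorProduct.map₂ (LinearMap.mul k A) lact (Coalgebra.comul (R := k) a) (coactL ω)
  coactL_ract : ∀ a ω, coactL (ract a ω) =
    TensorProduct.map₂ (LinearMap.mul k A).flip ract (Coalgebra.comul (R := k) a) (coactL ω)
  coactR_lact : ∀ a ω, coactR (lact a ω) =
    TensorProduct.map₂ lact (LinearMap.mul k A) (Coalgebra.comul (R := k) a) (coactR ω)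
  coactR_ract : ∀ a ω, coactR (ract a ω) =
    TensorProduct.map₂ ract (LinearMap.mul k A).flip (Coalgebra.comul (R := k) a) (coactR ω)
  /-- The exterior derivative `d : A → Ω¹`. -/
  d : A →ₗ[k] carrier
  leibniz : ∀ a b, d (a * b) = lact a (d b) + ract b (d a)
  span_lact_d : Submodule.span k {ω | ∃ a b, lact a (d b) = ω} = ⊤
  coactL_d : ∀ a, coactL (d a) = d.lTensor A (Coalgebra.comul (R := k) a)
  coactR_d : ∀ a, coactR (d a) = d.rTensor A (Coalgebra.comul (R := k) a)

namespace BicovariantCalculus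

attribute [instance] addCommGroup module

variable {k : Type u} [Field k] {A : Type v} [Ring A] [HopfAlgebra k A]
variable (C : BicovariantCalculus.{u, v, w} k A)

/-- Sub-bimodules of `Ω¹` that are sub-bicomodules. The quotients of the calculus are the calculi
`(Ω¹ / N, d)` for such `N`. -/
structure IsBicovariantSub (N : Submodule k C.carrier) : Prop where
  lact_mem : ∀ a, ∀ ω ∈ N, C.lact a ω ∈ N
  ract_mem : ∀ a, ∀ ω ∈ N, C.ract a ω ∈ N
  coactL_mem : ∀ ω ∈ N, C.coactL ω ∈ LinearMap.range (N.subtype.lTensor A)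
  coactR_mem : ∀ ω ∈ N, C.coactR ω ∈ LinearMap.range (N.subtype.rTensor A)

/-- An irreducible calculus: it is nonzero and has no proper nonzero quotient. -/
def IsIrreducible : Prop :=
  Nontrivial C.carrier ∧ ∀ N, C.IsBicovariantSub N → N = ⊥ ∨ N = ⊤

/-- The spaces of 1-forms of two calculi are isomorphic as bicovariant bimodules (the isomorphism
need not intertwine the exterior derivatives). -/
def Equivalent (C : BicovariantCalculus.{u, v, w} k A) (C' : BicovariantCalculus.{u, v, w'} k A) :
    Prop :=
  ∃ φ : C.carrier ≃ₗ[k] C'.carrier,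
    (∀ a ω, φ (C.lact a ω) = C'.lact a (φ ω)) ∧
    (∀ a ω, φ (C.ract a ω) = C'.ract a (φ ω)) ∧
    (∀ ω, C'.coactL (φ ω) = φ.toLinearMap.lTensor A (C.coactL ω)) ∧
    (∀ ω, C'.coactR (φ ω) = φ.toLinearMap.rTensor A (C.coactR ω))

/-- The space `Λ¹` of left-invariant 1-forms, `Δ_L ω = 1 ⊗ ω`. -/
def invForms : Submodule k C.carrier :=
  LinearMap.ker (C.coactL - TensorProduct.mk k A C.carrier 1)

/-- The dimension of a calculus, `dim Λ¹`. -/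
def dim : ℕ := Module.finrank k C.invForms

/-- The Maurer-Cartan form `a ↦ S(a₍₁₎) d a₍₂₎`, with values in `Λ¹`. On the augmentation ideal it
is the projection `A⁺ → Λ¹`. -/
def maurerCartan : A →ₗ[k] C.carrier :=
  TensorProduct.lift C.lact ∘ₗ TensorProduct.map (HopfAlgebra.antipode k) C.d ∘ₗ
    Coalgebra.comul (R := k)

/-- The quantum tangent space `L ⊆ H⁺ ⊆ H = A*`: the functionals that vanish on the kernel of the
Maurer-Cartan form (which contains `1`), so that `L` is the dual of `Λ¹`. -/
def tangentSpace : Submodule k (Module.Dual k A) :=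
  (LinearMap.ker C.maurerCartan).dualAnnihilator

/-- `adj a x = S(a₍₁₎) x a₍₂₎`; on `Λ¹` this is the right action `x ◁ a` of the crossed module. -/
def adj : A →ₗ[k] C.carrier →ₗ[k] C.carrier :=
  TensorProduct.lift ((LinearMap.mul k (Module.End k C.carrier)).flip.compl₁₂ C.lact C.ract) ∘ₗ
    TensorProduct.map (HopfAlgebra.antipode k) LinearMap.id ∘ₗ Coalgebra.comul (R := k)

/-- `x ⊗ y ↦ y₍₀₎ ⊗ (x ◁ y₍₁₎)`, where `Δ_R y = y₍₀₎ ⊗ y₍₁₎`; on `Λ¹ ⊗ Λ¹` this is the braiding `Ψ`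
of crossed modules. -/
def braiding : C.carrier ⊗[k] C.carrier →ₗ[k] C.carrier ⊗[k] C.carrier :=
  TensorProduct.lift (LinearMap.lcomp k (C.carrier ⊗[k] C.carrier) C.coactR ∘ₗ
    LinearMap.lTensorHom C.carrier ∘ₗ C.adj.flip)

/-- The kernel of `id - Ψ` on `Λ¹ ⊗ Λ¹`, inside `Ω¹ ⊗ Ω¹`. -/
def symmetricForms : Submodule k (C.carrier ⊗[k] C.carrier) :=
  LinearMap.range (TensorProduct.map C.invForms.subtype C.invForms.subtype) ⊓
    LinearMap.ker (LinearMap.id - C.braiding)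

/-- The kernel of `Ω¹ ⊗ Ω¹ → Ω²`: the relations of the tensor product over `A`, and the left ideal
generated by `ker (id - Ψ)`. -/
def relations : Submodule k (C.carrier ⊗[k] C.carrier) :=
  Submodule.span k {t | ∃ a ω η, C.ract a ω ⊗ₜ[k] η - ω ⊗ₜ[k] C.lact a η = t} ⊔
    Submodule.span k {t | ∃ a, ∃ z ∈ C.symmetricForms, (C.lact a).rTensor C.carrier z = t}

/-- The space `Ω² = A ⊗ Λ²` of 2-forms, `Λ² = Λ¹ ⊗ Λ¹ / ker (id - Ψ)`, as a quotient of
`Ω¹ ⊗_A Ω¹ = A ⊗ Λ¹ ⊗ Λ¹`. -/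
abbrev TwoForms : Type _ := (C.carrier ⊗[k] C.carrier) ⧸ C.relations

/-- The wedge product of two 1-forms. -/
def wedge (ω η : C.carrier) : C.TwoForms := C.relations.mkQ (ω ⊗ₜ[k] η)

/-- `D : Ω¹ → Ω²` is the exterior derivative on 1-forms: `D(a db) = da ∧ db`. -/
def IsExteriorDerivative (D : C.carrier →ₗ[k] C.TwoForms) : Prop :=
  ∀ a b, D (C.lact a (C.d b)) = C.wedge (C.d a) (C.d b)

/-- `H⁰ = ker (d : A → Ω¹)`. -/
def H0 : Submodule k A := LinearMap.ker C.d

/-- The class of a 1-form modulo exact forms. -/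
def cls : C.carrier →ₗ[k] C.carrier ⧸ LinearMap.range C.d := (LinearMap.range C.d).mkQ

/-- `H¹ = ker (D : Ω¹ → Ω²) / im (d : A → Ω¹)`, as a subspace of `Ω¹ / im d`. -/
def H1 (D : C.carrier →ₗ[k] C.TwoForms) : Submodule k (C.carrier ⧸ LinearMap.range C.d) :=
  (LinearMap.ker D).map C.cls

end BicovariantCalculus

/-! ## The 6-dimensional calculus on `D(S₃)` -/

/-- The symmetric group `S₃ = {e, u, u², s, us, u²s}`. -/
abbrev S3 : Type := Equiv.Perm (Fin 3)

namespace S3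

/-- The 3-cycle `u = (123)`. -/
def u : S3 := finRotate 3

/-- The transposition `s = (12)`. -/
def s : S3 := Equiv.swap 0 1

end S3

/-- For `v ∈ G`, `t ∈ M` (here `G = M`), the element `Π(v.t) = t ⊗ δ_v - δ_{v,e} 1` of `H⁺`, where
`H = A*` has the basis `t ⊗ δ_v` dual to `δ_t ⊗ v`, and the unit of `H` is the counit of `A`. -/
def tangentVector (k : Type u) [Field k] {G : Type v} [Group G] [DecidableEq G] [Fintype G]
    (v t : G) : Module.Dual k (QuantumDouble k G) :=
  QuantumDouble.basis.coord (t, v) - if v = 1 then Coalgebra.counit (R := k) else 0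

open S3 in
/-- The basis `f₀, …, f₅` of the quantum tangent space of the 6-dimensional calculus, for a primitive
cube root of unity `q`. -/
def tangentBasis {k : Type u} [Field k] (q : k) : Fin 6 → Module.Dual k (QuantumDouble k S3) :=
  let f (v t : S3) := tangentVector k v t
  ![f 1 s + q ^ 2 • f u (u ^ 2 * s) + q • f (u ^ 2) (u * s),
    f u s + q ^ 2 • f (u ^ 2) (u ^ 2 * s) + q • f 1 (u * s),
    f (u ^ 2) s + q ^ 2 • f 1 (u ^ 2 * s) + q • f u (u * s),
    f s s + q • f (u ^ 2 * s) (u * s) + q ^ 2 • f (u * s) (u ^ 2 * s),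
    f (u ^ 2 * s) s + q • f (u * s) (u * s) + q ^ 2 • f s (u ^ 2 * s),
    f (u * s) s + q • f s (u * s) + q ^ 2 • f (u ^ 2 * s) (u ^ 2 * s)]

end

/-! For a finite group `G`, a conjugacy class `c` and a representation `ρ` on `W` give a bicovariant
bimodule over `D(G)` spanned by arrows `s → t` with `s⁻¹t ∈ c`, carrying a group element and a
vector of `W`. Its bi-invariant forms are the `innerForm` of vectors `w`, and the commutator with
such a form `θ` is a differential. If `ρ` is simple and `w ≠ 0` (and `w` is not fixed by `G` when
`c` is trivial), this is a calculus (`span_lact_innerD`). It is irreducible because any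
sub-bicomodule-bimodule is determined by an invariant subspace of `W` (`isIrreducible_calculus`).
Equivalence recovers `c` and `ρ` (`eq_and_exists_of_equivalent`), and the dimension is `|c| · dim
W`.

Conversely, averaging makes every bicovariant calculus inner by a bi-invariant `θ` (`exists_inner`).
The forms `arrow θ s t u g` are functions of `g`, and pairing them with matrix coefficients of `ρ`
gives homomorphisms from the path bimodules (`isHom_coeffHom`). By Schur's lemma, one nonzero
homomorphism out of a nontrivial pair `(c, ρ)` identifies an irreducible calculus. If all of them
vanished, the decomposition of the regular character of `S₃` would make the arrows independent of
`g` and zero off the diagonal, so that `d = 0`. Hence the eight calculi are the pairs (class,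
irreducible representation) other than (trivial, trivial).

For `H⁰`, the coefficient of `da` at an arrow `s → t` decorated by `v` is `a(t,v) w - a(s,v) ρ(v) w`
(`val_innerD`), a twisted gradient. For every pair except (reflections, 2-dimensional) an explicit
nonconstant element lies in the kernel, whatever the bi-invariant form. For that pair, with `w` an
eigenvector of the 3-cycle, walking along the bipartite graph of even and odd permutations leaves
only the constants. The tangent space is read off from the coefficients of the Maurer-Cartan form in
an explicit basis of `Λ¹`.

For `H¹`, the exterior derivative is the anticommutator with `θ`. The braiding on left-invariant
forms is the conjugation braiding with the vectors exchanged (`braiding_leftForm`), so explicit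
functionals on pairs of composable arrows descend to `Ω²`. They turn `Dω = 0` into equations on the
coefficients of `ω` (`val_of_closed`). A discrete Poincaré lemma on the bipartite graph solves these
equations: a closed form is exact up to the two bi-invariant forms attached to the eigenvectors of
the 3-cycle, and these are independent modulo exact forms. -/

noncomputable section

/-! ### The space of decorated arrows -/

/-- The space of formal sums of arrows `s → t` decorated with `u ∈ G` and a vector of `W`, for
`s⁻¹ t` in a fixed conjugacy class. -/
def PathForms {G : Type v} [Group G] (c : ConjClasses G) (W : Type w)
    [AddCommGroup W] : Type (max v w) :=
  {p : G × G × G // ConjClasses.mk (p.1⁻¹ * p.2.1) = c} →₀ W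

theorem ConjClasses.mk_conj {G : Type v} [Group G] (g x : G) :
    ConjClasses.mk (g * x * g⁻¹) = ConjClasses.mk x :=
  ConjClasses.mk_eq_mk_iff_isConj.2 (isConj_iff.2 ⟨g⁻¹, by group⟩)

namespace PathForms

open QuantumDouble

section Space

variable {k : Type u} [Field k] {G : Type v} [Group G] {c : ConjClasses G}
  {W : Type w} [AddCommGroup W] [Module k W]

instance : AddCommGroup (PathForms c W) :=
  inferInstanceAs (AddCommGroup ({p : G × G × G // ConjClasses.mk (p.1⁻¹ * p.2.1) = c} →₀ W))
instance : Module k (PathForms c W) :=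
  inferInstanceAs (Module k ({p : G × G × G // ConjClasses.mk (p.1⁻¹ * p.2.1) = c} →₀ W))

variable (k c W) in
/-- The identification with finitely supported functions. -/
def repr : PathForms c W ≃ₗ[k]
    ({p : G × G × G // ConjClasses.mk (p.1⁻¹ * p.2.1) = c} →₀ W) :=
  LinearEquiv.refl k ({p : G × G × G // ConjClasses.mk (p.1⁻¹ * p.2.1) = c} →₀ W)

variable (k c) in
open scoped Classical in
/-- The arrow `s → t` with decorations `u` and `b`; it is `0` if `s⁻¹ t` is not in `c`. -/
def path (s t u : G) : W →ₗ[k] PathForms c W :=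
  if h : ConjClasses.mk (s⁻¹ * t) = c then
    (repr k c W).symm.toLinearMap ∘ₗ Finsupp.lsingle ⟨(s, t, u), h⟩
  else 0

variable (k c) in
open scoped Classical in
/-- The coefficient of a form at the arrow `s → t` with decoration `u`. -/
def val (s t u : G) : PathForms c W →ₗ[k] W :=
  if h : ConjClasses.mk (s⁻¹ * t) = c then
    Finsupp.lapply ⟨(s, t, u), h⟩ ∘ₗ (repr k c W).toLinearMap
  else 0

/-- The linear map with prescribed values on the arrows. -/
def lift {V : Type*} [AddCommGroup V] [Module k V] (f : G → G → G → W →ₗ[k] V) :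
    PathForms c W →ₗ[k] V :=
  Finsupp.lsum k (fun p => f p.1.1 p.1.2.1 p.1.2.2) ∘ₗ (repr k c W).toLinearMap

theorem path_of_ne {s t : G} (h : ConjClasses.mk (s⁻¹ * t) ≠ c) (u : G) (b : W) :
    path k c s t u b = 0 := by
  rw [path, dif_neg h, LinearMap.zero_apply]

theorem val_of_ne {s t : G} (h : ConjClasses.mk (s⁻¹ * t) ≠ c) (u : G) (ω : PathForms c W) :
    val k c s t u ω = 0 := by
  rw [val, dif_neg h, LinearMap.zero_apply]

theorem path_of_eq {s t : G} (h : ConjClasses.mk (s⁻¹ * t) = c) (u : G) (b : W) :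
    path k c s t u b = (repr k c W).symm (Finsupp.single ⟨(s, t, u), h⟩ b) := by
  rw [path, dif_pos h]; rfl

theorem val_of_eq {s t : G} (h : ConjClasses.mk (s⁻¹ * t) = c) (u : G) (ω : PathForms c W) :
    val k c s t u ω = repr k c W ω ⟨(s, t, u), h⟩ := by
  rw [val, dif_pos h]; rfl

theorem lift_path {V : Type*} [AddCommGroup V] [Module k V] (f : G → G → G → W →ₗ[k] V)
    (s t u : G) (b : W) (h : ConjClasses.mk (s⁻¹ * t) ≠ c → f s t u b = 0) :
    lift f (path k c s t u b) = f s t u b := by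
  by_cases hc : ConjClasses.mk (s⁻¹ * t) = c
  · simp [path_of_eq hc, lift]
  · rw [path_of_ne hc, map_zero, h hc]

theorem hom_ext {V : Type*} [AddCommGroup V] [Module k V] {f g : PathForms c W →ₗ[k] V}
    (h : ∀ s t u, ConjClasses.mk (s⁻¹ * t) = c → ∀ b, f (path k c s t u b) = g (path k c s t u b)) :
    f = g := by
  have : f ∘ₗ (repr k c W).symm.toLinearMap = g ∘ₗ (repr k c W).symm.toLinearMap := by
    refine Finsupp.lhom_ext fun ⟨⟨s, t, u⟩, hp⟩ b => ?_
    have := h s t u hp b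
    rwa [path_of_eq hp] at this
  refine LinearMap.ext fun ω => ?_
  simpa using LinearMap.congr_fun this (repr k c W ω)

theorem val_path [DecidableEq G] {s t : G} (h : ConjClasses.mk (s⁻¹ * t) = c) (u s' t' u' : G)
    (b : W) : val k c s t u (path k c s' t' u' b) =
      if s' = s then if t' = t then if u' = u then b else 0 else 0 else 0 := by
  classical
  by_cases h' : ConjClasses.mk (s'⁻¹ * t') = c
  · rw [path_of_eq h', val_of_eq h]
    simp [Finsupp.single_apply, ite_and]
  · rw [path_of_ne h', map_zero]
    split_ifs with h1 h2 h3
    · subst h1 h2; exact absurd h h'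
    all_goals rfl

theorem ext {ω η : PathForms c W}
    (h : ∀ s t u, ConjClasses.mk (s⁻¹ * t) = c → val k c s t u ω = val k c s t u η) : ω = η := by
  refine (repr k c W).injective (Finsupp.ext fun ⟨⟨s, t, u⟩, hp⟩ => ?_)
  have := h s t u hp
  rwa [val_of_eq hp, val_of_eq hp] at this

theorem sum_path_val [Fintype G] (ω : PathForms c W) :
    ∑ s, ∑ t, ∑ u, path k c s t u (val k c s t u ω) = ω := by
  classical
  refine ext (k := k) fun s t u h => ?_
  simp [map_sum, val_path h]

end Space

/-! ### Bimodule and bicomodule structure on the arrows -/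

section Structure

variable {k : Type u} [Field k] {G : Type v} [Group G] [DecidableEq G] [Fintype G]
  {c : ConjClasses G} {W : Type w} [AddCommGroup W] [Module k W] (ρ : Representation k G W)

/-- The left action of `D(G)`. -/
def lact : QuantumDouble k G →ₗ[k] PathForms c W →ₗ[k] PathForms c W :=
  QuantumDouble.lift fun r g => lift fun s t u =>
    if g⁻¹ * r * g = s then path k c r (g * t * g⁻¹) (g * u) ∘ₗ ρ g else 0

/-- The right action of `D(G)`. -/
def ract : QuantumDouble k G →ₗ[k] PathForms c W →ₗ[k] PathForms c W :=
  QuantumDouble.lift fun r g => lift fun s t u =>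
    if u⁻¹ * t * u = r then path k c s t (u * g) else 0

/-- The left coaction of `D(G)`. -/
def coactL : PathForms c W →ₗ[k] QuantumDouble k G ⊗[k] PathForms c W :=
  lift fun s t u => ∑ x, TensorProduct.mk k _ _ (delta k x u) ∘ₗ path k c (x⁻¹ * s) (x⁻¹ * t) u

/-- The right coaction of `D(G)`. -/
def coactR : PathForms c W →ₗ[k] PathForms c W ⊗[k] QuantumDouble k G :=
  lift fun s t u => ∑ y,
    (TensorProduct.mk k _ _).flip (delta k y u) ∘ₗ path k c (s * y⁻¹) (t * y⁻¹) u

theorem lact_path (r g s t u : G) (b : W) :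
    lact ρ (delta k r g) (path k c s t u b) =
      if g⁻¹ * r * g = s then path k c r (g * t * g⁻¹) (g * u) (ρ g b) else 0 := by
  rw [lact, QuantumDouble.lift_delta, lift_path]
  · split_ifs <;> rfl
  · intro h
    split_ifs with hr
    · refine path_of_ne (fun h' => h ?_) _ _
      rw [← h', ← ConjClasses.mk_conj g, ← hr]
      congr 1; group
    · rfl

theorem ract_path (r g s t u : G) (b : W) :
    ract (delta k r g) (path k c s t u b) =
      if u⁻¹ * t * u = r then path k c s t (u * g) b else 0 := by
  rw [ract, QuantumDouble.lift_delta, lift_path]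
  · split_ifs <;> rfl
  · intro h
    split_ifs with hr
    · exact path_of_ne h _ _
    · rfl

theorem coactL_path (s t u : G) (b : W) :
    coactL (path k c s t u b) = ∑ x, delta k x u ⊗ₜ path k c (x⁻¹ * s) (x⁻¹ * t) u b := by
  rw [coactL, lift_path]
  · simp
  · intro h
    rw [LinearMap.sum_apply]
    refine Finset.sum_eq_zero fun x _ => ?_
    rw [LinearMap.comp_apply, path_of_ne, map_zero]
    intro h'; apply h; rw [← h']; congr 1; group

theorem coactR_path (s t u : G) (b : W) :
    coactR (path k c s t u b) = ∑ y, path k c (s * y⁻¹) (t * y⁻¹) u b ⊗ₜ delta k y u := by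
  rw [coactR, lift_path]
  · simp
  · intro h
    rw [LinearMap.sum_apply]
    refine Finset.sum_eq_zero fun y _ => ?_
    rw [LinearMap.comp_apply, path_of_ne, map_zero]
    intro h'; apply h; rw [← h', ← ConjClasses.mk_conj y]; congr 1; group

/-- The bi-invariant form `∑ₛₜ (s → t) ⊗ b`. -/
def innerForm (k : Type u) [Field k] {G : Type v} [Group G] [Fintype G] (c : ConjClasses G)
    {W : Type w} [AddCommGroup W] [Module k W] (b : W) : PathForms c W :=
  ∑ s, ∑ t, path k c s t 1 b

theorem lact_innerForm (r g : G) (b : W) :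
    lact ρ (delta k r g) (innerForm k c b) = ∑ t, path k c r t g (ρ g b) := by
  simp only [innerForm, map_sum, lact_path]
  rw [Finset.sum_eq_single (g⁻¹ * r * g)]
  · simp only [if_true, mul_one]
    exact Fintype.sum_equiv (MulAut.conj g).toEquiv _ _ fun t => rfl
  · intro s _ hs
    simp [Ne.symm hs]
  · simp

theorem ract_innerForm (r g : G) (b : W) :
    ract (delta k r g) (innerForm k c b) = ∑ s, path k c s r g b := by
  simp [innerForm, ract_path]

/-- The inner derivation defined by the bi-invariant form. -/
def innerD (b : W) : QuantumDouble k G →ₗ[k] PathForms c W :=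
  ract.flip (innerForm k c b) - (lact ρ).flip (innerForm k c b)

theorem innerD_delta (t v : G) (b : W) :
    innerD ρ (c := c) b (delta k t v) = ∑ s, path k c s t v b - ∑ s, path k c t s v (ρ v b) := by
  simp [innerD, ract_innerForm, lact_innerForm]

theorem bilin_ext {V : Type*} [AddCommGroup V] [Module k V]
    {f g : QuantumDouble k G →ₗ[k] PathForms c W →ₗ[k] V}
    (h : ∀ r x s t u, ConjClasses.mk (s⁻¹ * t) = c → ∀ b,
      f (delta k r x) (path k c s t u b) = g (delta k r x) (path k c s t u b)) : f = g :=
  QuantumDouble.hom_ext fun r x => hom_ext (h r x)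

theorem one_lact (ω : PathForms c W) : lact ρ 1 ω = ω := by
  refine LinearMap.congr_fun (hom_ext (k := k) (g := LinearMap.id) fun s t u _ b => ?_) ω
  simp [one_def, lact_path]

theorem one_ract (ω : PathForms c W) : ract (k := k) 1 ω = ω := by
  refine LinearMap.congr_fun (hom_ext (k := k) (g := LinearMap.id) fun s t u _ b => ?_) ω
  simp [one_def, ract_path]

theorem mul_lact (a b : QuantumDouble k G) (ω : PathForms c W) :
    lact ρ (a * b) ω = lact ρ a (lact ρ b ω) := by
  have : (LinearMap.mul k (QuantumDouble k G)).compr₂ (lact (c := c) ρ) =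
      (LinearMap.mul k (Module.End k (PathForms c W))).compl₁₂ (lact ρ) (lact ρ) := by
    refine QuantumDouble.hom_ext fun r g => bilin_ext fun r' g' s t u _ b => ?_
    simp only [LinearMap.compr₂_apply, LinearMap.mul_apply', LinearMap.compl₁₂_apply,
      Module.End.mul_apply, delta_mul_delta, lact_path]
    by_cases h1 : g'⁻¹ * r' * g' = s
    · subst h1
      by_cases h2 : g⁻¹ * r * g = r'
      · subst h2
        simp [lact_path, mul_assoc]
      · simp [h2, lact_path]
    · by_cases h2 : g⁻¹ * r * g = r'
      · subst h2
        simp only [if_true, lact_path, h1, if_false, map_zero]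
        rw [if_neg]
        simpa [mul_assoc] using h1
      · simp [h1, h2]
  exact LinearMap.congr_fun (LinearMap.congr_fun₂ this a b) ω

theorem mul_ract (a b : QuantumDouble k G) (ω : PathForms c W) :
    ract (a * b) ω = ract b (ract a ω) := by
  have : (LinearMap.mul k (QuantumDouble k G)).compr₂ (ract (c := c) (W := W)) =
      (LinearMap.mul k (Module.End k (PathForms c W))).flip.compl₁₂ ract ract := by
    refine QuantumDouble.hom_ext fun r g => bilin_ext fun r' g' s t u _ b => ?_
    simp only [LinearMap.compr₂_apply, LinearMap.mul_apply', LinearMap.compl₁₂_apply,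
      Module.End.mul_apply, delta_mul_delta, ract_path, LinearMap.flip_apply]
    by_cases h1 : u⁻¹ * t * u = r
    · subst h1
      by_cases h2 : g⁻¹ * (u⁻¹ * t * u) * g = r'
      · subst h2
        simp [ract_path, mul_assoc]
      · simp only [h2, if_false, if_true, ract_path, map_zero, LinearMap.zero_apply]
        rw [if_neg]
        simpa [mul_assoc] using h2
    · by_cases h2 : g⁻¹ * r * g = r'
      · simp [h2, ract_path, h1]
      · simp [h1, h2]
  exact LinearMap.congr_fun (LinearMap.congr_fun₂ this a b) ω

theorem lact_ract (a b : QuantumDouble k G) (ω : PathForms c W) :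
    lact ρ a (ract b ω) = ract b (lact ρ a ω) := by
  have : (LinearMap.mul k (Module.End k (PathForms c W))).compl₁₂ (lact ρ) ract =
      (LinearMap.mul k (Module.End k (PathForms c W))).flip.compl₁₂ (lact ρ) ract := by
    refine QuantumDouble.hom_ext fun r g => bilin_ext fun r' g' s t u _ b => ?_
    simp only [LinearMap.mul_apply', LinearMap.compl₁₂_apply,
      Module.End.mul_apply, ract_path, lact_path, LinearMap.flip_apply]
    by_cases h1 : u⁻¹ * t * u = r'
    · subst h1
      by_cases h2 : g⁻¹ * r * g = s
      · subst h2
        simp [ract_path, lact_path, mul_assoc]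
      · simp [h2, lact_path]
    · by_cases h2 : g⁻¹ * r * g = s
      · subst h2
        simp only [if_true, ract_path, h1, if_false, map_zero]
        rw [if_neg]
        simpa [mul_assoc] using h1
      · simp [h1, h2]
  exact LinearMap.congr_fun (LinearMap.congr_fun₂ this a b) ω

theorem coactL_coassoc (ω : PathForms c W) :
    TensorProduct.assoc k _ _ _ ((Coalgebra.comul (R := k) (A := QuantumDouble k G)).rTensor _
      (coactL ω)) = coactL.lTensor _ (coactL (k := k) ω) := by
  refine LinearMap.congr_fun (f := (TensorProduct.assoc k _ _ _).toLinearMap ∘ₗ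
    (Coalgebra.comul (R := k) (A := QuantumDouble k G)).rTensor _ ∘ₗ coactL)
    (g := coactL.lTensor _ ∘ₗ coactL) (hom_ext fun s t u _ b => ?_) ω
  simp only [LinearMap.comp_apply, coactL_path, map_sum, LinearMap.rTensor_tmul, comul_delta,
    TensorProduct.sum_tmul, LinearEquiv.coe_coe, TensorProduct.assoc_tmul, LinearMap.lTensor_tmul,
    TensorProduct.tmul_sum]
  rw [Finset.sum_comm]
  refine Finset.sum_congr rfl fun x _ => Fintype.sum_equiv (Equiv.mulLeft x⁻¹) _ _ fun y => ?_
  simp [mul_assoc]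

theorem coactR_coassoc (ω : PathForms c W) :
    TensorProduct.assoc k _ _ _ (coactR.rTensor _ (coactR (k := k) ω)) =
      (Coalgebra.comul (R := k) (A := QuantumDouble k G)).lTensor _ (coactR ω) := by
  refine LinearMap.congr_fun (f := (TensorProduct.assoc k _ _ _).toLinearMap ∘ₗ
    coactR.rTensor _ ∘ₗ coactR)
    (g := (Coalgebra.comul (R := k) (A := QuantumDouble k G)).lTensor _ ∘ₗ coactR)
    (hom_ext fun s t u _ b => ?_) ω
  simp only [LinearMap.comp_apply, coactR_path, map_sum, LinearMap.rTensor_tmul, comul_delta,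
    TensorProduct.sum_tmul, LinearEquiv.coe_coe, TensorProduct.assoc_tmul, LinearMap.lTensor_tmul,
    TensorProduct.tmul_sum]
  rw [Finset.sum_comm]
  conv_rhs => rw [Finset.sum_comm]
  refine Finset.sum_congr rfl fun x _ => Fintype.sum_equiv (Equiv.mulLeft x) _ _ fun y => ?_
  simp [mul_assoc]

theorem coactL_counit (ω : PathForms c W) :
    TensorProduct.lid k _ ((Coalgebra.counit (R := k) (A := QuantumDouble k G)).rTensor _
      (coactL ω)) = ω := by
  refine LinearMap.congr_fun (f := (TensorProduct.lid k _).toLinearMap ∘ₗ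
    (Coalgebra.counit (R := k) (A := QuantumDouble k G)).rTensor _ ∘ₗ coactL)
    (g := LinearMap.id) (hom_ext fun s t u _ b => ?_) ω
  simp [coactL_path, counit_delta]

theorem coactR_counit (ω : PathForms c W) :
    TensorProduct.rid k _ ((Coalgebra.counit (R := k) (A := QuantumDouble k G)).lTensor _
      (coactR ω)) = ω := by
  refine LinearMap.congr_fun (f := (TensorProduct.rid k _).toLinearMap ∘ₗ
    (Coalgebra.counit (R := k) (A := QuantumDouble k G)).lTensor _ ∘ₗ coactR)
    (g := LinearMap.id) (hom_ext fun s t u _ b => ?_) ω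
  simp [coactR_path, counit_delta]

theorem coact_comm (ω : PathForms c W) :
    TensorProduct.assoc k (QuantumDouble k G) _ (QuantumDouble k G)
      (coactL.rTensor _ (coactR (k := k) ω)) = coactR.lTensor _ (coactL ω) := by
  refine LinearMap.congr_fun (f := (TensorProduct.assoc k _ _ _).toLinearMap ∘ₗ
    coactL.rTensor _ ∘ₗ coactR) (g := coactR.lTensor _ ∘ₗ coactL)
    (hom_ext fun s t u _ b => ?_) ω
  simp only [LinearMap.comp_apply, coactR_path, coactL_path, map_sum, LinearMap.rTensor_tmul,
    TensorProduct.sum_tmul, LinearEquiv.coe_coe, TensorProduct.assoc_tmul, LinearMap.lTensor_tmul,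
    TensorProduct.tmul_sum]
  rw [Finset.sum_comm]
  simp [mul_assoc]

theorem coactL_lact (a : QuantumDouble k G) (ω : PathForms c W) : coactL (lact ρ a ω) =
    TensorProduct.map₂ (LinearMap.mul k _) (lact ρ) (Coalgebra.comul (R := k) a) (coactL ω) := by
  refine LinearMap.congr_fun₂ (f := (lact ρ).compr₂ coactL)
    (g := (TensorProduct.map₂ (LinearMap.mul k (QuantumDouble k G)) (lact ρ)).compl₁₂
      (Coalgebra.comul (R := k)) coactL) (bilin_ext fun r g s t u _ b => ?_) a ω
  simp only [LinearMap.compr₂_apply, LinearMap.compl₁₂_apply, comul_delta, coactL_path, map_sum,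
    LinearMap.sum_apply, TensorProduct.map₂_apply_tmul, TensorProduct.map_tmul, LinearMap.mul_apply',
    delta_mul_delta,
    lact_path]
  -- The first factor forces `y = g⁻¹xg`. After this substitution the condition on the second factor
  -- no longer involves `x`, so the double sum collapses to the coaction of the product.
  have h : ∀ x y : G, ((if g⁻¹ * x * g = y then delta k x (g * u) else 0) ⊗ₜ[k]
      if g⁻¹ * (x⁻¹ * r) * g = y⁻¹ * s then
        path k c (x⁻¹ * r) (g * (y⁻¹ * t) * g⁻¹) (g * u) (ρ g b) else 0) =
      if g⁻¹ * x * g = y then if g⁻¹ * r * g = s then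
        delta k x (g * u) ⊗ₜ[k] path k c (x⁻¹ * r) (x⁻¹ * (g * t * g⁻¹)) (g * u) (ρ g b)
        else 0 else 0 := by
    intro x y
    by_cases hy : g⁻¹ * x * g = y
    · subst hy
      by_cases hr : g⁻¹ * r * g = s
      · subst hr
        simp [mul_assoc]
      · simp only [if_true, if_neg hr]
        rw [if_neg, TensorProduct.tmul_zero]
        intro h; apply hr
        have := congrArg (fun z => g⁻¹ * x * g * z) h
        simpa [mul_assoc] using this
    · simp [hy]
  simp only [h]
  rw [Finset.sum_comm]
  by_cases hr : g⁻¹ * r * g = s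
  · simp [hr, coactL_path]
  · simp [hr]

theorem coactL_ract (a : QuantumDouble k G) (ω : PathForms c W) : coactL (ract a ω) =
    TensorProduct.map₂ (LinearMap.mul k _).flip ract (Coalgebra.comul (R := k) a) (coactL ω) := by
  refine LinearMap.congr_fun₂ (f := ract.compr₂ coactL)
    (g := (TensorProduct.map₂ (LinearMap.mul k (QuantumDouble k G)).flip ract).compl₁₂
      (Coalgebra.comul (R := k)) coactL) (bilin_ext fun r g s t u _ b => ?_) a ω
  simp only [LinearMap.compr₂_apply, LinearMap.compl₁₂_apply, comul_delta, coactL_path, map_sum,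
    LinearMap.sum_apply, TensorProduct.map₂_apply_tmul, TensorProduct.map_tmul, LinearMap.mul_apply',
    delta_mul_delta,
    ract_path, LinearMap.flip_apply]
  have h : ∀ x y : G, ((if u⁻¹ * y * u = x then delta k y (u * g) else 0) ⊗ₜ[k]
      if u⁻¹ * (y⁻¹ * t) * u = x⁻¹ * r then
        path k c (y⁻¹ * s) (y⁻¹ * t) (u * g) b else 0) =
      if u⁻¹ * y * u = x then if u⁻¹ * t * u = r then
        delta k y (u * g) ⊗ₜ[k] path k c (y⁻¹ * s) (y⁻¹ * t) (u * g) b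
        else 0 else 0 := by
    intro x y
    by_cases hy : u⁻¹ * y * u = x
    · subst hy
      by_cases hr : u⁻¹ * t * u = r
      · subst hr
        simp [mul_assoc]
      · simp only [if_true, if_neg hr]
        rw [if_neg, TensorProduct.tmul_zero]
        intro h; apply hr
        have := congrArg (fun z => u⁻¹ * y * u * z) h
        simpa [mul_assoc] using this
    · simp [hy]
  simp only [h]
  by_cases hr : u⁻¹ * t * u = r
  · simp [hr, coactL_path]
  · simp [hr]

theorem coactR_lact (a : QuantumDouble k G) (ω : PathForms c W) : coactR (lact ρ a ω) =
    TensorProduct.map₂ (lact ρ) (LinearMap.mul k _) (Coalgebra.comul (R := k) a) (coactR ω) := by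
  refine LinearMap.congr_fun₂ (f := (lact ρ).compr₂ coactR)
    (g := (TensorProduct.map₂ (lact ρ) (LinearMap.mul k (QuantumDouble k G))).compl₁₂
      (Coalgebra.comul (R := k)) coactR) (bilin_ext fun r g s t u _ b => ?_) a ω
  simp only [LinearMap.compr₂_apply, LinearMap.compl₁₂_apply, comul_delta, coactR_path, map_sum,
    LinearMap.sum_apply, TensorProduct.map₂_apply_tmul, TensorProduct.map_tmul, LinearMap.mul_apply',
    delta_mul_delta,
    lact_path]
  have h : ∀ x y : G, ((if g⁻¹ * x * g = s * y⁻¹ then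
        path k c x (g * (t * y⁻¹) * g⁻¹) (g * u) (ρ g b) else 0) ⊗ₜ[k]
      if g⁻¹ * (x⁻¹ * r) * g = y then delta k (x⁻¹ * r) (g * u) else 0) =
      if g⁻¹ * (x⁻¹ * r) * g = y then if g⁻¹ * r * g = s then
        path k c (r * (x⁻¹ * r)⁻¹) (g * t * g⁻¹ * (x⁻¹ * r)⁻¹) (g * u) (ρ g b) ⊗ₜ[k]
          delta k (x⁻¹ * r) (g * u)
        else 0 else 0 := by
    intro x y
    by_cases hy : g⁻¹ * (x⁻¹ * r) * g = y
    · subst hy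
      by_cases hr : g⁻¹ * r * g = s
      · subst hr
        simp [mul_assoc]
      · simp only [if_true, if_neg hr]
        rw [if_neg, TensorProduct.zero_tmul]
        intro h; apply hr
        have := congrArg (fun z => z * (g⁻¹ * (x⁻¹ * r) * g)) h
        simpa [mul_assoc] using this
    · simp [hy]
  simp only [h]
  rw [Finset.sum_comm]
  by_cases hr : g⁻¹ * r * g = s
  · simp only [hr, if_true, coactR_path]
    simp only [Finset.sum_ite_eq, Finset.mem_univ, if_true]
    exact Fintype.sum_equiv ((Equiv.inv G).trans (Equiv.mulRight r)) _ _ (fun x => rfl) |>.symm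
  · simp [hr]

theorem coactR_ract (a : QuantumDouble k G) (ω : PathForms c W) : coactR (ract a ω) =
    TensorProduct.map₂ ract (LinearMap.mul k _).flip (Coalgebra.comul (R := k) a) (coactR ω) := by
  refine LinearMap.congr_fun₂ (f := ract.compr₂ coactR)
    (g := (TensorProduct.map₂ ract (LinearMap.mul k (QuantumDouble k G)).flip).compl₁₂
      (Coalgebra.comul (R := k)) coactR) (bilin_ext fun r g s t u _ b => ?_) a ω
  simp only [LinearMap.compr₂_apply, LinearMap.compl₁₂_apply, comul_delta, coactR_path, map_sum,
    LinearMap.sum_apply, TensorProduct.map₂_apply_tmul, TensorProduct.map_tmul, LinearMap.mul_apply',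
    delta_mul_delta,
    ract_path, LinearMap.flip_apply]
  have h : ∀ x y : G, ((if u⁻¹ * (t * y⁻¹) * u = x then
        path k c (s * y⁻¹) (t * y⁻¹) (u * g) b else 0) ⊗ₜ[k]
      if u⁻¹ * y * u = x⁻¹ * r then delta k y (u * g) else 0) =
      if u⁻¹ * (t * y⁻¹) * u = x then if u⁻¹ * t * u = r then
        path k c (s * y⁻¹) (t * y⁻¹) (u * g) b ⊗ₜ[k] delta k y (u * g)
        else 0 else 0 := by
    intro x y
    by_cases hy : u⁻¹ * (t * y⁻¹) * u = x
    · subst hy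
      by_cases hr : u⁻¹ * t * u = r
      · subst hr
        simp [mul_assoc]
      · simp only [if_true, if_neg hr]
        rw [if_neg, TensorProduct.tmul_zero]
        intro h; apply hr
        have := congrArg (fun z => u⁻¹ * (t * y⁻¹) * u * z) h
        simpa [mul_assoc] using this
    · simp [hy]
  simp only [h]
  by_cases hr : u⁻¹ * t * u = r
  · simp [hr, coactR_path]
  · simp [hr]

end Structure
end PathForms
end

/-! ### The inner calculus of a class and a simple representation -/

noncomputable section

/-- A nonzero representation without proper nonzero invariant subspaces. -/
structure Representation.IsSimple {k : Type u} [Field k] {G : Type v} [Group G] {W : Type w}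
    [AddCommGroup W] [Module k W] (ρ : Representation k G W) : Prop where
  nontrivial : Nontrivial W
  eq_bot_or_eq_top : ∀ N : Submodule k W, (∀ g, ∀ b ∈ N, ρ g b ∈ N) → N = ⊥ ∨ N = ⊤

namespace PathForms

open QuantumDouble

variable {k : Type u} [Field k] {G : Type v} [Group G] [DecidableEq G] [Fintype G]
  {c : ConjClasses G} {W : Type w} [AddCommGroup W] [Module k W] (ρ : Representation k G W)

theorem innerD_mul (w : W) (a b : QuantumDouble k G) : innerD ρ (c := c) w (a * b) =
    lact ρ a (innerD ρ w b) + ract b (innerD ρ w a) := by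
  simp only [innerD, LinearMap.sub_apply, LinearMap.flip_apply, mul_lact, mul_ract, map_sub,
    lact_ract]
  abel

theorem coactL_innerD (w : W) (a : QuantumDouble k G) : coactL (innerD ρ (c := c) w a) =
    (innerD ρ w).lTensor _ (Coalgebra.comul (R := k) a) := by
  refine LinearMap.congr_fun (f := coactL ∘ₗ innerD ρ w)
    (g := (innerD ρ w).lTensor _ ∘ₗ Coalgebra.comul (R := k))
    (QuantumDouble.hom_ext fun t v => ?_) a
  simp only [LinearMap.comp_apply, innerD_delta, comul_delta, map_sum, map_sub, coactL_path,
    LinearMap.lTensor_tmul, TensorProduct.tmul_sub, TensorProduct.tmul_sum,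
    Finset.sum_sub_distrib]
  congr 1 <;> rw [Finset.sum_comm] <;> refine Finset.sum_congr rfl fun x _ => ?_ <;>
    exact Fintype.sum_equiv (Equiv.mulLeft x⁻¹) _ _ fun s => rfl

theorem coactR_innerD (w : W) (a : QuantumDouble k G) : coactR (innerD ρ (c := c) w a) =
    (innerD ρ w).rTensor _ (Coalgebra.comul (R := k) a) := by
  refine LinearMap.congr_fun (f := coactR ∘ₗ innerD ρ w)
    (g := (innerD ρ w).rTensor _ ∘ₗ Coalgebra.comul (R := k))
    (QuantumDouble.hom_ext fun t v => ?_) a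
  simp only [LinearMap.comp_apply, innerD_delta, comul_delta, map_sum, map_sub, coactR_path,
    LinearMap.rTensor_tmul, TensorProduct.sub_tmul, TensorProduct.sum_tmul,
    Finset.sum_sub_distrib]
  congr 1 <;> rw [Finset.sum_comm] <;>
    refine Fintype.sum_equiv ((Equiv.inv G).trans (Equiv.mulLeft t)) _ _ fun x => ?_ <;>
    refine Fintype.sum_equiv (Equiv.mulRight x⁻¹) _ _ fun s => ?_ <;> simp

theorem lact_innerD (r g t v : G) (w : W) :
    lact ρ (delta k r g) (innerD ρ (c := c) w (delta k t v)) =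
      path k c r (g * t * g⁻¹) (g * v) (ρ g w) -
        if g⁻¹ * r * g = t then ∑ s, path k c r s (g * v) (ρ (g * v) w) else 0 := by
  simp only [innerD_delta, map_sub, map_sum, lact_path]
  congr 1
  · simp
  · split_ifs with h
    · refine Fintype.sum_equiv (MulAut.conj g).toEquiv _ _ fun s => ?_
      simp
    · simp

-- A suitable product `a db` isolates a single arrow. Off the diagonal its vector is `ρ(g) w`, and
-- the orbit of `w` spans a simple representation. On the diagonal only differences `ρ(g) w - w` are
-- reached. They span an invariant subspace, which is nonzero exactly because some `g` moves `w`;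
-- this is why the hypothesis on the trivial class is needed.
variable {ρ} in
theorem span_lact_innerD (hρ : ρ.IsSimple) {w : W} (hw : w ≠ 0)
    (hc : c = ConjClasses.mk 1 → ∃ g, ρ g w ≠ w) :
    Submodule.span k {ω : PathForms c W | ∃ a b, lact ρ a (innerD ρ w b) = ω} = ⊤ := by
  set N := Submodule.span k {ω : PathForms c W | ∃ a b, lact ρ a (innerD ρ w b) = ω}
  suffices H : ∀ s t u b, ConjClasses.mk (s⁻¹ * t) = c → path k c s t u b ∈ N by
    refine eq_top_iff.2 fun ω _ => ?_
    rw [← sum_path_val (k := k) ω]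
    refine Submodule.sum_mem _ fun s _ => Submodule.sum_mem _ fun t _ =>
      Submodule.sum_mem _ fun u _ => ?_
    by_cases h : ConjClasses.mk (s⁻¹ * t) = c
    · exact H _ _ _ _ h
    · rw [path_of_ne h]; exact N.zero_mem
  have hN : ∀ r g t v, lact ρ (delta k r g) (innerD ρ (c := c) w (delta k t v)) ∈ N :=
    fun r g t v => Submodule.subset_span ⟨_, _, rfl⟩
  intro s t u b h
  by_cases h1 : c = ConjClasses.mk 1
  · have hst : ∀ s t : G, ConjClasses.mk (s⁻¹ * t) = c ↔ t = s := by
      intro s t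
      rw [h1, ConjClasses.mk_eq_mk_iff_isConj, isConj_comm, isConj_one_right, inv_mul_eq_one]
      exact eq_comm
    obtain rfl := (hst _ _).1 h
    -- The product chosen below gives `ρ(g) w - ρ(u) w`; subtracting the case `g = 1` removes the
    -- dependence on `u`.
    have hmem : ∀ g, ρ g w - w ∈ N.comap (path k c t t u) := by
      have hg : ∀ g, ρ g w - ρ u w ∈ N.comap (path k c t t u) := by
        intro g
        have := hN t g (g⁻¹ * t * g) (g⁻¹ * u)
        rw [lact_innerD, if_pos rfl, Finset.sum_eq_single t] at this
        · simpa [mul_assoc] using this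
        · intro x _ hx
          exact path_of_ne (fun h => hx ((hst _ _).1 h)) _ _
        · simp
      intro g
      simpa using Submodule.sub_mem _ (hg g) (hg 1)
    obtain ⟨g, hg⟩ := hc h1
    have htop : Submodule.span k (Set.range fun g => ρ g w - w) = ⊤ := by
      refine (hρ.eq_bot_or_eq_top _ fun g b hb => ?_).resolve_left fun hbot => hg ?_
      · refine Submodule.span_induction (p := fun b _ => ρ g b ∈ _) ?_ ?_ ?_ ?_ hb
        · rintro _ ⟨h, rfl⟩
          have : ρ g (ρ h w - w) = (ρ (g * h) w - w) - (ρ g w - w) := by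
            simp
          rw [this]
          exact Submodule.sub_mem _ (Submodule.subset_span ⟨_, rfl⟩)
            (Submodule.subset_span ⟨_, rfl⟩)
        · simp
        · intro x y _ _ hx hy
          rw [map_add]; exact Submodule.add_mem _ hx hy
        · intro a x _ hx
          rw [map_smul]; exact Submodule.smul_mem _ _ hx
      · have : ρ g w - w ∈ Submodule.span k (Set.range fun g => ρ g w - w) :=
          Submodule.subset_span ⟨g, rfl⟩
        rw [hbot, Submodule.mem_bot, sub_eq_zero] at this
        exact this
    have : b ∈ Submodule.span k (Set.range fun g => ρ g w - w) := htop ▸ Submodule.mem_top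
    change b ∈ N.comap (path k c t t u)
    refine Submodule.span_le.2 ?_ this
    rintro _ ⟨g, rfl⟩
    exact hmem g
  · have hst : s ≠ t := by
      rintro rfl
      simp [eq_comm, h1] at h
    have hmem : ∀ g, ρ g w ∈ N.comap (path k c s t u) := by
      intro g
      have := hN s g (g⁻¹ * t * g) (g⁻¹ * u)
      -- Since `s ≠ t`, the conjugates `g⁻¹sg` and `g⁻¹tg` differ, so only one of the two terms of
      -- `db` survives left multiplication.
      rw [lact_innerD, if_neg (by simpa using hst)] at this
      simpa [mul_assoc] using this
    have htop : Submodule.span k (Set.range fun g => ρ g w) = ⊤ := by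
      refine (hρ.eq_bot_or_eq_top _ fun g b hb => ?_).resolve_left fun hbot => hw ?_
      · refine Submodule.span_induction (p := fun b _ => ρ g b ∈ _) ?_ ?_ ?_ ?_ hb
        · rintro _ ⟨h, rfl⟩
          exact Submodule.subset_span ⟨g * h, by simp⟩
        · simp
        · intro x y _ _ hx hy
          rw [map_add]; exact Submodule.add_mem _ hx hy
        · intro a x _ hx
          rw [map_smul]; exact Submodule.smul_mem _ _ hx
      · have : w ∈ Submodule.span k (Set.range fun g => ρ g w) :=
          Submodule.subset_span ⟨1, by simp⟩
        rwa [hbot, Submodule.mem_bot] at this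
    have : b ∈ Submodule.span k (Set.range fun g => ρ g w) := htop ▸ Submodule.mem_top
    change b ∈ N.comap (path k c s t u)
    refine Submodule.span_le.2 ?_ this
    rintro _ ⟨g, rfl⟩
    exact hmem g

/-- The inner bicovariant calculus defined by a conjugacy class, a simple representation, and a
vector that generates it. -/
def calculus {ρ : Representation k G W} (c : ConjClasses G) (hρ : ρ.IsSimple) {w : W} (hw : w ≠ 0)
    (hc : c = ConjClasses.mk 1 → ∃ g, ρ g w ≠ w) :
    BicovariantCalculus.{u, max u v, max v w} k (QuantumDouble k G) where
  carrier := PathForms c W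
  lact := lact ρ
  ract := ract
  one_lact := one_lact ρ
  mul_lact := mul_lact ρ
  one_ract := one_ract
  mul_ract := mul_ract
  lact_ract := lact_ract ρ
  coactL := coactL
  coactR := coactR
  coactL_coassoc := coactL_coassoc
  coactL_counit := coactL_counit
  coactR_coassoc := coactR_coassoc
  coactR_counit := coactR_counit
  coact_comm := coact_comm
  coactL_lact := coactL_lact ρ
  coactL_ract := coactL_ract
  coactR_lact := coactR_lact ρ
  coactR_ract := coactR_ract
  d := innerD ρ w
  leibniz := innerD_mul ρ w
  span_lact_d := span_lact_innerD hρ hw hc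
  coactL_d := coactL_innerD ρ w
  coactR_d := coactR_innerD ρ w

end PathForms
end

/-! ### Homomorphisms, Schur's lemma and irreducibility -/

noncomputable section

namespace BicovariantCalculus

section Hom

variable {k : Type u} [Field k] {A : Type v} [Ring A] [HopfAlgebra k A]
  {C : BicovariantCalculus.{u, v, w} k A} {C' : BicovariantCalculus.{u, v, w'} k A}

/-- A homomorphism of bicovariant bimodules between the spaces of 1-forms of two calculi. -/
structure IsHom (φ : C.carrier →ₗ[k] C'.carrier) : Prop where
  map_lact : ∀ a ω, φ (C.lact a ω) = C'.lact a (φ ω)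
  map_ract : ∀ a ω, φ (C.ract a ω) = C'.ract a (φ ω)
  map_coactL : ∀ ω, C'.coactL (φ ω) = φ.lTensor A (C.coactL ω)
  map_coactR : ∀ ω, C'.coactR (φ ω) = φ.rTensor A (C.coactR ω)

theorem IsHom.symm {φ : C.carrier ≃ₗ[k] C'.carrier}
    (h : IsHom (C := C) (C' := C') φ.toLinearMap) :
    IsHom (C := C') (C' := C) φ.symm.toLinearMap where
  map_lact a ω := by
    have := h.map_lact a (φ.symm ω)
    simp only [LinearEquiv.coe_coe, LinearEquiv.apply_symm_apply] at this ⊢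
    rw [← this, LinearEquiv.symm_apply_apply]
  map_ract a ω := by
    have := h.map_ract a (φ.symm ω)
    simp only [LinearEquiv.coe_coe, LinearEquiv.apply_symm_apply] at this ⊢
    rw [← this, LinearEquiv.symm_apply_apply]
  map_coactL ω := by
    have := h.map_coactL (φ.symm ω)
    simp only [LinearEquiv.coe_coe, LinearEquiv.apply_symm_apply] at this ⊢
    rw [this, ← LinearMap.comp_apply, ← LinearMap.lTensor_comp]
    simp
  map_coactR ω := by
    have := h.map_coactR (φ.symm ω)
    simp only [LinearEquiv.coe_coe, LinearEquiv.apply_symm_apply] at this ⊢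
    rw [this, ← LinearMap.comp_apply, ← LinearMap.rTensor_comp]
    simp

theorem equivalent_iff : C.Equivalent C' ↔
    ∃ φ : C.carrier ≃ₗ[k] C'.carrier, IsHom (C := C) (C' := C') φ.toLinearMap :=
  ⟨fun ⟨φ, h⟩ => ⟨φ, h.1, h.2.1, h.2.2.1, h.2.2.2⟩,
    fun ⟨φ, h⟩ => ⟨φ, h.map_lact, h.map_ract, h.map_coactL, h.map_coactR⟩⟩

theorem Equivalent.symm (h : C.Equivalent C') : C'.Equivalent C := by
  obtain ⟨φ, hφ⟩ := equivalent_iff.1 h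
  exact equivalent_iff.2 ⟨φ.symm, hφ.symm⟩

/-- Tensoring with `A` over a field is exact, so an element of `A ⊗ Ω¹` killed by `id ⊗ φ` comes
from `A ⊗ ker φ`; likewise on the right. -/
theorem IsHom.isBicovariantSub_ker {φ : C.carrier →ₗ[k] C'.carrier}
    (h : IsHom φ) : C.IsBicovariantSub (LinearMap.ker φ) where
  lact_mem a ω hω := by rw [LinearMap.mem_ker, h.map_lact, LinearMap.mem_ker.1 hω, map_zero]
  ract_mem a ω hω := by rw [LinearMap.mem_ker, h.map_ract, LinearMap.mem_ker.1 hω, map_zero]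
  coactL_mem ω hω := by
    refine (Module.Flat.lTensor_exact A (LinearMap.exact_subtype_ker_map φ) _).1 ?_
    rw [← h.map_coactL, LinearMap.mem_ker.1 hω, map_zero]
  coactR_mem ω hω := by
    refine (Module.Flat.rTensor_exact A (LinearMap.exact_subtype_ker_map φ) _).1 ?_
    rw [← h.map_coactR, LinearMap.mem_ker.1 hω, map_zero]

theorem IsHom.isBicovariantSub_range {φ : C.carrier →ₗ[k] C'.carrier}
    (h : IsHom φ) : C'.IsBicovariantSub (LinearMap.range φ) where
  lact_mem := by rintro a _ ⟨ω, rfl⟩; exact ⟨_, h.map_lact a ω⟩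
  ract_mem := by rintro a _ ⟨ω, rfl⟩; exact ⟨_, h.map_ract a ω⟩
  coactL_mem := by
    rintro _ ⟨ω, rfl⟩
    refine ⟨φ.rangeRestrict.lTensor A (C.coactL ω), ?_⟩
    rw [← LinearMap.comp_apply, ← LinearMap.lTensor_comp, h.map_coactL]
    rfl
  coactR_mem := by
    rintro _ ⟨ω, rfl⟩
    refine ⟨φ.rangeRestrict.rTensor A (C.coactR ω), ?_⟩
    rw [← LinearMap.comp_apply, ← LinearMap.rTensor_comp, h.map_coactR]
    rfl

/-- Schur's lemma. -/
theorem IsHom.equivalent {φ : C.carrier →ₗ[k] C'.carrier} (h : IsHom φ) (hC : C.IsIrreducible)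
    (hC' : C'.IsIrreducible) (hφ : φ ≠ 0) : C.Equivalent C' := by
  have hker : LinearMap.ker φ = ⊥ := (hC.2 _ h.isBicovariantSub_ker).resolve_right fun hk =>
    hφ (LinearMap.ker_eq_top.1 hk)
  have hrange : LinearMap.range φ = ⊤ := (hC'.2 _ h.isBicovariantSub_range).resolve_left
    fun hk => hφ (LinearMap.range_eq_bot.1 hk)
  refine equivalent_iff.2 ⟨LinearEquiv.ofBijective φ
    ⟨LinearMap.ker_eq_bot.1 hker, LinearMap.range_eq_top.1 hrange⟩, ?_⟩
  exact ⟨h.map_lact, h.map_ract, h.map_coactL, h.map_coactR⟩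

variable (C) in
/-- The left coaction contracted with a functional. -/
def sliceL (f : Module.Dual k A) : C.carrier →ₗ[k] C.carrier :=
  (TensorProduct.lid k C.carrier).toLinearMap ∘ₗ f.rTensor C.carrier ∘ₗ C.coactL

variable (C) in
/-- The right coaction contracted with a functional. -/
def sliceR (f : Module.Dual k A) : C.carrier →ₗ[k] C.carrier :=
  (TensorProduct.rid k C.carrier).toLinearMap ∘ₗ f.lTensor C.carrier ∘ₗ C.coactR

theorem IsHom.map_sliceL {φ : C.carrier →ₗ[k] C'.carrier} (h : IsHom φ) (f : Module.Dual k A)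
    (ω : C.carrier) : φ (C.sliceL f ω) = C'.sliceL f (φ ω) := by
  simp only [sliceL, LinearMap.comp_apply, h.map_coactL]
  induction C.coactL ω using TensorProduct.induction_on with
  | zero => simp
  | tmul a ω => simp
  | add x y hx hy => simp only [map_add, hx, hy]

theorem IsHom.map_sliceR {φ : C.carrier →ₗ[k] C'.carrier} (h : IsHom φ) (f : Module.Dual k A)
    (ω : C.carrier) : φ (C.sliceR f ω) = C'.sliceR f (φ ω) := by
  simp only [sliceR, LinearMap.comp_apply, h.map_coactR]
  induction C.coactR ω using TensorProduct.induction_on with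
  | zero => simp
  | tmul a ω => simp
  | add x y hx hy => simp only [map_add, hx, hy]

theorem IsBicovariantSub.sliceL_mem {N : Submodule k C.carrier} (h : C.IsBicovariantSub N)
    (f : Module.Dual k A) {ω : C.carrier} (hω : ω ∈ N) : C.sliceL f ω ∈ N := by
  obtain ⟨z, hz⟩ := h.coactL_mem ω hω
  simp only [sliceL, LinearMap.comp_apply, ← hz]
  clear hz
  induction z using TensorProduct.induction_on with
  | zero => simp
  | tmul a η => simpa using N.smul_mem _ (SetLike.coe_mem _)
  | add x y hx hy => simpa only [map_add] using N.add_mem hx hy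

theorem IsBicovariantSub.sliceR_mem {N : Submodule k C.carrier} (h : C.IsBicovariantSub N)
    (f : Module.Dual k A) {ω : C.carrier} (hω : ω ∈ N) : C.sliceR f ω ∈ N := by
  obtain ⟨z, hz⟩ := h.coactR_mem ω hω
  simp only [sliceR, LinearMap.comp_apply, ← hz]
  clear hz
  induction z using TensorProduct.induction_on with
  | zero => simp
  | tmul a η => simpa using N.smul_mem _ (SetLike.coe_mem _)
  | add x y hx hy => simpa only [map_add] using N.add_mem hx hy

end Hom

end BicovariantCalculus

namespace PathForms

open QuantumDouble BicovariantCalculus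

variable {k : Type u} [Field k] {G : Type v} [Group G] [DecidableEq G] [Fintype G]
  {c : ConjClasses G} {W : Type w} [AddCommGroup W] [Module k W]

/-- The left coaction contracted with a coordinate functional. -/
def coordL (x v : G) : PathForms c W →ₗ[k] PathForms c W :=
  (TensorProduct.lid k _).toLinearMap ∘ₗ (basis.coord (x, v)).rTensor _ ∘ₗ coactL

/-- The right coaction contracted with a coordinate functional. -/
def coordR (y v : G) : PathForms c W →ₗ[k] PathForms c W :=
  (TensorProduct.rid k _).toLinearMap ∘ₗ (basis.coord (y, v)).lTensor _ ∘ₗ coactR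

theorem coordL_path (x v s t u : G) (b : W) : coordL (k := k) x v (path k c s t u b) =
    if u = v then path k c (x⁻¹ * s) (x⁻¹ * t) u b else 0 := by
  simp only [coordL, LinearMap.comp_apply, coactL_path, map_sum, LinearMap.rTensor_tmul, delta,
    Module.Basis.coord_apply, Module.Basis.repr_self, LinearEquiv.coe_coe,
    TensorProduct.lid_tmul, Finsupp.single_apply, Prod.mk.injEq, ite_and,
    ite_smul, one_smul, zero_smul]
  simp

theorem coordR_path (y v s t u : G) (b : W) : coordR (k := k) y v (path k c s t u b) =
    if u = v then path k c (s * y⁻¹) (t * y⁻¹) u b else 0 := by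
  simp only [coordR, LinearMap.comp_apply, coactR_path, map_sum, LinearMap.lTensor_tmul, delta,
    Module.Basis.coord_apply, Module.Basis.repr_self, LinearEquiv.coe_coe,
    TensorProduct.rid_tmul, Finsupp.single_apply, Prod.mk.injEq, ite_and,
    ite_smul, one_smul, zero_smul]
  simp

end PathForms

namespace BicovariantCalculus
open QuantumDouble

variable {k : Type u} [Field k] {G : Type v} [Group G] [DecidableEq G] [Fintype G]
  (C : BicovariantCalculus.{u, max u v, w} k (QuantumDouble k G))

/-- The operator that isolates the arrows `s → t` with decoration `u`. -/
def component (s t u : G) : C.carrier →ₗ[k] C.carrier :=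
  C.lact (delta k s 1) ∘ₗ C.ract (delta k (u⁻¹ * t * u) 1) ∘ₗ C.sliceL (basis.coord (1, u))

/-- The operator that moves the arrows `s → t` with decoration `u` to arrows starting at `s'`, with
decoration `u'`, after a translation on the right by `y⁻¹`. -/
def move (s t u s' u' y : G) : C.carrier →ₗ[k] C.carrier :=
  C.ract (delta k (u⁻¹ * (s' * y * s⁻¹ * t * y⁻¹) * u) (u⁻¹ * u')) ∘ₗ
    C.sliceR (basis.coord (y, u)) ∘ₗ
    C.sliceL (basis.coord (s * y⁻¹ * s'⁻¹, u))

/-- The operator `b ↦ ρ(g) b` on arrows `1 → τ`. -/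
def twist (τ g : G) : C.carrier →ₗ[k] C.carrier :=
  C.sliceR (basis.coord (g⁻¹, 1)) ∘ₗ C.sliceL (basis.coord (g, 1)) ∘ₗ
    C.ract (delta k τ g⁻¹) ∘ₗ C.lact (delta k 1 g)

variable {C} {C' : BicovariantCalculus.{u, max u v, w'} k (QuantumDouble k G)}

theorem IsHom.map_component {φ : C.carrier →ₗ[k] C'.carrier} (h : IsHom φ) (s t u : G)
    (ω : C.carrier) : φ (C.component s t u ω) = C'.component s t u (φ ω) := by
  simp only [component, LinearMap.comp_apply, h.map_lact, h.map_ract, h.map_sliceL]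

theorem IsHom.map_twist {φ : C.carrier →ₗ[k] C'.carrier} (h : IsHom φ) (τ g : G)
    (ω : C.carrier) : φ (C.twist τ g ω) = C'.twist τ g (φ ω) := by
  simp only [twist, LinearMap.comp_apply, h.map_lact, h.map_ract, h.map_sliceL, h.map_sliceR]

theorem IsBicovariantSub.component_mem {N : Submodule k C.carrier} (h : C.IsBicovariantSub N)
    (s t u : G) {ω : C.carrier} (hω : ω ∈ N) : C.component s t u ω ∈ N :=
  h.lact_mem _ _ (h.ract_mem _ _ (h.sliceL_mem _ hω))

theorem IsBicovariantSub.move_mem {N : Submodule k C.carrier} (h : C.IsBicovariantSub N)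
    (s t u s' u' y : G) {ω : C.carrier} (hω : ω ∈ N) : C.move s t u s' u' y ω ∈ N :=
  h.ract_mem _ _ (h.sliceR_mem _ (h.sliceL_mem _ hω))

theorem IsBicovariantSub.twist_mem {N : Submodule k C.carrier} (h : C.IsBicovariantSub N)
    (τ g : G) {ω : C.carrier} (hω : ω ∈ N) : C.twist τ g ω ∈ N :=
  h.sliceR_mem _ (h.sliceL_mem _ (h.ract_mem _ _ (h.lact_mem _ _ hω)))

end BicovariantCalculus

namespace PathForms

open QuantumDouble BicovariantCalculus

variable {k : Type u} [Field k] {G : Type v} [Group G] [DecidableEq G] [Fintype G]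
  {c : ConjClasses G} {W : Type w} [AddCommGroup W] [Module k W] {ρ : Representation k G W}
  (hρ : ρ.IsSimple) {w : W} (hw : w ≠ 0) (hc : c = ConjClasses.mk 1 → ∃ g, ρ g w ≠ w)

theorem component_eq (s t u : G) (ω : PathForms c W) :
    (calculus c hρ hw hc).component s t u ω = path k c s t u (val k c s t u ω) := by
  change (lact ρ (delta k s 1) ∘ₗ ract (delta k (u⁻¹ * t * u) 1) ∘ₗ coordL 1 u) ω =
    (path k c s t u ∘ₗ val k c s t u) ω
  congr 1
  refine hom_ext fun s' t' u' h b => ?_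
  simp only [LinearMap.comp_apply, coordL_path]
  by_cases hst : ConjClasses.mk (s⁻¹ * t) = c
  · rw [val_path hst]
    by_cases hu : u' = u
    · subst hu
      rw [if_pos rfl, ract_path]
      by_cases ht : t' = t
      · subst ht
        rw [if_pos (by simp), lact_path]
        by_cases hs : s' = s
        · subst hs
          simp
        · simp [hs, Ne.symm hs]
      · rw [if_neg (by simpa using ht)]
        simp [ht]
    · simp [hu]
  · rw [val_of_ne hst, map_zero]
    split_ifs with hu
    · rw [ract_path]
      split_ifs with ht
      · rw [lact_path]
        split_ifs with hs
        · subst hu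
          have : t' = t := by simpa using ht
          subst this
          have : s' = s := by simpa [eq_comm] using hs
          subst this
          exact absurd h hst
        · rfl
      · simp
    · simp

/-- Left translation changes the starting point, right translation conjugates the step `s⁻¹t`, and
right multiplication changes the decoration. Any two arrows of the same class are thus related
without altering the vector. -/
theorem move_path {s t u s' t' u' y : G} (h : s'⁻¹ * t' = y * (s⁻¹ * t) * y⁻¹) (b : W) :
    (calculus c hρ hw hc).move s t u s' u' y (path k c s t u b) = path k c s' t' u' b := by
  have ht : t' = s' * y * s⁻¹ * t * y⁻¹ := by
    rw [← mul_right_inj s'⁻¹, h]; group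
  change ract (delta k (u⁻¹ * (s' * y * s⁻¹ * t * y⁻¹) * u) (u⁻¹ * u')) (coordR y u
    (coordL (s * y⁻¹ * s'⁻¹) u (path k c s t u b))) = _
  rw [coordL_path, if_pos rfl, coordR_path, if_pos rfl, ract_path, if_pos (by group)]
  subst ht
  congr 2 <;> group

theorem twist_path (τ g : G) (b : W) :
    (calculus c hρ hw hc).twist τ g (path k c 1 τ 1 b) = path k c 1 τ 1 (ρ g b) := by
  change coordR g⁻¹ 1 (coordL g 1 (ract (delta k τ g⁻¹) (lact ρ (delta k 1 g) _))) = _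
  rw [lact_path, if_pos (by group), ract_path, if_pos (by group),
    coordL_path, if_pos (by group), coordR_path, if_pos (by group)]
  congr 2 <;> group

/-- A bicovariant sub-object `N` contains the arrow components of its elements by `component`, and
membership of an arrow depends only on its vector by `move`. So `N` amounts to a subspace `M` of
`W`, which `twist` makes invariant; simplicity of `ρ` finishes. -/
theorem isIrreducible_calculus : (calculus c hρ hw hc).IsIrreducible := by
  obtain ⟨τ, rfl⟩ := ConjClasses.mk_surjective c
  have hτ : ConjClasses.mk ((1 : G)⁻¹ * τ) = ConjClasses.mk τ := by simp
  refine ⟨⟨⟨path k _ 1 τ 1 w, 0, fun h => hw ?_⟩⟩,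
    fun (N : Submodule k (PathForms (ConjClasses.mk τ) W)) hN => ?_⟩
  · have := congrArg (val k (ConjClasses.mk τ) 1 τ 1) h
    erw [val_path hτ, map_zero] at this
    simpa using this
  · have hconj : ∀ s t : G, ConjClasses.mk (s⁻¹ * t) = ConjClasses.mk τ →
        ∃ y, s⁻¹ * t = y * (1⁻¹ * τ) * y⁻¹ := by
      intro s t h
      obtain ⟨y, hy⟩ := isConj_iff.1 (ConjClasses.mk_eq_mk_iff_isConj.1 h.symm)
      exact ⟨y, by rw [← hy]; simp⟩
    let M : Submodule k W := N.comap (path k (ConjClasses.mk τ) 1 τ 1)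
    have hM : ∀ s t u b, ConjClasses.mk (s⁻¹ * t) = ConjClasses.mk τ →
        (path k (ConjClasses.mk τ) s t u b ∈ N ↔ b ∈ M) := by
      intro s t u b h
      obtain ⟨y, hy⟩ := hconj s t h
      constructor
      · intro hb
        have := hN.move_mem s t u 1 1 y⁻¹ hb
        rwa [move_path (t' := τ)] at this
        rw [hy]; group
      · intro hb
        have := hN.move_mem 1 τ 1 s u y (ω := path k (ConjClasses.mk τ) 1 τ 1 b) hb
        rwa [move_path (t' := t)] at this
        exact hy
    rcases hρ.eq_bot_or_eq_top M (fun g b hb => by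
      have := hN.twist_mem τ g (ω := path k (ConjClasses.mk τ) 1 τ 1 b) hb
      rwa [twist_path] at this) with h | h
    · left
      refine (Submodule.eq_bot_iff _).2 fun ω hω => ext (k := k) fun s t u hst => ?_
      have : path k _ s t u (val k _ s t u ω) ∈ N := by
        rw [← component_eq hρ hw hc]
        exact hN.component_mem s t u hω
      rw [hM _ _ _ _ hst, h, Submodule.mem_bot] at this
      rw [this, map_zero]
    · right
      refine eq_top_iff.2 fun ω _ => ?_
      rw [← sum_path_val (k := k) ω]
      refine Submodule.sum_mem _ fun s _ => Submodule.sum_mem _ fun t _ =>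
        Submodule.sum_mem _ fun u _ => ?_
      by_cases hst : ConjClasses.mk (s⁻¹ * t) = ConjClasses.mk τ
      · exact (hM _ _ _ _ hst).2 (by rw [h]; trivial)
      · rw [path_of_ne hst]; exact N.zero_mem

/-- Equivalent calculi have the same conjugacy class, and isomorphic representations. -/
theorem eq_and_exists_of_equivalent {c' : ConjClasses G} {W' : Type w'} [AddCommGroup W']
    [Module k W'] {ρ' : Representation k G W'} (hρ' : ρ'.IsSimple) {w' : W'} (hw' : w' ≠ 0)
    (hc' : c' = ConjClasses.mk 1 → ∃ g, ρ' g w' ≠ w')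
    (h : (calculus c hρ hw hc).Equivalent (calculus c' hρ' hw' hc')) :
    c = c' ∧ ∃ T : W →ₗ[k] W', Function.Injective T ∧ ∀ g b, T (ρ g b) = ρ' g (T b) := by
  obtain ⟨φ, hφ⟩ := equivalent_iff.1 h
  obtain ⟨τ, rfl⟩ := ConjClasses.mk_surjective c
  have hτ : ConjClasses.mk ((1 : G)⁻¹ * τ) = ConjClasses.mk τ := by simp
  let ψ : PathForms (ConjClasses.mk τ) W →ₗ[k] PathForms c' W' := φ.toLinearMap
  -- Homomorphisms commute with `component`, so an arrow goes to an arrow with the same endpoints.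
  -- Being nonzero, the image forces the classes to agree, and its vector depends on `b` through the
  -- intertwiner sought.
  have hψ : ∀ b, ψ (path k _ 1 τ 1 b) = path k _ 1 τ 1 (val k _ 1 τ 1 (ψ (path k _ 1 τ 1 b))) := by
    intro b
    have h1 := component_eq hρ hw hc 1 τ 1 (path k _ 1 τ 1 b)
    rw [val_path hτ, if_pos rfl, if_pos rfl, if_pos rfl] at h1
    exact (congrArg ψ h1.symm).trans ((hφ.map_component 1 τ 1 (path k _ 1 τ 1 b)).trans
      (component_eq hρ' hw' hc' 1 τ 1 (ψ (path k _ 1 τ 1 b))))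
  have hinj : ∀ b, ψ (path k _ 1 τ 1 b) = 0 → b = 0 := by
    intro b hb
    have h0 : path k (ConjClasses.mk τ) 1 τ 1 b = 0 := φ.injective (hb.trans (map_zero φ).symm)
    have := congrArg (val k (ConjClasses.mk τ) 1 τ 1) h0
    rw [val_path hτ, map_zero] at this
    simpa using this
  have hcc : ConjClasses.mk ((1 : G)⁻¹ * τ) = c' := by
    by_contra hne
    refine hw (hinj w ?_)
    rw [hψ, path_of_ne hne]
  refine ⟨hτ.symm.trans hcc, val k c' 1 τ 1 ∘ₗ ψ ∘ₗ path k _ 1 τ 1, ?_, fun g b => ?_⟩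
  · refine LinearMap.ker_eq_bot.1 ((Submodule.eq_bot_iff _).2 fun b hb => hinj b ?_)
    rw [hψ]
    have hb' : val k c' 1 τ 1 (ψ (path k (ConjClasses.mk τ) 1 τ 1 b)) = 0 := hb
    rw [hb', map_zero]
  · have h2 : ψ (path k (ConjClasses.mk τ) 1 τ 1 (ρ g b)) =
        (calculus c' hρ' hw' hc').twist τ g (ψ (path k _ 1 τ 1 b)) := by
      rw [← twist_path hρ hw hc]
      exact hφ.map_twist τ g (path k _ 1 τ 1 b)
    rw [hψ b, twist_path] at h2
    simp only [LinearMap.comp_apply]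
    rw [h2, val_path hcc]
    simp

end PathForms
end

/-! ### Invariant forms and dimension -/

noncomputable section

namespace PathForms

open QuantumDouble BicovariantCalculus

variable {k : Type u} [Field k] {G : Type v} [Group G] [DecidableEq G] [Fintype G]
  {c : ConjClasses G} {W : Type w} [AddCommGroup W] [Module k W]

theorem basis_coord_one (x v : G) :
    (basis.coord (x, v) : Module.Dual k (QuantumDouble k G)) 1 = if v = 1 then 1 else 0 := by
  simp only [one_def, map_sum, delta, Module.Basis.coord_apply, Module.Basis.repr_self,
    Finsupp.single_apply, Prod.mk.injEq, ite_and]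
  simp [eq_comm]

theorem val_coordL (x v s t u : G) (ω : PathForms c W) :
    val k c s t u (coordL (k := k) x v ω) =
      if u = v then val k c (x * s) (x * t) u ω else 0 := by
  by_cases h : ConjClasses.mk (s⁻¹ * t) = c
  · have h' : ConjClasses.mk ((x * s)⁻¹ * (x * t)) = c := by rw [← h]; congr 1; group
    have : val k c s t u ∘ₗ coordL (k := k) (c := c) (W := W) x v =
        if u = v then val k c (x * s) (x * t) u else 0 := by
      refine hom_ext fun s' t' u' _ b => ?_
      rw [LinearMap.comp_apply, coordL_path]
      split_ifs with h1 h2 h2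
      · rw [val_path h, val_path h']
        simp [inv_mul_eq_iff_eq_mul]
      · rw [val_path h]
        simp [h1, Ne.symm h2]
      · rw [map_zero, val_path h']
        have : ¬ u' = u := fun e => h1 (e.trans h2)
        simp [this]
      · simp
    rw [← LinearMap.comp_apply, this]
    split_ifs <;> rfl
  · rw [val_of_ne h, val_of_ne, ite_self]
    intro h'; apply h; rw [← h']; congr 1; group

theorem val_coordR (y v s t u : G) (ω : PathForms c W) :
    val k c s t u (coordR (k := k) y v ω) =
      if u = v then val k c (s * y) (t * y) u ω else 0 := by
  by_cases h : ConjClasses.mk (s⁻¹ * t) = c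
  · have h' : ConjClasses.mk ((s * y)⁻¹ * (t * y)) = c := by
      rw [← h, ← ConjClasses.mk_conj y]; congr 1; group
    have : val k c s t u ∘ₗ coordR (k := k) (c := c) (W := W) y v =
        if u = v then val k c (s * y) (t * y) u else 0 := by
      refine hom_ext fun s' t' u' _ b => ?_
      rw [LinearMap.comp_apply, coordR_path]
      split_ifs with h1 h2 h2
      · rw [val_path h, val_path h']
        simp [mul_inv_eq_iff_eq_mul]
      · rw [val_path h]
        simp [h1, Ne.symm h2]
      · rw [map_zero, val_path h']
        have : ¬ u' = u := fun e => h1 (e.trans h2)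
        simp [this]
      · simp
    rw [← LinearMap.comp_apply, this]
    split_ifs <;> rfl
  · rw [val_of_ne h, val_of_ne, ite_self]
    intro h'; apply h; rw [← h', ← ConjClasses.mk_conj y⁻¹]; congr 1; group

theorem coordL_of_coactL {ω : PathForms c W} (h : coactL (k := k) ω = 1 ⊗ₜ ω) (x v : G) :
    coordL (k := k) x v ω = if v = 1 then ω else 0 := by
  rw [coordL, LinearMap.comp_apply, LinearMap.comp_apply, h, LinearMap.rTensor_tmul,
    basis_coord_one, LinearEquiv.coe_coe, TensorProduct.lid_tmul, ite_smul, one_smul, zero_smul]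

theorem coordR_of_coactR {ω : PathForms c W} (h : coactR (k := k) ω = ω ⊗ₜ 1) (x v : G) :
    coordR (k := k) x v ω = if v = 1 then ω else 0 := by
  rw [coordR, LinearMap.comp_apply, LinearMap.comp_apply, h, LinearMap.lTensor_tmul,
    basis_coord_one, LinearEquiv.coe_coe, TensorProduct.rid_tmul, ite_smul, one_smul, zero_smul]

/-- The coordinates of `1 = ∑ δ_x ⊗ e` vanish off the decoration `e` and do not depend on `x`.
Comparing them with the slices of the coaction kills other decorations and makes coefficients
invariant under left translation. -/
theorem val_of_coactL {ω : PathForms c W} (h : coactL (k := k) ω = 1 ⊗ₜ ω) (s t u : G) :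
    val k c s t u ω = if u = 1 then val k c 1 (s⁻¹ * t) 1 ω else 0 := by
  have h1 := val_coordL (k := k) s u 1 (s⁻¹ * t) u ω
  rw [coordL_of_coactL h, if_pos rfl, mul_one, mul_inv_cancel_left] at h1
  rw [← h1]
  split_ifs with hu
  · rw [hu]
  · rw [map_zero]

variable (k c) in
/-- The left-invariant form `∑ₛ (s → sτ) ⊗ b`. -/
def leftForm (τ : G) : W →ₗ[k] PathForms c W := ∑ s, path k c s (s * τ) 1

theorem leftForm_apply (τ : G) (b : W) : leftForm k c τ b = ∑ s, path k c s (s * τ) 1 b := by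
  simp [leftForm]

theorem leftForm_of_ne {τ : G} (h : ConjClasses.mk τ ≠ c) (b : W) : leftForm k c τ b = 0 := by
  rw [leftForm_apply]
  exact Finset.sum_eq_zero fun s _ => path_of_ne (by simpa using h) _ _

theorem val_leftForm {s t : G} (h : ConjClasses.mk (s⁻¹ * t) = c) (u τ : G) (b : W) :
    val k c s t u (leftForm k c τ b) = if s⁻¹ * t = τ then if u = 1 then b else 0 else 0 := by
  have h' : s⁻¹ * t = τ ↔ s * τ = t := by rw [inv_mul_eq_iff_eq_mul, eq_comm]
  simp only [leftForm_apply, map_sum, val_path h, Finset.sum_ite_eq', Finset.mem_univ, if_true, h',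
    eq_comm (a := u)]

theorem coactL_leftForm (τ : G) (b : W) :
    coactL (leftForm k c τ b) = (1 : QuantumDouble k G) ⊗ₜ leftForm k c τ b := by
  simp only [leftForm_apply, map_sum, coactL_path, one_def, TensorProduct.sum_tmul]
  rw [Finset.sum_comm]
  refine Finset.sum_congr rfl fun x _ => ?_
  rw [TensorProduct.tmul_sum]
  refine Fintype.sum_equiv (Equiv.mulLeft x⁻¹) _ _ fun s => ?_
  simp [mul_assoc]

theorem innerForm_eq_sum_leftForm (b : W) : innerForm k c b = ∑ τ, leftForm k c τ b := by
  simp only [leftForm_apply, innerForm]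
  rw [Finset.sum_comm]
  conv_rhs => rw [Finset.sum_comm]
  rw [Finset.sum_comm]
  exact Finset.sum_congr rfl fun s _ => (Fintype.sum_equiv (Equiv.mulLeft s) _ _ fun τ => rfl).symm

theorem eq_sum_leftForm {ω : PathForms c W} (h : coactL (k := k) ω = 1 ⊗ₜ ω) :
    ω = ∑ τ, leftForm k c τ (val k c 1 τ 1 ω) := by
  refine ext (k := k) fun s t u hst => ?_
  rw [val_of_coactL h, map_sum]
  simp only [val_leftForm hst]
  simp

/-- Bi-invariant forms are given by a vector. -/
theorem exists_eq_innerForm {ω : PathForms c W} (hL : coactL (k := k) ω = 1 ⊗ₜ ω)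
    (hR : coactR (k := k) ω = ω ⊗ₜ 1) : ∃ b, ω = innerForm k c b := by
  obtain ⟨σ, hσ⟩ := ConjClasses.mk_surjective c
  refine ⟨val k c 1 σ 1 ω, ?_⟩
  rw [innerForm_eq_sum_leftForm]
  conv_lhs => rw [eq_sum_leftForm hL]
  refine Finset.sum_congr rfl fun τ _ => ?_
  by_cases hτ : ConjClasses.mk τ = c
  -- Right invariance identifies the coefficient at `1 → σ` with that at `y⁻¹ → σy⁻¹`, and left
  -- invariance carries the latter to `1 → yσy⁻¹`.
  · obtain ⟨y, rfl⟩ := isConj_iff.1 (ConjClasses.mk_eq_mk_iff_isConj.1 (hσ.trans hτ.symm))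
    congr 1
    have h1 := val_coordR (k := k) y 1 y⁻¹ (σ * y⁻¹) 1 ω
    rw [coordR_of_coactR hR, if_pos rfl, if_pos rfl, val_of_coactL hL] at h1
    simpa [mul_assoc] using h1
  · rw [leftForm_of_ne hτ, leftForm_of_ne hτ]

section Calculus

variable {ρ : Representation k G W}
  (hρ : ρ.IsSimple) {w : W} (hw : w ≠ 0) (hc : c = ConjClasses.mk 1 → ∃ g, ρ g w ≠ w)

theorem mem_invForms {ω : PathForms c W} :
    ω ∈ (calculus c hρ hw hc).invForms ↔ coactL (k := k) ω = 1 ⊗ₜ ω := by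
  rw [← sub_eq_zero]
  exact Iff.rfl

/-- A left-invariant form is a function from the class `c` to `W`, namely its coefficients at the
arrows `1 → τ`. -/
theorem dim_calculus [FiniteDimensional k W] : (calculus c hρ hw hc).dim =
    Nat.card {τ : G // ConjClasses.mk τ = c} * Module.finrank k W := by
  classical
  obtain ⟨L, hL⟩ : ∃ L : ({τ : G // ConjClasses.mk τ = c} → W) →ₗ[k] PathForms c W,
      ∀ f, L f = ∑ τ, leftForm k c τ.1 (f τ) :=
    ⟨∑ τ, leftForm k c τ.1 ∘ₗ LinearMap.proj τ, fun f => by simp⟩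
  have hval : ∀ f τ, val k c 1 τ.1 1 (L f) = f τ := by
    intro f τ
    rw [hL, map_sum, Finset.sum_eq_single τ]
    · rw [val_leftForm (by simpa using τ.2)]; simp
    · intro σ _ hσ
      rw [val_leftForm (by simpa using τ.2), if_neg]
      simpa [Subtype.ext_iff, eq_comm] using hσ
    · simp
  have hinj : Function.Injective L := fun f g h => funext fun τ => by
    rw [← hval f, h, hval]
  have hrange : LinearMap.range L = (calculus c hρ hw hc).invForms := by
    ext ω
    constructor
    · rintro ⟨f, rfl⟩
      rw [hL]
      exact Submodule.sum_mem _ fun τ _ => (mem_invForms hρ hw hc).2 (coactL_leftForm _ _)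
    · intro h
      refine ⟨fun τ => val k c 1 τ.1 1 ω, ?_⟩
      rw [hL]
      refine Eq.trans ?_ (eq_sum_leftForm ((mem_invForms hρ hw hc).1 h)).symm
      rw [← Finset.sum_filter_add_sum_filter_not Finset.univ (fun τ => ConjClasses.mk τ = c),
        Finset.sum_eq_zero (s := Finset.filter (fun τ => ¬ ConjClasses.mk τ = c) _), add_zero]
      · exact (Finset.sum_subtype _ (fun τ => by simp)
          fun τ => leftForm k c τ (val k c 1 τ 1 ω)).symm
      · intro τ hτ
        exact leftForm_of_ne (Finset.mem_filter.1 hτ).2 _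
  have h1 : (calculus c hρ hw hc).dim = Module.finrank k (LinearMap.range L) := by
    rw [hrange]; rfl
  rw [h1, LinearMap.finrank_range_of_inj hinj, Module.finrank_pi_fintype, Finset.sum_const,
    Finset.card_univ, smul_eq_mul, Nat.card_eq_fintype_card]

end Calculus

end PathForms

/-! ### Every calculus is inner -/

namespace BicovariantCalculus

open QuantumDouble PathForms

variable {k : Type u} [Field k] {G : Type v} [Group G] [DecidableEq G] [Fintype G]
  (C : BicovariantCalculus.{u, max u v, w'} k (QuantumDouble k G))

/-- The bi-invariant form `∑ₐ d(δ_a ⊗ v⁻¹) (δ_{vav⁻¹} ⊗ v)`. -/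
def averageForm (v : G) : C.carrier :=
  ∑ a, C.ract (delta k (v * a * v⁻¹) v) (C.d (delta k a v⁻¹))

theorem coactL_averageForm (v : G) : C.coactL (C.averageForm v) = 1 ⊗ₜ C.averageForm v := by
  have h : ∀ a x y : G, (delta k x v⁻¹ * delta k y v) ⊗ₜ[k]
      C.ract (delta k (y⁻¹ * (v * a * v⁻¹)) v) (C.d (delta k (x⁻¹ * a) v⁻¹)) =
      if v * x * v⁻¹ = y then delta k x 1 ⊗ₜ[k]
      C.ract (delta k (v * (x⁻¹ * a) * v⁻¹) v) (C.d (delta k (x⁻¹ * a) v⁻¹)) else 0 := by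
    intro a x y
    rw [delta_mul_delta, inv_inv]
    split_ifs with h
    · subst h
      congr 4
      · group
      · group
    · rw [TensorProduct.zero_tmul]
  simp only [averageForm, map_sum, C.coactL_ract, C.coactL_d, comul_delta, LinearMap.lTensor_tmul,
    LinearMap.sum_apply, TensorProduct.map₂_apply_tmul, TensorProduct.map_tmul,
    LinearMap.flip_apply, LinearMap.mul_apply', h, Finset.sum_ite_eq, Finset.mem_univ, if_true]
  rw [Finset.sum_comm, one_def, TensorProduct.sum_tmul]
  refine Finset.sum_congr rfl fun x _ => ?_
  rw [TensorProduct.tmul_sum]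
  exact Fintype.sum_equiv (Equiv.mulLeft x⁻¹) _ _ fun a => rfl

theorem coactR_averageForm (v : G) : C.coactR (C.averageForm v) = C.averageForm v ⊗ₜ 1 := by
  have h : ∀ a x y : G, C.ract (delta k y v) (C.d (delta k x v⁻¹)) ⊗ₜ[k]
      (delta k (x⁻¹ * a) v⁻¹ * delta k (y⁻¹ * (v * a * v⁻¹)) v) =
      if v * x * v⁻¹ = y then
      C.ract (delta k (v * x * v⁻¹) v) (C.d (delta k x v⁻¹)) ⊗ₜ[k] delta k (x⁻¹ * a) 1 else 0 := by
    intro a x y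
    rw [delta_mul_delta, inv_inv]
    by_cases h : v * x * v⁻¹ = y
    · subst h
      rw [if_pos rfl, if_pos (by group)]
      congr 2; group
    · rw [if_neg h, if_neg, TensorProduct.tmul_zero]
      intro h'; apply h
      have := congrArg (fun z => v * a * v⁻¹ * z⁻¹) h'
      simpa [mul_assoc] using this
  simp only [averageForm, map_sum, C.coactR_ract, C.coactR_d, comul_delta, LinearMap.rTensor_tmul,
    LinearMap.sum_apply, TensorProduct.map₂_apply_tmul, TensorProduct.map_tmul,
    LinearMap.flip_apply, LinearMap.mul_apply', h, Finset.sum_ite_eq, Finset.mem_univ, if_true]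
  rw [Finset.sum_comm, TensorProduct.sum_tmul]
  refine Finset.sum_congr rfl fun x _ => ?_
  rw [one_def, TensorProduct.tmul_sum]
  exact Fintype.sum_equiv (Equiv.mulLeft x⁻¹) _ _ fun a => rfl

/-- By Leibniz, `x (da) b = d(xa) b - (dx) ab`, and the products `ab` occurring in the average sum
to `1`, which leaves `dx` as the second term. -/
theorem lact_averageForm (t g v : G) : C.lact (delta k t g) (C.averageForm v) =
    C.ract (delta k (v * (g⁻¹ * t * g) * v⁻¹) v) (C.d (delta k t (g * v⁻¹))) -
      C.d (delta k t g) := by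
  have h : ∀ a, C.lact (delta k t g) (C.ract (delta k (v * a * v⁻¹) v) (C.d (delta k a v⁻¹))) =
      C.ract (delta k (v * a * v⁻¹) v) (C.d (delta k t g * delta k a v⁻¹)) -
      C.ract (delta k a v⁻¹ * delta k (v * a * v⁻¹) v) (C.d (delta k t g)) := by
    intro a
    rw [C.lact_ract, C.leibniz, map_add, C.mul_ract, add_sub_cancel_right]
  simp only [averageForm, map_sum, h, Finset.sum_sub_distrib]
  congr 1
  · simp only [delta_mul_delta]
    rw [Finset.sum_eq_single (g⁻¹ * t * g)]
    · rw [if_pos rfl]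
    · intro a _ ha
      rw [if_neg (Ne.symm ha), map_zero, map_zero]
    · simp
  · rw [← LinearMap.sum_apply, ← map_sum]
    have : ∑ a, delta k a v⁻¹ * delta k (v * a * v⁻¹) v = 1 := by
      rw [one_def]
      exact Finset.sum_congr rfl fun a _ => by rw [delta_mul_delta, if_pos (by group)]; simp
    rw [this, C.one_ract]

theorem ract_averageForm (t g v : G) : C.ract (delta k t g) (C.averageForm v) =
    C.ract (delta k (v * t * v⁻¹) (v * g)) (C.d (delta k t v⁻¹)) := by
  simp only [averageForm, map_sum, ← C.mul_ract, delta_mul_delta]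
  rw [Finset.sum_eq_single t]
  · rw [if_pos (by group)]
  · intro a _ ha
    rw [if_neg, map_zero, LinearMap.zero_apply]
    intro h; apply ha; rw [← h]; group
  · simp

/-- Every bicovariant calculus on `D(G)` is inner, with respect to a bi-invariant form. -/
theorem exists_inner (hG : (Fintype.card G : k) ≠ 0) : ∃ θ : C.carrier,
    C.coactL θ = 1 ⊗ₜ θ ∧ C.coactR θ = θ ⊗ₜ 1 ∧ ∀ a, C.d a = C.ract a θ - C.lact a θ := by
  refine ⟨(Fintype.card G : k)⁻¹ • ∑ v, C.averageForm v, ?_, ?_, fun a => ?_⟩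
  · simp only [map_smul, map_sum, coactL_averageForm, TensorProduct.tmul_smul,
      TensorProduct.tmul_sum]
  · simp only [map_smul, map_sum, coactR_averageForm, ← TensorProduct.smul_tmul',
      TensorProduct.sum_tmul]
  · refine LinearMap.congr_fun (f := C.d)
      (g := (C.ract - C.lact).flip ((Fintype.card G : k)⁻¹ • ∑ v, C.averageForm v))
      (QuantumDouble.hom_ext fun t g => ?_) a
    rw [LinearMap.flip_apply]
    simp only [LinearMap.flip_apply, LinearMap.sub_apply, map_smul, map_sum, lact_averageForm,
      ract_averageForm, ← smul_sub]
    simp only [← sub_add]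
    rw [eq_inv_smul_iff₀ hG, Finset.sum_add_distrib, Finset.sum_const, Finset.card_univ,
      Nat.cast_smul_eq_nsmul, eq_comm, add_eq_right, Finset.sum_sub_distrib, sub_eq_zero]
    -- The elements `(δ_a ⊗ v⁻¹) ⊗ (δ_{vav⁻¹} ⊗ v)`, summed and divided by `|G|`, form a
    -- separability idempotent. Concretely, the shift `v ↦ vg` cancels all terms of the commutator
    -- except `|G|` copies of the differential.
    refine Fintype.sum_equiv (Equiv.mulRight g) _ _ fun v => ?_
    simp [mul_assoc]

variable {C} {θ : C.carrier}

/-- The form `(δ_s ⊗ g) θ (δ_{g⁻¹tg} ⊗ g⁻¹u)`. -/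
def arrow (θ : C.carrier) (s t u g : G) : C.carrier :=
  C.lact (delta k s g) (C.ract (delta k (g⁻¹ * t * g) (g⁻¹ * u)) θ)

theorem lact_arrow (r h s t u g : G) : C.lact (delta k r h) (arrow θ s t u g) =
    if h⁻¹ * r * h = s then arrow θ r (h * t * h⁻¹) (h * u) (h * g) else 0 := by
  rw [arrow, ← C.mul_lact, delta_mul_delta]
  split_ifs
  · rw [arrow]
    congr 4
    · group
    · group
  · rw [map_zero, LinearMap.zero_apply]

theorem ract_arrow (r h s t u g : G) : C.ract (delta k r h) (arrow θ s t u g) =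
    if u⁻¹ * t * u = r then arrow θ s t (u * h) g else 0 := by
  have hu : (g⁻¹ * u)⁻¹ * (g⁻¹ * t * g) * (g⁻¹ * u) = u⁻¹ * t * u := by group
  rw [arrow, ← C.lact_ract, ← C.mul_ract, delta_mul_delta, hu]
  split_ifs
  · rw [arrow, mul_assoc g⁻¹ u h]
  · rw [map_zero, LinearMap.zero_apply, map_zero]

theorem coactL_arrow (hL : C.coactL θ = 1 ⊗ₜ θ) (s t u g : G) : C.coactL (arrow θ s t u g) =
    ∑ x, delta k x u ⊗ₜ arrow θ (x⁻¹ * s) (x⁻¹ * t) u g := by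
  have h : ∀ x y : G, (delta k x g * delta k y (g⁻¹ * u)) ⊗ₜ[k]
      C.lact (delta k (x⁻¹ * s) g) (C.ract (delta k (y⁻¹ * (g⁻¹ * t * g)) (g⁻¹ * u)) θ) =
      if g⁻¹ * x * g = y then delta k x u ⊗ₜ arrow θ (x⁻¹ * s) (x⁻¹ * t) u g else 0 := by
    intro x y
    rw [delta_mul_delta, mul_inv_cancel_left]
    split_ifs with hy
    · subst hy
      rw [arrow]
      congr 5; group
    · rw [TensorProduct.zero_tmul]
  simp only [arrow, C.coactL_lact, C.coactL_ract, hL, comul_delta, map_sum, LinearMap.sum_apply,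
    TensorProduct.map₂_apply_tmul, TensorProduct.map_tmul, LinearMap.flip_apply,
    LinearMap.mul_apply', one_mul, h] at h ⊢
  rw [Finset.sum_comm]
  simp

theorem coactR_arrow (hR : C.coactR θ = θ ⊗ₜ 1) (s t u g : G) : C.coactR (arrow θ s t u g) =
    ∑ y, arrow θ (s * y⁻¹) (t * y⁻¹) u g ⊗ₜ delta k y u := by
  have h : ∀ x y : G, C.lact (delta k x g) (C.ract (delta k y (g⁻¹ * u)) θ) ⊗ₜ[k]
      (delta k (x⁻¹ * s) g * delta k (y⁻¹ * (g⁻¹ * t * g)) (g⁻¹ * u)) =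
      if g⁻¹ * (t * (x⁻¹ * s)⁻¹) * g = y then
        arrow θ (s * (x⁻¹ * s)⁻¹) (t * (x⁻¹ * s)⁻¹) u g ⊗ₜ delta k (x⁻¹ * s) u else 0 := by
    intro x y
    rw [delta_mul_delta, mul_inv_cancel_left]
    by_cases hy : g⁻¹ * (t * (x⁻¹ * s)⁻¹) * g = y
    · subst hy
      rw [if_pos rfl, if_pos (by group), arrow]
      congr 3; group
    · rw [if_neg hy, if_neg, TensorProduct.tmul_zero]
      intro h'; apply hy
      have := congrArg (fun z => g⁻¹ * t * g * z⁻¹) h'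
      simpa [mul_assoc] using this
  simp only [arrow, C.coactR_lact, C.coactR_ract, hR, comul_delta, map_sum, LinearMap.sum_apply,
    TensorProduct.map₂_apply_tmul, TensorProduct.map_tmul, LinearMap.flip_apply,
    LinearMap.mul_apply', one_mul, h] at h ⊢
  rw [Finset.sum_comm]
  simp only [Finset.sum_ite_eq, Finset.mem_univ, if_true]
  exact Fintype.sum_equiv ((Equiv.inv G).trans (Equiv.mulRight s)) _ _ fun x => rfl

end BicovariantCalculus

/-! ### Homomorphisms from matrix coefficients -/

namespace PathForms

open QuantumDouble BicovariantCalculus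

variable {k : Type u} [Field k] {G : Type v} [Group G] [DecidableEq G] [Fintype G]
  {c : ConjClasses G} {W : Type w} [AddCommGroup W] [Module k W] {ρ : Representation k G W}
  {C : BicovariantCalculus.{u, max u v, w'} k (QuantumDouble k G)}

variable (c ρ) in
/-- The homomorphism to a calculus defined by a matrix coefficient of the representation. -/
def coeffHom (θ : C.carrier) (ξ : Module.Dual k W) : PathForms c W →ₗ[k] C.carrier :=
  lift fun s t u => ∑ g, (ξ ∘ₗ ρ g⁻¹).smulRight (arrow θ s t u g)

theorem coeffHom_path (θ : C.carrier) (ξ : Module.Dual k W) {s t : G}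
    (h : ConjClasses.mk (s⁻¹ * t) = c) (u : G) (b : W) :
    coeffHom c ρ θ ξ (path k c s t u b) = ∑ g, ξ (ρ g⁻¹ b) • arrow θ s t u g := by
  rw [coeffHom, lift_path _ _ _ _ _ (fun h' => absurd h h')]
  simp

/-- The coefficient `ξ(ρ(g⁻¹) b)` is unchanged when `g` becomes `hg` and `b` becomes `ρ(h) b`, which
is what left multiplication does to the two sides. The right action and the coactions leave `g` and
`b` alone. -/
theorem isHom_coeffHom (hρ : ρ.IsSimple) {w : W} (hw : w ≠ 0)
    (hc : c = ConjClasses.mk 1 → ∃ g, ρ g w ≠ w) {θ : C.carrier} (hL : C.coactL θ = 1 ⊗ₜ θ)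
    (hR : C.coactR θ = θ ⊗ₜ 1) (ξ : Module.Dual k W) :
    IsHom (C := calculus c hρ hw hc) (coeffHom c ρ θ ξ) where
  map_lact a ω := by
    refine LinearMap.congr_fun₂ (f := (lact ρ).compr₂ (coeffHom c ρ θ ξ))
      (g := C.lact.compl₂ (coeffHom c ρ θ ξ)) (bilin_ext fun r h s t u hst b => ?_) a ω
    rw [LinearMap.compr₂_apply, LinearMap.compl₂_apply, lact_path, coeffHom_path _ _ hst, map_sum]
    simp only [map_smul, lact_arrow]
    split_ifs with hr
    · subst hr
      rw [coeffHom_path]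
      · refine Fintype.sum_equiv (Equiv.mulLeft h⁻¹) _ _ fun g => ?_
        simp
      · rw [← hst, ← ConjClasses.mk_conj h⁻¹]; congr 1; group
    · simp
  map_ract a ω := by
    refine LinearMap.congr_fun₂ (f := ract.compr₂ (coeffHom c ρ θ ξ))
      (g := C.ract.compl₂ (coeffHom c ρ θ ξ)) (bilin_ext fun r h s t u hst b => ?_) a ω
    rw [LinearMap.compr₂_apply, LinearMap.compl₂_apply, ract_path, coeffHom_path _ _ hst, map_sum]
    simp only [map_smul, ract_arrow]
    split_ifs with hr
    · rw [coeffHom_path _ _ hst]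
    · simp
  map_coactL ω := by
    refine LinearMap.congr_fun (f := C.coactL ∘ₗ coeffHom c ρ θ ξ)
      (g := (coeffHom c ρ θ ξ).lTensor _ ∘ₗ coactL) (hom_ext fun s t u hst b => ?_) ω
    rw [LinearMap.comp_apply, LinearMap.comp_apply, coeffHom_path _ _ hst, coactL_path]
    simp only [map_sum, map_smul, coactL_arrow hL, LinearMap.lTensor_tmul, Finset.smul_sum]
    rw [Finset.sum_comm]
    refine Finset.sum_congr rfl fun x _ => ?_
    rw [coeffHom_path, TensorProduct.tmul_sum]
    · simp only [TensorProduct.tmul_smul]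
    · rw [← hst]; congr 1; group
  map_coactR ω := by
    refine LinearMap.congr_fun (f := C.coactR ∘ₗ coeffHom c ρ θ ξ)
      (g := (coeffHom c ρ θ ξ).rTensor _ ∘ₗ coactR) (hom_ext fun s t u hst b => ?_) ω
    rw [LinearMap.comp_apply, LinearMap.comp_apply, coeffHom_path _ _ hst, coactR_path]
    simp only [map_sum, map_smul, coactR_arrow hR, LinearMap.rTensor_tmul, Finset.smul_sum]
    rw [Finset.sum_comm]
    refine Finset.sum_congr rfl fun x _ => ?_
    rw [coeffHom_path, TensorProduct.sum_tmul]
    · simp only [TensorProduct.smul_tmul']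
    · rw [← hst, ← ConjClasses.mk_conj x⁻¹]; congr 1; group

/-- An irreducible calculus to which some matrix coefficient gives a nonzero map. -/
theorem equivalent_of_coeffHom_ne_zero (hρ : ρ.IsSimple) {w : W} (hw : w ≠ 0)
    (hc : c = ConjClasses.mk 1 → ∃ g, ρ g w ≠ w) (hC : C.IsIrreducible) {θ : C.carrier}
    (hL : C.coactL θ = 1 ⊗ₜ θ) (hR : C.coactR θ = θ ⊗ₜ 1)
    {ξ : Module.Dual k W} (hξ : coeffHom c ρ θ ξ ≠ 0) :
    C.Equivalent (calculus c hρ hw hc) :=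
  ((isHom_coeffHom hρ hw hc hL hR ξ).equivalent (isIrreducible_calculus hρ hw hc) hC hξ).symm

/-- Inserting `1 = ∑ δ_s ⊗ e` on the free side of `θ` splits both terms of the commutator into
arrows. The group element stands to the right of `θ` in the first term and to its left in the
second, hence the last arguments `1` and `v`. -/
theorem d_delta {θ : C.carrier} (hθ : ∀ a, C.d a = C.ract a θ - C.lact a θ) (t v : G) :
    C.d (delta k t v) = ∑ s, arrow θ s t v 1 - ∑ s, arrow θ t s v v := by
  have h1 : ∑ s, C.lact (delta k s 1) (C.ract (delta k t v) θ) = C.ract (delta k t v) θ := by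
    rw [← LinearMap.sum_apply, ← map_sum, ← one_def, C.one_lact]
  have h2 : ∑ s, C.ract (delta k (v⁻¹ * s * v) 1) θ = θ := by
    rw [← LinearMap.sum_apply, ← map_sum,
      Fintype.sum_equiv (MulAut.conj v⁻¹).toEquiv _ (fun s => delta k s 1) (by simp),
      ← one_def, C.one_ract]
  rw [hθ]
  simp only [arrow, inv_mul_cancel, ← map_sum, h2]
  simp [h1]

end PathForms
end

noncomputable section

/-! ### The irreducible representations of `S₃` -/

namespace S3

theorem mk_eq_mk_one_iff : ∀ τ : S3, ConjClasses.mk τ = ConjClasses.mk 1 ↔ τ = 1 := by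
  intro τ
  rw [ConjClasses.mk_eq_mk_iff_isConj, isConj_one_left]

theorem mk_eq_mk_u_iff (τ : S3) :
    ConjClasses.mk τ = ConjClasses.mk u ↔ Equiv.Perm.sign τ = 1 ∧ τ ≠ 1 := by
  rw [ConjClasses.mk_eq_mk_iff_isConj, isConj_iff]
  revert τ; decide

theorem mk_eq_mk_s_iff (τ : S3) :
    ConjClasses.mk τ = ConjClasses.mk s ↔ Equiv.Perm.sign τ = -1 := by
  rw [ConjClasses.mk_eq_mk_iff_isConj, isConj_iff]
  revert τ; decide

theorem mk_cases (τ : S3) : ConjClasses.mk τ = ConjClasses.mk 1 ∨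
    ConjClasses.mk τ = ConjClasses.mk u ∨ ConjClasses.mk τ = ConjClasses.mk s := by
  rw [mk_eq_mk_one_iff, mk_eq_mk_u_iff, mk_eq_mk_s_iff]
  revert τ; decide

theorem mk_one_ne_mk_u : (ConjClasses.mk 1 : ConjClasses S3) ≠ ConjClasses.mk u := by
  rw [Ne, mk_eq_mk_u_iff]; decide

theorem mk_one_ne_mk_s : (ConjClasses.mk 1 : ConjClasses S3) ≠ ConjClasses.mk s := by
  rw [Ne, mk_eq_mk_s_iff]; decide

theorem mk_u_ne_mk_s : (ConjClasses.mk u : ConjClasses S3) ≠ ConjClasses.mk s := by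
  rw [Ne, mk_eq_mk_s_iff]; decide

theorem cases (v : S3) : v = 1 ∨ v = u ∨ v = u ^ 2 ∨ v = s ∨ v = u * s ∨ v = u ^ 2 * s := by
  revert v; decide

variable {k : Type u} [Field k]

/-- The one-dimensional representation defined by a character. -/
def charRep {G : Type v} [Group G] (χ : G →* k) : Representation k G k :=
  (Algebra.lmul k k : k →* Module.End k k).comp χ

@[simp]
theorem charRep_apply {G : Type v} [Group G] (χ : G →* k) (g : G) (b : k) :
    charRep χ g b = χ g * b := rfl

theorem isSimple_charRep {G : Type v} [Group G] (χ : G →* k) : (charRep χ).IsSimple where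
  nontrivial := inferInstance
  eq_bot_or_eq_top N _ := eq_bot_or_eq_top N

variable (k) in
/-- The sign character. -/
def signChar : S3 →* k :=
  ((Int.castRingHom k : ℤ →* k).comp (Units.coeHom ℤ)).comp Equiv.Perm.sign

@[simp]
theorem signChar_apply (g : S3) : signChar k g = ((Equiv.Perm.sign g : ℤ) : k) := rfl

variable (k) in
/-- The space of the 2-dimensional representation. -/
def stdSpace : Submodule k (Fin 3 → k) := LinearMap.ker (∑ i, LinearMap.proj i)

theorem mem_stdSpace {b : Fin 3 → k} : b ∈ stdSpace k ↔ b 0 + b 1 + b 2 = 0 := by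
  simp [stdSpace, LinearMap.mem_ker, Fin.sum_univ_three]

variable (k) in
/-- The 2-dimensional representation of `S₃`. -/
def stdRep : Representation k S3 (stdSpace k) where
  toFun g := (LinearMap.funLeft k k ⇑g⁻¹).restrict fun b hb => by
    simp only [stdSpace, LinearMap.mem_ker, LinearMap.sum_apply, LinearMap.proj_apply,
      LinearMap.funLeft_apply] at hb ⊢
    rw [← hb]
    exact Equiv.sum_comp g⁻¹ b
  map_one' := rfl
  map_mul' g h := by
    ext b i
    simp [LinearMap.restrict_apply, LinearMap.funLeft_apply]

@[simp]
theorem stdRep_apply (g : S3) (b : stdSpace k) (i : Fin 3) :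
    (stdRep k g b : Fin 3 → k) i = (b : Fin 3 → k) (g⁻¹ i) := rfl

variable {q : k}

/-- An eigenvector of `u`. -/
def stdX (hq : 1 + q + q ^ 2 = 0) : stdSpace k :=
  ⟨![1, q ^ 2, q], mem_stdSpace.2 (by simp; linear_combination hq)⟩

/-- The image under `s` of the eigenvector `stdX`. -/
def stdY (hq : 1 + q + q ^ 2 = 0) : stdSpace k :=
  ⟨![q ^ 2, 1, q], mem_stdSpace.2 (by simp; linear_combination hq)⟩

variable (q) in
/-- The first coordinate of a vector in the basis `stdX`, `stdY`. -/
def coordX : Module.Dual k (stdSpace k) :=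
  (3⁻¹ : k) • (LinearMap.proj 0 + q • LinearMap.proj 1 + q ^ 2 • LinearMap.proj 2) ∘ₗ
    (stdSpace k).subtype

variable (q) in
/-- The second coordinate of a vector in the basis `stdX`, `stdY`. -/
def coordY : Module.Dual k (stdSpace k) :=
  (3⁻¹ : k) • (q • LinearMap.proj 0 + LinearMap.proj 1 + q ^ 2 • LinearMap.proj 2) ∘ₗ
    (stdSpace k).subtype

theorem coordX_apply (b : stdSpace k) :
    coordX q b = 3⁻¹ * (b.1 0 + q * b.1 1 + q ^ 2 * b.1 2) := rfl

theorem coordY_apply (b : stdSpace k) :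
    coordY q b = 3⁻¹ * (q * b.1 0 + b.1 1 + q ^ 2 * b.1 2) := rfl

theorem cube_eq_one (hq : 1 + q + q ^ 2 = 0) : q ^ 3 = 1 := by
  linear_combination (q - 1) * hq

section Basis

variable [CharZero k]

theorem ne_one (hq : 1 + q + q ^ 2 = 0) : q ≠ 1 := by
  rintro rfl
  norm_num at hq

theorem coordX_stdX (hq : 1 + q + q ^ 2 = 0) : coordX q (stdX hq) = 1 := by
  have h3 : (3 : k) ≠ 0 := by norm_num
  simp [coordX_apply, stdX]
  field_simp
  linear_combination 2 * cube_eq_one hq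

theorem coordX_stdY (hq : 1 + q + q ^ 2 = 0) : coordX q (stdY hq) = 0 := by
  simp [coordX_apply, stdY]
  linear_combination q * hq

theorem coordY_stdX (hq : 1 + q + q ^ 2 = 0) : coordY q (stdX hq) = 0 := by
  simp [coordY_apply, stdX]
  linear_combination q * hq

theorem coordY_stdY (hq : 1 + q + q ^ 2 = 0) : coordY q (stdY hq) = 1 := by
  have h3 : (3 : k) ≠ 0 := by norm_num
  simp [coordY_apply, stdY]
  field_simp
  linear_combination 2 * cube_eq_one hq

theorem eq_stdX_add_stdY (hq : 1 + q + q ^ 2 = 0) (b : stdSpace k) :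
    b = coordX q b • stdX hq + coordY q b • stdY hq := by
  have h3 : (3 : k) ≠ 0 := by norm_num
  have hb := mem_stdSpace.1 b.2
  ext i
  fin_cases i <;> simp [coordX_apply, coordY_apply, stdX, stdY] <;> field_simp
  · linear_combination hb - (b.1 0 + q * b.1 2) * cube_eq_one hq - (b.1 1 + b.1 2) * hq
  · linear_combination hb - (b.1 1 + q * b.1 2) * cube_eq_one hq - (b.1 0 + b.1 2) * hq
  · linear_combination hb - 2 * b.1 2 * cube_eq_one hq - (b.1 0 + b.1 1) * hq

theorem stdRep_u_stdX (hq : 1 + q + q ^ 2 = 0) : stdRep k u (stdX hq) = q • stdX hq := by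
  have h3 := cube_eq_one hq
  ext i
  fin_cases i
  · rw [stdRep_apply, show u⁻¹ ((fun i => i) ⟨0, by decide⟩ : Fin 3) = 2 by decide]; simp [stdX]
  · rw [stdRep_apply, show u⁻¹ ((fun i => i) ⟨1, by decide⟩ : Fin 3) = 0 by decide]
    simp [stdX]; linear_combination -h3
  · rw [stdRep_apply, show u⁻¹ ((fun i => i) ⟨2, by decide⟩ : Fin 3) = 1 by decide]
    simp [stdX]; ring

theorem stdRep_u_stdY (hq : 1 + q + q ^ 2 = 0) : stdRep k u (stdY hq) = q ^ 2 • stdY hq := by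
  have h3 := cube_eq_one hq
  ext i
  fin_cases i
  · rw [stdRep_apply, show u⁻¹ ((fun i => i) ⟨0, by decide⟩ : Fin 3) = 2 by decide]; simp [stdY]
    linear_combination -q * h3
  · rw [stdRep_apply, show u⁻¹ ((fun i => i) ⟨1, by decide⟩ : Fin 3) = 0 by decide]
    simp [stdY]
  · rw [stdRep_apply, show u⁻¹ ((fun i => i) ⟨2, by decide⟩ : Fin 3) = 1 by decide]
    simp [stdY]; linear_combination -h3

theorem stdRep_s_stdX (hq : 1 + q + q ^ 2 = 0) : stdRep k s (stdX hq) = stdY hq := by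
  ext i
  fin_cases i
  · rw [stdRep_apply, show s⁻¹ ((fun i => i) ⟨0, by decide⟩ : Fin 3) = 1 by decide]
    simp [stdX, stdY]
  · rw [stdRep_apply, show s⁻¹ ((fun i => i) ⟨1, by decide⟩ : Fin 3) = 0 by decide]
    simp [stdX, stdY]
  · rw [stdRep_apply, show s⁻¹ ((fun i => i) ⟨2, by decide⟩ : Fin 3) = 2 by decide]
    simp [stdX, stdY]

theorem stdRep_s_stdY (hq : 1 + q + q ^ 2 = 0) : stdRep k s (stdY hq) = stdX hq := by
  rw [← stdRep_s_stdX, ← Module.End.mul_apply, ← map_mul, show s * s = 1 by decide, map_one,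
    Module.End.one_apply]

theorem stdX_ne_zero (hq : 1 + q + q ^ 2 = 0) : stdX hq ≠ 0 := by
  intro h
  have := coordX_stdX hq
  rw [h, map_zero] at this
  exact zero_ne_one this

/-- The 3-cycle has the distinct eigenvalues `q` and `q²` on `stdX` and `stdY`, and the reflection
`s` exchanges the two eigenvectors. A nonzero invariant subspace therefore contains one of them,
hence both. -/
theorem isSimple_stdRep (hq : 1 + q + q ^ 2 = 0) : (stdRep k).IsSimple where
  nontrivial := ⟨⟨_, _, stdX_ne_zero hq⟩⟩
  eq_bot_or_eq_top N hN := by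
    have hX : stdX hq ∈ N → N = ⊤ := by
      intro hX
      refine eq_top_iff.2 fun b _ => ?_
      rw [eq_stdX_add_stdY hq b, ← stdRep_s_stdX]
      exact N.add_mem (N.smul_mem _ hX) (N.smul_mem _ (hN _ _ hX))
    by_contra! h
    obtain ⟨b, hb, hb0⟩ := (Submodule.ne_bot_iff _).1 h.1
    have h1 : coordX q b = 0 := by
      by_contra hne
      refine h.2 (hX ?_)
      -- The operator `u - q²` kills the `stdY` component and scales the `stdX` component by `q(1 -
      -- q) ≠ 0`.
      have : stdRep k u b - q ^ 2 • b ∈ N := N.sub_mem (hN _ _ hb) (N.smul_mem _ hb)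
      have h2 : stdRep k u b - q ^ 2 • b = (coordX q b * (q * (1 - q))) • stdX hq := by
        conv_lhs => rw [eq_stdX_add_stdY hq b]
        rw [map_add, map_smul, map_smul, stdRep_u_stdX, stdRep_u_stdY]
        module
      rw [h2] at this
      refine (N.smul_mem_iff (mul_ne_zero hne (mul_ne_zero ?_ ?_))).1 this
      · rintro rfl; norm_num at hq
      · exact sub_ne_zero.2 (ne_one hq).symm
    refine h.2 (hX ?_)
    have h2 : b = coordY q b • stdY hq := by
      conv_lhs => rw [eq_stdX_add_stdY hq b, h1, zero_smul, zero_add]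
    have h3 : coordY q b ≠ 0 := fun h3 => hb0 (by rw [h2, h3, zero_smul])
    rw [h2] at hb
    have := hN s _ ((N.smul_mem_iff h3).1 hb)
    rwa [stdRep_s_stdY] at this

theorem finrank_stdSpace (hq : 1 + q + q ^ 2 = 0) : Module.finrank k (stdSpace k) = 2 := by
  have e : stdSpace k ≃ₗ[k] k × k := LinearEquiv.ofLinearMap
    ((coordX q).prod (coordY q))
    ((LinearMap.toSpanSingleton k _ (stdX hq)).coprod (LinearMap.toSpanSingleton k _ (stdY hq)))
    (by
      ext <;> simp [coordX_stdX hq, coordX_stdY hq, coordY_stdX hq, coordY_stdY hq])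
    (by
      ext1 b
      simpa using (eq_stdX_add_stdY hq b).symm)
  rw [e.finrank_eq]; simp

end Basis

end S3
end

noncomputable section

open QuantumDouble BicovariantCalculus PathForms

/-! ### Calculi equivalent to a path calculus -/

namespace PathForms

variable {k : Type u} [Field k] {G : Type v} [Group G] [DecidableEq G] [Fintype G]
  {c : ConjClasses G} {W : Type w} [AddCommGroup W] [Module k W] {ρ : Representation k G W}
  {C : BicovariantCalculus.{u, max u v, w'} k (QuantumDouble k G)}

/-- The differential of a calculus equivalent to `calculus` is inner, up to the equivalence. -/
theorem exists_d_eq_zero_iff (hG : (Fintype.card G : k) ≠ 0) (hρ : ρ.IsSimple) {w : W}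
    (hw : w ≠ 0) (hc : c = ConjClasses.mk 1 → ∃ g, ρ g w ≠ w)
    (h : C.Equivalent (calculus c hρ hw hc)) :
    ∃ b, ∀ a, C.d a = 0 ↔ innerD ρ (c := c) b a = 0 := by
  obtain ⟨φ, hφ⟩ := equivalent_iff.1 h
  obtain ⟨θ, hL, hR, hd⟩ := C.exists_inner hG
  -- Equivalence does not respect the differentials, so the vector `b` need not be the chosen `w`;
  -- only bi-invariance of the image of `θ` is available.
  obtain ⟨b, hb⟩ := exists_eq_innerForm (k := k) (ω := (φ θ : PathForms c W))
    ((hφ.map_coactL θ).trans (by rw [hL]; rfl)) ((hφ.map_coactR θ).trans (by rw [hR]; rfl))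
  refine ⟨b, fun a => ?_⟩
  have : φ (C.d a) = innerD ρ (c := c) b a := by
    rw [hd, map_sub]
    have h1 : φ (C.ract a θ) = ract a (innerForm k c b) := by
      rw [← hb]; exact hφ.map_ract a θ
    have h2 : φ (C.lact a θ) = lact ρ a (innerForm k c b) := by
      rw [← hb]; exact hφ.map_lact a θ
    rw [h1, h2]; rfl
  rw [← φ.map_eq_zero_iff, this]
  exact Iff.rfl

/-- For the trivial class all arrows are loops, and the loop at `s` occurs with both signs. -/
theorem innerD_eq_zero_of_class_one (b : W) (s : G) :
    innerD ρ (c := ConjClasses.mk 1) b (delta k s 1) = 0 := by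
  have h : ∀ s t : G, s ≠ t → ConjClasses.mk (s⁻¹ * t) ≠ ConjClasses.mk 1 := by
    intro s t hst h
    rw [ConjClasses.mk_eq_mk_iff_isConj, isConj_one_left, inv_mul_eq_one] at h
    exact hst h
  rw [innerD_delta, Finset.sum_eq_single s, Finset.sum_eq_single s, map_one,
    Module.End.one_apply, sub_self]
  · exact fun t _ ht => path_of_ne (h _ _ (Ne.symm ht)) _ _
  · simp
  · exact fun t _ ht => path_of_ne (h _ _ ht) _ _
  · simp

/-- Summed over `t`, each arrow decorated by `v` occurs once as incoming with vector `b` and once as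
outgoing with vector `ρ(v) b`. -/
theorem innerD_sum_delta_eq_zero (b : W) {v : G} (hv : ρ v b = b) :
    innerD ρ (c := c) b (∑ t, delta k t v) = 0 := by
  rw [map_sum]
  simp only [innerD_delta, hv, Finset.sum_sub_distrib]
  rw [Finset.sum_comm, sub_self]

end PathForms

namespace QuantumDouble

variable {k : Type u} [Field k] {G : Type v} [Group G] [DecidableEq G] [Fintype G]

theorem coord_delta (x v s u : G) :
    basis.coord (x, v) (delta k s u) = if s = x then if u = v then 1 else 0 else 0 := by
  simp [delta, Finsupp.single_apply, ite_and]

theorem notMem_span_one {a : QuantumDouble k G} {x y v : G}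
    (h : basis.coord (x, v) a ≠ basis.coord (y, v) a) : a ∉ Submodule.span k {1} := by
  intro ha
  obtain ⟨r, rfl⟩ := Submodule.mem_span_singleton.1 ha
  rw [map_smul, map_smul, basis_coord_one, basis_coord_one] at h
  exact h rfl

theorem notMem_span_one' {a : QuantumDouble k G} {x v : G} (hv : v ≠ 1)
    (h : basis.coord (x, v) a ≠ 0) : a ∉ Submodule.span k {1} := by
  intro ha
  obtain ⟨r, rfl⟩ := Submodule.mem_span_singleton.1 ha
  rw [map_smul, basis_coord_one, if_neg hv, smul_zero] at h
  exact h rfl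

end QuantumDouble

/-! ### The eight calculi on `D(S₃)` -/

/-- A simple representation with a chosen nonzero vector. -/
structure PointedRep (k : Type u) [Field k] (G : Type v) [Group G] where
  /-- The underlying space. -/
  space : Type u
  [addCommGroup : AddCommGroup space]
  [module : Module k space]
  [finiteDimensional : FiniteDimensional k space]
  /-- The representation. -/
  rep : Representation k G space
  isSimple : rep.IsSimple
  /-- The chosen vector. -/
  vector : space
  vector_ne_zero : vector ≠ 0

namespace PointedRep
attribute [instance] addCommGroup module finiteDimensional
end PointedRep

namespace S3

variable {k : Type u} [Field k]

/-- The one-dimensional representations. -/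
def charPointedRep (χ : S3 →* k) : PointedRep k S3 where
  space := k
  rep := charRep χ
  isSimple := isSimple_charRep χ
  vector := 1
  vector_ne_zero := one_ne_zero

/-- The 2-dimensional representation, with the vector `stdX`. -/
def stdPointedRep [CharZero k] {q : k} (hq : 1 + q + q ^ 2 = 0) : PointedRep k S3 where
  space := stdSpace k
  rep := stdRep k
  isSimple := isSimple_stdRep hq
  vector := stdX hq
  vector_ne_zero := stdX_ne_zero hq

/-- The three irreducible representations of `S₃`. -/
def irrep [CharZero k] {q : k} (hq : 1 + q + q ^ 2 = 0) : Fin 3 → PointedRep k S3 :=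
  ![charPointedRep 1, charPointedRep (signChar k), stdPointedRep hq]

/-- The three conjugacy classes of `S₃`. -/
def cls : Fin 3 → ConjClasses S3 := ![ConjClasses.mk 1, ConjClasses.mk u, ConjClasses.mk s]

variable [CharZero k] {q : k} (hq : 1 + q + q ^ 2 = 0)

theorem irrep_moves {i j : Fin 3} (h : i ≠ 0 ∨ j ≠ 0) (hc : cls i = ConjClasses.mk 1) :
    ∃ g, (irrep hq j).rep g (irrep hq j).vector ≠ (irrep hq j).vector := by
  have hi : i = 0 := by
    fin_cases i
    · rfl
    · exact absurd hc mk_one_ne_mk_u.symm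
    · exact absurd hc mk_one_ne_mk_s.symm
  have hj := h.resolve_left (not_not.2 hi)
  fin_cases j
  · exact absurd rfl hj
  · refine ⟨s, ?_⟩
    change charRep (signChar k) s 1 ≠ 1
    have : Equiv.Perm.sign s = -1 := by decide
    rw [charRep_apply, signChar_apply, this]
    norm_num
  · refine ⟨u, ?_⟩
    change stdRep k u (stdX hq) ≠ stdX hq
    rw [stdRep_u_stdX]
    intro h
    have := congrArg (coordX q) h
    rw [map_smul, coordX_stdX, smul_eq_mul, mul_one] at this
    exact ne_one hq this

/-- The calculus given by a conjugacy class and an irreducible representation, not both trivial. -/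
def pairCalculus (p : {p : Fin 3 × Fin 3 // p.1 ≠ 0 ∨ p.2 ≠ 0}) :
    BicovariantCalculus.{u, u, u} k (QuantumDouble k S3) :=
  calculus (cls p.1.1) (irrep hq p.1.2).isSimple (irrep hq p.1.2).vector_ne_zero
    (irrep_moves hq p.2)

/-- Invariance under the 3-cycle makes all three coordinates equal, and their sum is zero. -/
theorem eq_zero_of_stdRep_u {b : stdSpace k} (h : stdRep k u b = b) : b = 0 := by
  have h3 : (3 : k) ≠ 0 := by norm_num
  have hb := mem_stdSpace.1 b.2
  have h0 : b.1 (u⁻¹ 0) = b.1 0 := congrFun (congrArg Subtype.val h) 0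
  have h1 : b.1 (u⁻¹ 1) = b.1 1 := congrFun (congrArg Subtype.val h) 1
  rw [show (u⁻¹ : S3) 0 = 2 by decide] at h0
  rw [show (u⁻¹ : S3) 1 = 0 by decide] at h1
  ext i
  have h2 : b.1 0 = 0 := by
    have : 3 * b.1 0 = 0 := by linear_combination hb - h0 + h1
    exact (mul_eq_zero.1 this).resolve_left h3
  fin_cases i
  · exact h2
  · exact h1.symm.trans h2
  · exact h0.trans h2

/-- The 3-cycle fixes everything in the one-dimensional representations and no nonzero vector in the
2-dimensional one; the reflection `s` separates the trivial and sign characters. -/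
theorem irrep_eq_of_injective {i j : Fin 3} (T : (irrep hq i).space →ₗ[k] (irrep hq j).space)
    (hT : Function.Injective T)
    (hT' : ∀ g b, T ((irrep hq i).rep g b) = (irrep hq j).rep g (T b)) : i = j := by
  have hs : Equiv.Perm.sign s = -1 := by decide
  have hu : Equiv.Perm.sign u = 1 := by decide
  have h2 : ∀ {x : k}, x = -x → x = 0 := fun h => self_eq_neg.1 h
  fin_cases i <;> fin_cases j
  · rfl
  · exfalso
    -- Repackaging `T` exposes the concrete spaces and representations hidden behind `irrep`; the
    -- other cases do the same.
    obtain ⟨T, hT, hT'⟩ : ∃ T : k →ₗ[k] k, Function.Injective T ∧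
      ∀ g b, T (charRep 1 g b) = charRep (signChar k) g (T b) := ⟨T, hT, hT'⟩
    have h := hT' s 1
    rw [charRep_apply, charRep_apply, signChar_apply, hs] at h
    have h1 : T 1 = 0 := h2 (by simpa using h)
    exact one_ne_zero (hT (h1.trans (map_zero T).symm))
  · exfalso
    obtain ⟨T, hT, hT'⟩ : ∃ T : k →ₗ[k] stdSpace k, Function.Injective T ∧
      ∀ g b, T (charRep 1 g b) = stdRep k g (T b) := ⟨T, hT, hT'⟩
    have h := hT' u 1
    rw [charRep_apply, MonoidHom.one_apply, one_mul] at h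
    have h1 : T 1 = 0 := eq_zero_of_stdRep_u h.symm
    exact one_ne_zero (hT (h1.trans (map_zero T).symm))
  · exfalso
    obtain ⟨T, hT, hT'⟩ : ∃ T : k →ₗ[k] k, Function.Injective T ∧
      ∀ g b, T (charRep (signChar k) g b) = charRep 1 g (T b) := ⟨T, hT, hT'⟩
    have h := hT' s 1
    rw [charRep_apply, charRep_apply, signChar_apply, hs] at h
    have h1 : T 1 = 0 := h2 (by simpa using h.symm)
    exact one_ne_zero (hT (h1.trans (map_zero T).symm))
  · rfl
  · exfalso
    obtain ⟨T, hT, hT'⟩ : ∃ T : k →ₗ[k] stdSpace k, Function.Injective T ∧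
      ∀ g b, T (charRep (signChar k) g b) = stdRep k g (T b) := ⟨T, hT, hT'⟩
    have h := hT' u 1
    rw [charRep_apply, signChar_apply, hu] at h
    have h1 : T 1 = 0 := eq_zero_of_stdRep_u (by simpa using h.symm)
    exact one_ne_zero (hT (h1.trans (map_zero T).symm))
  · exfalso
    obtain ⟨T, hT, hT'⟩ : ∃ T : stdSpace k →ₗ[k] k, Function.Injective T ∧
      ∀ g b, T (stdRep k g b) = charRep 1 g (T b) := ⟨T, hT, hT'⟩
    have h := hT' u (stdX hq)
    rw [charRep_apply, MonoidHom.one_apply, one_mul] at h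
    exact stdX_ne_zero hq (eq_zero_of_stdRep_u (hT h))
  · exfalso
    obtain ⟨T, hT, hT'⟩ : ∃ T : stdSpace k →ₗ[k] k, Function.Injective T ∧
      ∀ g b, T (stdRep k g b) = charRep (signChar k) g (T b) := ⟨T, hT, hT'⟩
    have h := hT' u (stdX hq)
    rw [charRep_apply, signChar_apply, hu, Units.val_one, Int.cast_one, one_mul] at h
    exact stdX_ne_zero hq (eq_zero_of_stdRep_u (hT h))
  · rfl

theorem cls_injective : Function.Injective cls := by
  intro i j h
  fin_cases i <;> fin_cases j
  · rfl
  · exact absurd h mk_one_ne_mk_u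
  · exact absurd h mk_one_ne_mk_s
  · exact absurd h mk_one_ne_mk_u.symm
  · rfl
  · exact absurd h mk_u_ne_mk_s
  · exact absurd h mk_one_ne_mk_s.symm
  · exact absurd h mk_u_ne_mk_s.symm
  · rfl

theorem pairCalculus_eq_of_equivalent {p p' : {p : Fin 3 × Fin 3 // p.1 ≠ 0 ∨ p.2 ≠ 0}}
    (h : (pairCalculus hq p).Equivalent (pairCalculus hq p')) : p = p' := by
  obtain ⟨h1, T, hT, hT'⟩ := eq_and_exists_of_equivalent _ _ _ _ _ _ h
  exact Subtype.ext (Prod.ext (cls_injective h1) (irrep_eq_of_injective hq T hT hT'))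

theorem isIrreducible_pairCalculus (p : {p : Fin 3 × Fin 3 // p.1 ≠ 0 ∨ p.2 ≠ 0}) :
    (pairCalculus hq p).IsIrreducible :=
  isIrreducible_calculus _ _ _

theorem card_cls (i : Fin 3) :
    Nat.card {τ : S3 // ConjClasses.mk τ = cls i} = (![1, 2, 3] : Fin 3 → ℕ) i := by
  fin_cases i
  · refine (Nat.card_congr (Equiv.subtypeEquivRight (q := fun τ : S3 => τ = 1)
      mk_eq_mk_one_iff)).trans ?_
    rw [Nat.card_eq_fintype_card]
    decide
  · refine (Nat.card_congr (Equiv.subtypeEquivRight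
      (q := fun τ : S3 => Equiv.Perm.sign τ = 1 ∧ τ ≠ 1) mk_eq_mk_u_iff)).trans ?_
    rw [Nat.card_eq_fintype_card]
    decide
  · refine (Nat.card_congr (Equiv.subtypeEquivRight
      (q := fun τ : S3 => Equiv.Perm.sign τ = -1) mk_eq_mk_s_iff)).trans ?_
    rw [Nat.card_eq_fintype_card]
    decide

theorem finrank_irrep (j : Fin 3) :
    Module.finrank k (irrep hq j).space = (![1, 1, 2] : Fin 3 → ℕ) j := by
  fin_cases j
  · exact Module.finrank_self k
  · exact Module.finrank_self k
  · exact finrank_stdSpace hq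

theorem dim_pairCalculus (p : {p : Fin 3 × Fin 3 // p.1 ≠ 0 ∨ p.2 ≠ 0}) :
    (pairCalculus hq p).dim = (![1, 2, 3] : Fin 3 → ℕ) p.1.1 * (![1, 1, 2] : Fin 3 → ℕ) p.1.2 := by
  rw [← card_cls, ← finrank_irrep hq]
  exact dim_calculus _ _ _

/-- The regular character is `1 + sign + 2χ` with `χ` the number of fixed points minus `1`.
Subtracting `1` inside the sum over three points removes `3` instead of `1`, and the summand `4`
corrects this. -/
theorem regular_character (h : S3) :
    1 + (Equiv.Perm.sign h : ℤ) + 2 * ∑ i, ((if h⁻¹ i = i then 1 else 0 : ℤ) - 1) + 4 =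
      if h = 1 then 6 else 0 := by
  revert h; decide

/-- The projection of a basis vector to the 2-dimensional representation. -/
def stdProj (i : Fin 3) : stdSpace k :=
  ⟨fun j => (if j = i then 1 else 0) - 3⁻¹, mem_stdSpace.2 (by
    have h3 : (3 : k) ≠ 0 := by norm_num
    fin_cases i <;> simp <;> field_simp <;> norm_num)⟩

theorem regular_character' (h : S3) :
    (1 : k) + ((Equiv.Perm.sign h : ℤ) : k) + 2 * ∑ i, (stdRep k h (stdProj i)).1 i =
      if h = 1 then 6 else 0 := by
  have h3 : (3 : k) ≠ 0 := by norm_num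
  have := congrArg (Int.cast : ℤ → k) (regular_character h)
  push_cast at this
  rw [← this]
  simp only [stdRep_apply, stdProj, Fin.sum_univ_three]
  field_simp
  ring

section Classification

variable {C : BicovariantCalculus.{u, u, w} k (QuantumDouble k S3)}

/-- A function on `S₃` that is orthogonal to the coefficients of the nontrivial irreducible
representations is constant. -/
theorem six_smul_eq_sum {V : Type*} [AddCommGroup V] [Module k V] (f : S3 → V)
    (h1 : ∑ g, ((Equiv.Perm.sign g⁻¹ : ℤ) : k) • f g = 0)
    (h2 : ∀ (b : stdSpace k) i, ∑ g, (stdRep k g⁻¹ b).1 i • f g = 0) (h : S3) :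
    (6 : k) • f h = ∑ g, f g := by
  -- The hypotheses are stable under translation by `h`. Adding the translated relations with their
  -- multiplicities assembles the regular character of `g⁻¹h`, which is supported at `g = h`.
  have h1' : ∑ g, ((Equiv.Perm.sign (g⁻¹ * h) : ℤ) : k) • f g = 0 := by
    simp only [map_mul, Units.val_mul, Int.cast_mul, mul_comm _ ((Equiv.Perm.sign h : ℤ) : k),
      mul_smul]
    rw [← Finset.smul_sum, h1, smul_zero]
  have h2' : ∑ g, (∑ i, (stdRep k (g⁻¹ * h) (stdProj i)).1 i) • f g = 0 := by
    simp only [Finset.sum_smul]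
    rw [Finset.sum_comm]
    refine Finset.sum_eq_zero fun i _ => ?_
    have := h2 (stdRep k h (stdProj i)) i
    simpa only [map_mul, Module.End.mul_apply] using this
  have h6 : ∑ g, ((1 : k) + ((Equiv.Perm.sign (g⁻¹ * h) : ℤ) : k) +
      2 * ∑ i, (stdRep k (g⁻¹ * h) (stdProj i)).1 i) • f g = ∑ g, f g := by
    simp only [add_smul, one_smul, mul_smul, Finset.sum_add_distrib]
    rw [h1', ← Finset.smul_sum, h2']
    simp
  simp only [regular_character', inv_mul_eq_one, ite_smul, zero_smul] at h6
  rw [Finset.sum_ite_eq' Finset.univ h] at h6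
  simpa using h6

theorem card_ne_zero : (Fintype.card S3 : k) ≠ 0 := by
  rw [show Fintype.card S3 = 6 by decide]
  norm_num

/-- Every irreducible calculus is equivalent to one of the eight. -/
theorem exists_equivalent (hC : C.IsIrreducible) : ∃ p, C.Equivalent (pairCalculus hq p) := by
  by_contra! hne
  obtain ⟨θ, hL, hR, hd⟩ := C.exists_inner card_ne_zero
  -- By Schur's lemma a nonzero `coeffHom` would give an excluded equivalence.
  have hzero : ∀ (p : {p : Fin 3 × Fin 3 // p.1 ≠ 0 ∨ p.2 ≠ 0}) ξ,
      coeffHom (cls p.1.1) (irrep hq p.1.2).rep θ ξ = 0 := fun p ξ => by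
    by_contra hξ
    exact hne p (equivalent_of_coeffHom_ne_zero _ _ _ hC hL hR hξ)
  have hsum : ∀ (i j : Fin 3) (_ : i ≠ 0 ∨ j ≠ 0) (ξ : Module.Dual k (irrep hq j).space) b
      (s t v : S3), ConjClasses.mk (s⁻¹ * t) = cls i →
      ∑ g, ξ ((irrep hq j).rep g⁻¹ b) • arrow θ s t v g = 0 := by
    intro i j hij ξ b s t v hst
    rw [← coeffHom_path θ ξ hst, hzero ⟨(i, j), hij⟩]
    rfl
  have hcls : ∀ τ : S3, ∃ i, ConjClasses.mk τ = cls i := by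
    intro τ
    rcases mk_cases τ with h | h | h
    exacts [⟨0, h⟩, ⟨1, h⟩, ⟨2, h⟩]
  -- The sign and the 2-dimensional representation are admissible for every class, including the
  -- trivial one, so each arrow is constant in `g`.
  have hconst : ∀ s t v g, (6 : k) • arrow θ s t v g = ∑ g, arrow θ s t v g := by
    intro s t v g
    obtain ⟨i, hi⟩ := hcls (s⁻¹ * t)
    refine six_smul_eq_sum (fun g => arrow θ s t v g) ?_ (fun b i' => ?_) g
    · have := hsum i 1 (Or.inr (by decide)) (LinearMap.id (R := k) (M := k)) (1 : k) s t v hi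
      refine Eq.trans (Finset.sum_congr rfl fun g _ => ?_) this
      change _ = (charRep (signChar k) g⁻¹ 1 : k) • _
      rw [charRep_apply, signChar_apply, mul_one]
    · exact hsum i 2 (Or.inr (by decide))
        ((LinearMap.proj i' : (Fin 3 → k) →ₗ[k] k) ∘ₗ (stdSpace k).subtype) b s t v hi
  have h6 : (6 : k) ≠ 0 := by norm_num
  -- Off the diagonal the trivial representation is admissible too, so the constant value also sums
  -- to zero over `g`.
  have hoff : ∀ s t v g, s ≠ t → arrow θ s t v g = 0 := by
    intro s t v g hst
    obtain ⟨i, hi⟩ := hcls (s⁻¹ * t)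
    have hi0 : i ≠ 0 := by
      rintro rfl
      have h1 := (mk_eq_mk_one_iff _).1 hi
      exact hst (inv_mul_eq_one.1 h1)
    have h0 := hsum i 0 (Or.inl hi0) (LinearMap.id (R := k) (M := k)) (1 : k) s t v hi
    refine (smul_eq_zero.1 ((hconst s t v g).trans (Eq.trans ?_ h0))).resolve_left h6
    refine Finset.sum_congr rfl fun g _ => ?_
    change _ = (charRep 1 g⁻¹ 1 : k) • _
    rw [charRep_apply, MonoidHom.one_apply, one_mul, one_smul]
  -- Only loops remain in `d_delta`, and the two of them differ only in `g`, on which they do not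
  -- depend.
  have hd0 : C.d = 0 := by
    refine QuantumDouble.hom_ext fun t v => ?_
    rw [d_delta hd, Finset.sum_eq_single t (fun s _ hs => hoff _ _ _ _ hs) (by simp),
      Finset.sum_eq_single t (fun s _ hs => hoff _ _ _ _ hs.symm) (by simp),
      LinearMap.zero_apply, sub_eq_zero]
    refine smul_right_injective _ h6 ?_
    change (6 : k) • _ = (6 : k) • _
    rw [hconst, hconst]
  have htop := C.span_lact_d
  have hbot : Submodule.span k {ω | ∃ a b, C.lact a (C.d b) = ω} = ⊥ := by
    refine (Submodule.span_eq_bot).2 ?_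
    rintro _ ⟨a, b, rfl⟩
    rw [hd0, LinearMap.zero_apply, map_zero]
  obtain ⟨x, y, hxy⟩ := hC.1
  have hall : ∀ z : C.carrier, z = 0 := fun z =>
    (Submodule.mem_bot k).1 (hbot ▸ htop ▸ Submodule.mem_top)
  exact hxy ((hall x).trans (hall y).symm)

/-- Only the 6-dimensional calculi can be connected. -/
theorem eq_of_H0_eq {p : {p : Fin 3 × Fin 3 // p.1 ≠ 0 ∨ p.2 ≠ 0}}
    (h : C.Equivalent (pairCalculus hq p)) (hH : C.H0 = Submodule.span k {1}) :
    p.1 = (2, 2) := by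
  obtain ⟨b, hb⟩ := exists_d_eq_zero_iff card_ne_zero _ _ _ h
  have hmem : ∀ a, innerD (irrep hq p.1.2).rep (c := cls p.1.1) b a = 0 →
      a ∈ Submodule.span k {1} := fun a ha => by
    rw [← hH]; exact (hb a).2 ha
  clear h hb hH
  obtain ⟨⟨i, j⟩, hij⟩ := p
  -- If some `g ≠ 1` acts trivially, then `∑ δ_t ⊗ g` lies in the kernel of `d` but is not a
  -- multiple of `1`. This excludes both characters, with `g = u`.
  have hu : ∀ g, Equiv.Perm.sign g = 1 → (∀ b, (irrep hq j).rep g b = b) → g ≠ 1 → False := by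
    intro g _ hg hg1
    refine notMem_span_one' (x := 1) hg1 ?_ (hmem _ (innerD_sum_delta_eq_zero b (hg b)))
    rw [map_sum]
    simp only [coord_delta]
    rw [Finset.sum_ite_eq']
    simp
  have hj : j = 2 := by
    fin_cases j
    · exact (hu u (by decide) (show ∀ b : k, charRep (1 : S3 →* k) u b = b from
        fun b => one_mul b) (by decide)).elim
    · refine (hu u (by decide) (show ∀ b : k, charRep (signChar k) u b = b from
        fun b => ?_) (by decide)).elim
      rw [charRep_apply, signChar_apply, show Equiv.Perm.sign u = 1 by decide]
      simp
    · rfl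
  have hi : i = 2 := by
    fin_cases i
    · refine (notMem_span_one (x := 1) (y := s) (v := 1) ?_
        (hmem _ (innerD_eq_zero_of_class_one b 1))).elim
      rw [coord_delta, coord_delta, if_neg (by decide : (1 : S3) ≠ s)]
      simp
    -- Arrows in the class of 3-cycles preserve the sign, so the indicator function of the even
    -- permutations is killed by `d`.
    · refine (notMem_span_one (x := 1) (y := s) (v := 1)
        (a := ∑ t with Equiv.Perm.sign t = 1, delta k t 1) ?_ (hmem _ ?_)).elim
      · rw [map_sum, map_sum]
        simp only [coord_delta]
        simp only [if_true, Finset.sum_ite_eq']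
        rw [if_pos (by decide), if_neg (by decide)]
        exact one_ne_zero
      · rw [map_sum]
        simp only [innerD_delta, map_one, Module.End.one_apply, Finset.sum_sub_distrib]
        rw [sub_eq_zero]
        have h1 : ∀ s t : S3, ¬ (Equiv.Perm.sign s = 1 ↔ Equiv.Perm.sign t = 1) → ∀ b,
            path k (cls 1) s t 1 b = (0 : PathForms (cls 1) (irrep hq j).space) := by
          intro s t hst b
          refine path_of_ne (fun h => hst ?_) _ _
          have := ((mk_eq_mk_u_iff _).1 h).1
          rw [map_mul, map_inv, inv_mul_eq_one] at this
          rw [this]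
        have h2 : ∀ t : S3, Equiv.Perm.sign t = 1 → ∑ s, path k (cls 1) s t 1 b =
            ∑ s with Equiv.Perm.sign s = 1, path k (cls 1) s t 1 b := by
          intro t ht
          rw [Finset.sum_filter]
          refine Finset.sum_congr rfl fun s _ => ?_
          split_ifs with hs
          · rfl
          · exact h1 _ _ (by simp [ht, hs]) _
        have h3 : ∀ t : S3, Equiv.Perm.sign t = 1 → ∑ s, path k (cls 1) t s 1 b =
            ∑ s with Equiv.Perm.sign s = 1, path k (cls 1) t s 1 b := by
          intro t ht
          rw [Finset.sum_filter]
          refine Finset.sum_congr rfl fun s _ => ?_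
          split_ifs with hs
          · rfl
          · exact h1 _ _ (by simp [ht, hs]) _
        refine (Finset.sum_congr rfl fun t ht => h2 t (Finset.mem_filter.1 ht).2).trans
          (Eq.trans ?_ (Finset.sum_congr rfl fun t ht => (h3 t (Finset.mem_filter.1 ht).2).symm))
        exact Finset.sum_comm
    · rfl
  exact Prod.ext hi hj

end Classification

end S3
end

/-! ### Maurer-Cartan form and `H⁰` of the 6-dimensional calculus -/

noncomputable section

open QuantumDouble BicovariantCalculus PathForms

namespace PathForms

variable {k : Type u} [Field k] {G : Type v} [Group G] [DecidableEq G] [Fintype G]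
  {c : ConjClasses G} {W : Type w} [AddCommGroup W] [Module k W] {ρ : Representation k G W}

/-- The differential is a gradient along arrows, twisted by `ρ(v)`. Kernel and image questions
become linear equations on a graph, one for each decoration `v`. -/
theorem val_innerD {s t : G} (h : ConjClasses.mk (s⁻¹ * t) = c) (v : G) (w : W)
    (a : QuantumDouble k G) : val k c s t v (innerD ρ w a) =
      basis.coord (t, v) a • w - basis.coord (s, v) a • ρ v w := by
  refine LinearMap.congr_fun (f := val k c s t v ∘ₗ innerD ρ w)
    (g := LinearMap.toSpanSingleton k W w ∘ₗ basis.coord (t, v) -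
      LinearMap.toSpanSingleton k W (ρ v w) ∘ₗ basis.coord (s, v))
    (QuantumDouble.hom_ext fun t' v' => ?_) a
  simp only [LinearMap.comp_apply, innerD_delta, map_sub, map_sum, val_path h,
    LinearMap.sub_apply, coord_delta, LinearMap.toSpanSingleton_apply]
  congr 1
  · simp
  · by_cases hv : v' = v
    · subst hv; simp
    · simp [hv]

section Calculus

variable (hρ : ρ.IsSimple) {w : W} (hw : w ≠ 0) (hc : c = ConjClasses.mk 1 → ∃ g, ρ g w ≠ w)

/-- For an inner differential, `S(a₁) d a₂ = S(a₁) θ a₂ - ε(a) θ`. The adjoint action of `δ_t ⊗ v`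
selects the single direction `v⁻¹tv` in `θ` and applies `ρ(v⁻¹)`. -/
theorem maurerCartan_calculus (t v : G) : (calculus c hρ hw hc).maurerCartan (delta k t v) =
    leftForm k c (v⁻¹ * t * v) (ρ v⁻¹ w) - if t = 1 then innerForm k c w else 0 := by
  have h1 : (calculus c hρ hw hc).maurerCartan (delta k t v) =
      ∑ a, lact ρ (delta k (v⁻¹ * a * v)⁻¹ v⁻¹) (innerD ρ w (delta k (a⁻¹ * t) v)) := by
    have : ∀ s u : G, HopfAlgebra.antipode k (delta k s u) = delta k (u⁻¹ * s * u)⁻¹ u⁻¹ :=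
      fun s u => QuantumDouble.lift_delta _ s u
    rw [maurerCartan, LinearMap.comp_apply, LinearMap.comp_apply]
    change TensorProduct.lift _ (TensorProduct.map _ _ (CoalgebraStruct.comul _)) = _
    simp only [comul_delta, map_sum, TensorProduct.map_tmul, TensorProduct.lift.tmul, this]
    rfl
  have h2 : ∀ a : G, lact ρ (delta k (v⁻¹ * a * v)⁻¹ v⁻¹) (innerD ρ w (delta k (a⁻¹ * t) v)) =
      path k c (v⁻¹ * a * v)⁻¹ ((v⁻¹ * a * v)⁻¹ * (v⁻¹ * t * v)) 1 (ρ v⁻¹ w) -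
      if t = 1 then ∑ r, path k c (v⁻¹ * a * v)⁻¹ r 1 w else 0 := by
    intro a
    have e : v⁻¹⁻¹ * (v⁻¹ * a * v)⁻¹ * v⁻¹ = a⁻¹ := by group
    have e' : v⁻¹ * (a⁻¹ * t) * v⁻¹⁻¹ = (v⁻¹ * a * v)⁻¹ * (v⁻¹ * t * v) := by group
    have e'' : a⁻¹ = a⁻¹ * t ↔ t = 1 := by simp
    simp only [innerD_delta, map_sub, map_sum, lact_path, e, Finset.sum_ite_eq, Finset.mem_univ,
      if_true, e', e'', inv_mul_cancel]
    congr 1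
    split_ifs
    · rw [← Module.End.mul_apply, ← map_mul, inv_mul_cancel, map_one, Module.End.one_apply]
      exact Fintype.sum_equiv (MulAut.conj v⁻¹).toEquiv _ _ fun t => rfl
    · simp
  rw [h1]
  simp only [h2, Finset.sum_sub_distrib]
  have e : ∀ f : G → PathForms c W, ∑ a, f (v⁻¹ * a * v)⁻¹ = ∑ a, f a := fun f =>
    Fintype.sum_equiv ((MulAut.conj v⁻¹).toEquiv.trans (Equiv.inv G)) _ _ fun a => by simp
  congr 1
  · rw [leftForm_apply]
    exact e fun a => path k c a (a * (v⁻¹ * t * v)) 1 (ρ v⁻¹ w)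
  · split_ifs
    · exact e fun a => ∑ r, path k c a r 1 w
    · simp

end Calculus

end PathForms

theorem tangentVector_delta {k : Type u} [Field k] {G : Type v} [Group G] [DecidableEq G]
    [Fintype G] (v t x y : G) : tangentVector k v t (delta k x y) =
      (if x = t then if y = v then 1 else 0 else 0) -
        if v = 1 then if x = 1 then 1 else 0 else 0 := by
  rw [tangentVector, LinearMap.sub_apply, coord_delta]
  split_ifs <;> simp_all [counit_delta]

namespace S3

variable {k : Type u} [Field k] [CharZero k] {q : k} (hq : 1 + q + q ^ 2 = 0)

/-- The action of a rotation or a reflection on the eigenvectors of `u`. -/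
theorem stdRep_cases (v : S3) :
    (∃ r : k, r ^ 3 = 1 ∧ (v = 1 ∨ r ≠ 1) ∧ stdRep k v (stdX hq) = r • stdX hq ∧
      stdRep k v (stdY hq) = r ^ 2 • stdY hq) ∨
    (∃ r : k, r ^ 3 = 1 ∧ stdRep k v (stdX hq) = r • stdY hq ∧
      stdRep k v (stdY hq) = r ^ 2 • stdX hq) := by
  have h3 := cube_eq_one hq
  have h6 : (q ^ 2) ^ 3 = 1 := by linear_combination (q ^ 3 + 1) * h3
  have h4 : (q ^ 2) ^ 2 = q := by linear_combination q * h3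
  have h2 : q ^ 2 ≠ 1 := fun h => ne_one hq (by rw [← h4, h, one_pow])
  rcases cases v with rfl | rfl | rfl | rfl | rfl | rfl
  · exact Or.inl ⟨1, by simp⟩
  · exact Or.inl ⟨q, h3, Or.inr (ne_one hq), stdRep_u_stdX hq, stdRep_u_stdY hq⟩
  · refine Or.inl ⟨q ^ 2, h6, Or.inr h2, ?_, ?_⟩
    · simp only [sq, map_mul, Module.End.mul_apply, stdRep_u_stdX, map_smul, smul_smul]
    · simp only [sq, map_mul, Module.End.mul_apply, stdRep_u_stdY, map_smul, smul_smul]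
  · exact Or.inr ⟨1, by simp, by rw [stdRep_s_stdX, one_smul],
      by rw [stdRep_s_stdY, one_pow, one_smul]⟩
  · refine Or.inr ⟨q ^ 2, h6, ?_, ?_⟩
    · simp only [map_mul, Module.End.mul_apply, stdRep_s_stdX, stdRep_u_stdY]
    · simp only [map_mul, Module.End.mul_apply, stdRep_s_stdY, stdRep_u_stdX, h4]
  · refine Or.inr ⟨q, h3, ?_, ?_⟩
    · simp only [map_mul, map_pow, sq, Module.End.mul_apply, stdRep_s_stdX, stdRep_u_stdY,
        map_smul, smul_smul]
      congr 1; linear_combination q * h3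
    · simp only [map_mul, map_pow, sq, Module.End.mul_apply, stdRep_s_stdY, stdRep_u_stdX,
        map_smul, smul_smul]

/-- Reflections connect permutations of different signs. -/
theorem mk_inv_mul_eq_mk_s {a b : S3} : ConjClasses.mk (a⁻¹ * b) = ConjClasses.mk s ↔
    Equiv.Perm.sign a ≠ Equiv.Perm.sign b := by
  rw [mk_eq_mk_s_iff]
  revert a b; decide

/-- The 6-dimensional calculus. -/
def connectedCalculus : BicovariantCalculus.{u, u, u} k (QuantumDouble k S3) :=
  calculus (ConjClasses.mk s) (isSimple_stdRep hq) (stdX_ne_zero hq)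
    fun h => absurd h mk_one_ne_mk_s.symm

/-- Arrows join exactly the permutations of opposite sign. For a reflection `v`, `stdX` and `ρ(v)
stdX` are independent, so the coefficients vanish. For a nontrivial rotation, an arrow and its
reverse multiply a coefficient by `r² ≠ 1`, so it vanishes. For `v = 1` connectedness makes the
coefficients constant. -/
theorem H0_connectedCalculus : (connectedCalculus hq).H0 = Submodule.span k {1} := by
  refine le_antisymm (fun a ha => ?_) ?_
  · have hd : innerD (stdRep k) (c := ConjClasses.mk s) (stdX hq) a = 0 := ha
    have hval : ∀ x y v : S3, Equiv.Perm.sign x ≠ Equiv.Perm.sign y →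
        basis.coord (y, v) a • stdX hq = basis.coord (x, v) a • stdRep k v (stdX hq) := by
      intro x y v h
      have := val_innerD (k := k) (mk_inv_mul_eq_mk_s.2 h) v (stdX hq) a (ρ := stdRep k)
      rw [hd, map_zero] at this
      exact sub_eq_zero.1 this.symm
    have hnb : ∀ x : S3, Equiv.Perm.sign (x * s) ≠ Equiv.Perm.sign x := by decide
    have hoff : ∀ x v : S3, v ≠ 1 → basis.coord (x, v) a = 0 := by
      intro x v hv
      rcases stdRep_cases hq v with ⟨r, hr3, hr, hX, -⟩ | ⟨r, -, hX, -⟩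
      · have h1 := congrArg (coordX q) (hval _ _ v (hnb x))
        have h2 := congrArg (coordX q) (hval _ _ v (hnb x).symm)
        simp only [hX, map_smul, coordX_stdX, smul_eq_mul, mul_one] at h1 h2
        have hr1 := hr.resolve_left hv
        have hr0 : r ^ 2 ≠ 1 := fun h => hr1 (by rw [← hr3, pow_succ, h, one_mul])
        have : basis.coord (x, v) a * (1 - r ^ 2) = 0 := by
          rw [h2] at h1; linear_combination h1
        exact (mul_eq_zero.1 this).resolve_right (sub_ne_zero.2 hr0.symm)
      · have h1 := congrArg (coordX q) (hval _ _ v (hnb x))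
        simpa only [hX, map_smul, coordX_stdX, coordX_stdY, smul_eq_mul, mul_one,
          mul_zero] using h1
    have hon : ∀ x y : S3, Equiv.Perm.sign x ≠ Equiv.Perm.sign y →
        basis.coord (y, 1) a = basis.coord (x, 1) a := by
      intro x y h
      have h1 := congrArg (coordX q) (hval x y 1 h)
      simpa only [map_one, Module.End.one_apply, map_smul, coordX_stdX, smul_eq_mul,
        mul_one] using h1
    have hall : ∀ x : S3, basis.coord (x, 1) a = basis.coord (1, 1) a := by
      intro x
      by_cases hx : Equiv.Perm.sign (1 : S3) = Equiv.Perm.sign x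
      -- Even permutations are not adjacent to `1` but are joined to it through `s`.
      · have h1 : Equiv.Perm.sign s ≠ Equiv.Perm.sign x := by rw [← hx]; decide
        rw [hon s x h1, hon 1 s (by decide)]
      · exact hon 1 x hx
    refine Submodule.mem_span_singleton.2 ⟨basis.coord (1, 1) a, basis.ext_elem fun p => ?_⟩
    have h1 : basis.coord p ((basis.coord (1, 1) a : k) • (1 : QuantumDouble k S3)) =
        basis.coord p a := by
      obtain ⟨x, v⟩ := p
      rw [map_smul, basis_coord_one]
      split_ifs with hv
      · rw [hv, hall x, smul_eq_mul, mul_one]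
      · rw [hoff x v hv, smul_zero]
    exact h1
  · rw [Submodule.span_singleton_le_iff_mem]
    have h := (connectedCalculus hq).leibniz 1 1
    rw [mul_one, (connectedCalculus hq).one_lact, (connectedCalculus hq).one_ract] at h
    exact left_eq_add.1 h

/-- The left-invariant forms dual to `tangentBasis`. -/
def dualForm : Fin 6 → PathForms (ConjClasses.mk s) (stdSpace k) :=
  let f (τ : S3) := leftForm (W := stdSpace k) k (ConjClasses.mk s) τ
  ![f s (stdX hq), q ^ 2 • f (u * s) (stdX hq), q • f (u ^ 2 * s) (stdX hq),
    f s (stdY hq), q • f (u * s) (stdY hq), q ^ 2 • f (u ^ 2 * s) (stdY hq)]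

theorem sum_leftForm (b : stdSpace k) : innerForm k (ConjClasses.mk s) b =
    leftForm k (ConjClasses.mk s) s b + leftForm k (ConjClasses.mk s) (u * s) b +
      leftForm k (ConjClasses.mk s) (u ^ 2 * s) b := by
  have h : (Finset.univ : Finset S3) = {1, u, u ^ 2, s, u * s, u ^ 2 * s} := by decide
  rw [innerForm_eq_sum_leftForm, h, Finset.sum_insert (by decide), Finset.sum_insert (by decide),
    Finset.sum_insert (by decide), Finset.sum_insert (by decide), Finset.sum_insert (by decide),
    Finset.sum_singleton, leftForm_of_ne mk_one_ne_mk_s, leftForm_of_ne mk_u_ne_mk_s,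
    leftForm_of_ne (fun h => absurd ((mk_eq_mk_s_iff _).1 h) (by decide))]
  abel

theorem innerForm_stdX : innerForm k (ConjClasses.mk s) (stdX hq) =
    dualForm hq 0 + q • dualForm hq 1 + q ^ 2 • dualForm hq 2 := by
  have h3 := cube_eq_one hq
  simp only [dualForm, Matrix.cons_val, sum_leftForm, smul_smul]
  rw [show q * q ^ 2 = 1 by linear_combination h3, show q ^ 2 * q = 1 by linear_combination h3,
    one_smul, one_smul]

theorem innerForm_stdY : innerForm k (ConjClasses.mk s) (stdY hq) =
    dualForm hq 3 + q⁻¹ • dualForm hq 4 + (q⁻¹) ^ 2 • dualForm hq 5 := by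
  have h0 : q ≠ 0 := by rintro rfl; norm_num at hq
  simp only [dualForm, Matrix.cons_val, sum_leftForm, smul_smul]
  rw [inv_mul_cancel₀ h0, ← mul_pow, inv_mul_cancel₀ h0, one_pow, one_smul, one_smul]

end S3
end

/-! ### The tangent space of the 6-dimensional calculus -/

noncomputable section

open QuantumDouble BicovariantCalculus PathForms

namespace S3

variable {k : Type u} [Field k] [CharZero k] {q : k} (hq : 1 + q + q ^ 2 = 0)

theorem leftForm_eq_ite (τ : S3) (b : stdSpace k) : leftForm k (ConjClasses.mk s) τ b =
    (if τ = s then leftForm k (ConjClasses.mk s) s b else 0) +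
    (if τ = u * s then leftForm k (ConjClasses.mk s) (u * s) b else 0) +
    (if τ = u ^ 2 * s then leftForm k (ConjClasses.mk s) (u ^ 2 * s) b else 0) := by
  rcases cases τ with rfl | rfl | rfl | rfl | rfl | rfl
  · rw [leftForm_of_ne mk_one_ne_mk_s]
    simp (decide := true) only [if_false, add_zero]
  · rw [leftForm_of_ne mk_u_ne_mk_s]
    simp (decide := true) only [if_false, add_zero]
  · rw [leftForm_of_ne (fun h => absurd ((mk_eq_mk_s_iff _).1 h) (by decide))]
    simp (decide := true) only [if_false, add_zero]
  all_goals simp (decide := true) only [if_true, if_false, add_zero, zero_add]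

-- The vector `(1, q, q², 0, 0, 0)` undoes the counit terms of the `tangentVector`s with `v = e`. It
-- is also the coordinate vector of `θ` in `dualForm`, so this correction is later absorbed by the
-- term `ε(a) θ` of the Maurer-Cartan form. The identity is checked on all 36 basis elements.
set_option maxHeartbeats 2000000 in
theorem leftForm_conj (t v : S3) :
    leftForm k (ConjClasses.mk s) (v⁻¹ * t * v) (stdRep k v⁻¹ (stdX hq)) =
      ∑ i, (tangentBasis q i (delta k t v) +
        (![1, q, q ^ 2, 0, 0, 0] : Fin 6 → k) i * (if t = 1 then 1 else 0)) • dualForm hq i := by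
  have h3 := cube_eq_one hq
  have h4 : q ^ 4 = q := by linear_combination q * h3
  have hv : stdRep k v⁻¹ (stdX hq) = if v = 1 then stdX hq else if v = u then q ^ 2 • stdX hq else
      if v = u ^ 2 then q • stdX hq else if v = s then stdY hq else
      if v = u * s then q ^ 2 • stdY hq else q • stdY hq := by
    rcases cases v with rfl | rfl | rfl | rfl | rfl | rfl
    · simp
    · rw [show u⁻¹ = u * u by decide]
      simp (decide := true) only [if_true, if_false, map_mul, Module.End.mul_apply,
        stdRep_u_stdX, map_smul, smul_smul, sq]
    · rw [show (u ^ 2)⁻¹ = u by decide]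
      simp (decide := true) only [if_true, if_false, stdRep_u_stdX]
    · rw [show s⁻¹ = s by decide]
      simp (decide := true) only [if_true, if_false, stdRep_s_stdX]
    · rw [show (u * s)⁻¹ = u * s by decide]
      simp (decide := true) only [if_true, if_false, map_mul, Module.End.mul_apply,
        stdRep_s_stdX, stdRep_u_stdY]
    · rw [show (u ^ 2 * s)⁻¹ = u * (u * s) by decide]
      simp (decide := true) only [if_false, map_mul, Module.End.mul_apply,
        stdRep_s_stdX, stdRep_u_stdY, map_smul, smul_smul]
      rw [← pow_add, h4]
  have e1 : q * q ^ 2 = 1 := by linear_combination h3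
  have e2 : q ^ 2 * q = 1 := by linear_combination h3
  have e3 : q ^ 2 * q ^ 2 = q := by linear_combination h4
  have e4 : q * q = q ^ 2 := by ring
  rw [leftForm_eq_ite, hv]
  simp only [Fin.sum_univ_six, dualForm, tangentBasis, Matrix.cons_val, LinearMap.add_apply,
    LinearMap.smul_apply, tangentVector_delta]
  rcases cases t with rfl | rfl | rfl | rfl | rfl | rfl <;>
  rcases cases v with rfl | rfl | rfl | rfl | rfl | rfl
  all_goals
    simp (decide := true) only [if_true, if_false, add_zero, zero_add, sub_zero, smul_zero,
      zero_smul, map_smul, smul_smul, mul_one, mul_zero, one_mul, one_smul, smul_eq_mul, zero_mul,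
      zero_sub, sub_self, mul_neg, neg_add_cancel, e1, e2, e3, e4]

theorem maurerCartan_connectedCalculus (a : QuantumDouble k S3) :
    (connectedCalculus hq).maurerCartan a = ∑ i, tangentBasis q i a • dualForm hq i := by
  have h : ∑ i, (tangentBasis q i).smulRight (dualForm hq i) =
      (connectedCalculus hq).maurerCartan := by
    refine QuantumDouble.hom_ext fun t v => ?_
    have h1 : (if t = 1 then innerForm k (ConjClasses.mk s) (stdX hq) else 0) =
        ∑ i, ((![1, q, q ^ 2, 0, 0, 0] : Fin 6 → k) i * (if t = 1 then 1 else 0)) •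
          dualForm hq i := by
      split_ifs
      · simp [Fin.sum_univ_six, innerForm_stdX]
      · simp
    refine Eq.trans ?_ (maurerCartan_calculus _ _ _ t v).symm
    rw [leftForm_conj, h1, ← Finset.sum_sub_distrib, LinearMap.sum_apply]
    exact Finset.sum_congr rfl fun i _ => by rw [← sub_smul, add_sub_cancel_right]; rfl
  exact (LinearMap.congr_fun h a).symm.trans (LinearMap.sum_apply _ _ _)

theorem linearIndependent_dualForm : LinearIndependent k (dualForm hq) := by
  have h0 : q ≠ 0 := by rintro rfl; norm_num at hq
  rw [Fintype.linearIndependent_iff]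
  intro g hg
  have hval : ∀ τ, ConjClasses.mk τ = ConjClasses.mk s →
      val k (ConjClasses.mk s) 1 τ 1 (∑ i, g i • dualForm hq i) = 0 := fun τ _ => by
    rw [hg, map_zero]
  have key : ∀ τ : S3, ConjClasses.mk τ = ConjClasses.mk s → ∀ σ (b : stdSpace k),
      val k (ConjClasses.mk s) 1 τ 1 (leftForm k (ConjClasses.mk s) σ b) =
        if τ = σ then b else 0 := by
    intro τ hτ σ b
    rw [val_leftForm (by simpa using hτ)]
    simp
  have hs := hval s rfl
  have hus := hval (u * s) ((mk_eq_mk_s_iff _).2 (by decide))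
  have huus := hval (u ^ 2 * s) ((mk_eq_mk_s_iff _).2 (by decide))
  simp (decide := true) only [Fin.sum_univ_six, dualForm, Matrix.cons_val, map_add, map_smul,
    key s rfl, key _ ((mk_eq_mk_s_iff (u * s)).2 (by decide)), if_true, if_false, smul_zero,
    add_zero, zero_add, key _ ((mk_eq_mk_s_iff (u ^ 2 * s)).2 (by decide))] at hs hus huus
  have hX : ∀ a b : k, a • stdX hq + b • stdY hq = 0 → a = 0 ∧ b = 0 := by
    intro a b h
    have h1 := congrArg (coordX q) h
    have h2 := congrArg (coordY q) h
    simp only [map_add, map_smul, map_zero, coordX_stdX, coordX_stdY, coordY_stdX, coordY_stdY,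
      smul_eq_mul, mul_one, mul_zero, add_zero, zero_add] at h1 h2
    exact ⟨h1, h2⟩
  rw [smul_smul, smul_smul] at hus huus
  obtain ⟨h1, h2⟩ := hX _ _ hs
  obtain ⟨h3, h4⟩ := hX _ _ hus
  obtain ⟨h5, h6⟩ := hX _ _ huus
  have hq2 := pow_ne_zero 2 h0
  intro i
  fin_cases i
  exacts [h1, (mul_eq_zero.1 h3).resolve_right hq2, (mul_eq_zero.1 h5).resolve_right h0, h2,
    (mul_eq_zero.1 h4).resolve_right h0, (mul_eq_zero.1 h6).resolve_right hq2]

/-- Independence of `dualForm` makes the kernel of the Maurer-Cartan form the common kernel of the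
`tangentBasis`, and a functional vanishing on the common kernel of finitely many functionals is a
combination of them. -/
theorem tangentSpace_connectedCalculus :
    (connectedCalculus hq).tangentSpace = Submodule.span k (Set.range (tangentBasis q)) := by
  have hker : ∀ a, (connectedCalculus hq).maurerCartan a = 0 ↔ ∀ i, tangentBasis q i a = 0 := by
    intro a
    rw [maurerCartan_connectedCalculus]
    exact ⟨Fintype.linearIndependent_iff.1 (linearIndependent_dualForm hq) _,
      fun h => Finset.sum_eq_zero fun i _ => (congrArg (· • dualForm hq i) (h i)).trans
        (zero_smul k (dualForm hq i))⟩
  refine le_antisymm (fun f hf => ?_) (Submodule.span_le.2 ?_)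
  · refine mem_span_of_iInf_ker_le_ker fun a ha => ?_
    rw [Submodule.mem_iInf] at ha
    exact (Submodule.mem_dualAnnihilator f).1 hf a ((hker a).2 ha)
  · rintro _ ⟨i, rfl⟩
    exact (Submodule.mem_dualAnnihilator _).2 fun a ha => (hker a).1 ha i

end S3
end

/-! ### The braiding and the exterior derivative of an inner calculus -/

noncomputable section

open QuantumDouble

namespace BicovariantCalculus

section

variable {k : Type u} [Field k] {A : Type v} [Ring A] [HopfAlgebra k A]
  (C : BicovariantCalculus.{u, v, w} k A)

theorem braiding_tmul (x y : C.carrier) :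
    C.braiding (x ⊗ₜ y) = (C.adj.flip x).lTensor C.carrier (C.coactR y) := rfl

/-- The wedge product as a bilinear map. -/
def wedgeHom : C.carrier →ₗ[k] C.carrier →ₗ[k] C.TwoForms :=
  (TensorProduct.mk k C.carrier C.carrier).compr₂ C.relations.mkQ

theorem wedgeHom_ract (a : A) (ω η : C.carrier) :
    C.wedgeHom (C.ract a ω) η = C.wedgeHom ω (C.lact a η) := by
  change C.relations.mkQ _ = C.relations.mkQ _
  rw [← sub_eq_zero, ← map_sub, Submodule.mkQ_apply, Submodule.Quotient.mk_eq_zero]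
  exact Submodule.mem_sup_left (Submodule.subset_span ⟨a, ω, η, rfl⟩)

theorem mkQ_rTensor_lact (a : A) {z : C.carrier ⊗[k] C.carrier} (hz : z ∈ C.symmetricForms) :
    C.relations.mkQ ((C.lact a).rTensor C.carrier z) = 0 := by
  rw [Submodule.mkQ_apply, Submodule.Quotient.mk_eq_zero]
  exact Submodule.mem_sup_right (Submodule.subset_span ⟨a, z, hz, rfl⟩)

theorem mem_symmetricForms {z : C.carrier ⊗[k] C.carrier} : z ∈ C.symmetricForms ↔
    z ∈ LinearMap.range (TensorProduct.map C.invForms.subtype C.invForms.subtype) ∧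
      C.braiding z = z := by
  rw [symmetricForms, Submodule.mem_inf, LinearMap.mem_ker, LinearMap.sub_apply,
    LinearMap.id_apply, sub_eq_zero, eq_comm (a := z)]

theorem tmul_mem_range {x y : C.carrier} (hx : x ∈ C.invForms) (hy : y ∈ C.invForms) :
    x ⊗ₜ[k] y ∈ LinearMap.range (TensorProduct.map C.invForms.subtype C.invForms.subtype) :=
  ⟨⟨x, hx⟩ ⊗ₜ ⟨y, hy⟩, rfl⟩

/-- The exterior derivative on 1-forms of an inner calculus. -/
def innerExteriorD (θ : C.carrier) : C.carrier →ₗ[k] C.TwoForms := C.wedgeHom θ + C.wedgeHom.flip θ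

theorem innerExteriorD_apply (θ ω : C.carrier) :
    C.innerExteriorD θ ω = C.wedgeHom θ ω + C.wedgeHom ω θ := rfl

/-- Expanding the anticommutator of `θ` with `a db` and subtracting `da ∧ db` leaves `aθ ∧ θb - abθ
∧ θ`, so the vanishing of `aθ ∧ θb` for all `a`, `b` is enough. -/
theorem isExteriorDerivative_innerExteriorD {θ : C.carrier}
    (hd : ∀ a, C.d a = C.ract a θ - C.lact a θ)
    (h : ∀ a b, C.wedgeHom (C.lact a θ) (C.ract b θ) = 0) :
    C.IsExteriorDerivative (C.innerExteriorD θ) := by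
  intro a b
  have h1 : C.wedgeHom (C.lact a (C.lact b θ)) θ = 0 := by
    rw [← C.mul_lact]
    have := h (a * b) 1
    rwa [C.one_ract] at this
  change _ = C.wedgeHom (C.d a) (C.d b)
  rw [innerExteriorD_apply, ← C.wedgeHom_ract, hd a, hd b, map_sub (C.lact a), map_sub,
    map_sub (C.wedgeHom), map_sub (C.wedgeHom), LinearMap.sub_apply, LinearMap.sub_apply,
    C.lact_ract, C.wedgeHom_ract b, h1, map_sub (C.wedgeHom (C.lact a θ)), h,
    map_sub (C.wedgeHom (C.ract a θ))]
  abel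

end

variable {k : Type u} [Field k] {G : Type v} [Group G] [DecidableEq G] [Fintype G]
  (C : BicovariantCalculus.{u, max u v, w'} k (QuantumDouble k G))

theorem adj_delta (y g : G) (x : C.carrier) : C.adj (delta k y g) x =
    ∑ r, C.ract (delta k (r⁻¹ * y) g) (C.lact (delta k (g⁻¹ * r * g)⁻¹ g⁻¹) x) := by
  have : ∀ s u : G, HopfAlgebra.antipode k (delta k s u) = delta k (u⁻¹ * s * u)⁻¹ u⁻¹ :=
    fun s u => QuantumDouble.lift_delta _ s u
  have hΔ : Coalgebra.comul (R := k) (delta k y g) = _ := comul_delta y g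
  rw [adj, LinearMap.comp_apply, LinearMap.comp_apply, hΔ]
  simp only [map_sum, TensorProduct.map_tmul, TensorProduct.lift.tmul, this,
    LinearMap.sum_apply]
  rfl

/-- Moving `v` to the far left of `θ ∧ θ (δ_t ⊗ v)` replaces both factors by the forms `F`. The
terms then group into sums over factorizations of a group element, which are symmetric. -/
theorem wedgeHom_ract_delta_eq_zero {θ : C.carrier} {v : G} (F : G → C.carrier)
    (h : ∀ t, C.ract (delta k t v) θ =
      ∑ s, C.lact (delta k s v) (F (v⁻¹ * (s⁻¹ * t) * v)))
    (hF : ∀ x, ∑ τ, F τ ⊗ₜ[k] F (τ⁻¹ * x) ∈ C.symmetricForms) (a : QuantumDouble k G) (t : G) :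
    C.wedgeHom (C.lact a θ) (C.ract (delta k t v) θ) = 0 := by
  have h2 : ∀ s η, C.wedgeHom (C.lact a θ) (C.lact (delta k s v) η) =
      ∑ r, C.wedgeHom (C.lact (a * delta k r v) (F (v⁻¹ * (r⁻¹ * s) * v))) η := by
    intro s η
    rw [← C.wedgeHom_ract, ← C.lact_ract, h s, map_sum, map_sum, LinearMap.sum_apply]
    simp only [C.mul_lact]
  rw [h t, map_sum]
  simp only [h2]
  rw [Finset.sum_comm]
  refine Finset.sum_eq_zero fun r _ => ?_
  refine Eq.trans ?_ (C.mkQ_rTensor_lact (a * delta k r v) (hF (v⁻¹ * (r⁻¹ * t) * v)))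
  rw [map_sum, map_sum]
  refine Fintype.sum_equiv ((Equiv.mulLeft r⁻¹).trans (MulAut.conj v⁻¹).toEquiv) _ _ fun s => ?_
  have e1 : ((Equiv.mulLeft r⁻¹).trans (MulAut.conj v⁻¹).toEquiv) s = v⁻¹ * (r⁻¹ * s) * v := by
    simp
  have e2 : (v⁻¹ * (r⁻¹ * s) * v)⁻¹ * (v⁻¹ * (r⁻¹ * t) * v) = v⁻¹ * (s⁻¹ * t) * v := by group
  rw [e1, e2]
  rfl

end BicovariantCalculus

namespace PathForms

variable {k : Type u} [Field k] {G : Type v} [Group G] [DecidableEq G] [Fintype G]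
  {c : ConjClasses G} {W : Type w} [AddCommGroup W] [Module k W] {ρ : Representation k G W}

theorem lact_leftForm (r g τ : G) (b : W) : lact ρ (delta k r g) (leftForm k c τ b) =
    path k c r (r * (g * τ * g⁻¹)) g (ρ g b) := by
  simp only [leftForm_apply, map_sum, lact_path, Finset.sum_ite_eq, Finset.mem_univ, if_true,
    mul_one]
  congr 2; group

theorem coactR_leftForm (τ : G) (b : W) :
    coactR (leftForm k c τ b) = ∑ y, leftForm k c (y * τ * y⁻¹) b ⊗ₜ delta k y 1 := by
  simp only [leftForm_apply, map_sum, coactR_path, TensorProduct.sum_tmul]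
  rw [Finset.sum_comm]
  refine Finset.sum_congr rfl fun y _ => Fintype.sum_equiv (Equiv.mulRight y⁻¹) _ _ fun s => ?_
  simp [mul_assoc]

section Calculus

variable (hρ : ρ.IsSimple) {w : W} (hw : w ≠ 0) (hc : c = ConjClasses.mk 1 → ∃ g, ρ g w ≠ w)

theorem adj_leftForm (y τ : G) (b : W) :
    (calculus c hρ hw hc).adj (delta k y 1) (leftForm k c τ b) =
      if y = τ then leftForm k c τ b else 0 := by
  refine ((calculus c hρ hw hc).adj_delta y 1 _).trans ?_
  change ∑ r, ract (delta k (r⁻¹ * y) 1) (lact ρ (delta k (1⁻¹ * r * 1)⁻¹ 1⁻¹)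
    (leftForm k c τ b)) = _
  have h : ∀ r : G, ract (delta k (r⁻¹ * y) 1) (lact ρ (delta k (1⁻¹ * r * 1)⁻¹ 1⁻¹)
    (leftForm k c τ b)) = if y = τ then path k c r⁻¹ (r⁻¹ * τ) 1 b else 0 := by
    intro r
    rw [lact_leftForm, ract_path]
    simp [eq_comm]
  simp only [h]
  split_ifs
  · rw [leftForm_apply]
    exact Fintype.sum_equiv (Equiv.inv G) _ _ fun r => rfl
  · simp

/-- The right coaction of a left-invariant form involves only decoration `e`, and `δ_y ⊗ e` acts on
the direction `τ` as the indicator of `y = τ`. This gives the conjugation braiding on directions,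
while the representation does not intervene and the vectors are just exchanged. -/
theorem braiding_leftForm (τ τ' : G) (a b : W) :
    (calculus c hρ hw hc).braiding (leftForm k c τ a ⊗ₜ[k] leftForm k c τ' b) =
      leftForm k c (τ * τ' * τ⁻¹) b ⊗ₜ[k] leftForm k c τ a := by
  refine ((calculus c hρ hw hc).braiding_tmul _ _).trans ?_
  have h : (calculus c hρ hw hc).coactR (leftForm k c τ' b) = _ := coactR_leftForm τ' b
  rw [h]
  have key : ∀ F : QuantumDouble k G →ₗ[k] PathForms c W,
      (∀ y, F (delta k y 1) = if y = τ then leftForm k c τ a else 0) →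
      F.lTensor (PathForms c W) (∑ y, leftForm k c (y * τ' * y⁻¹) b ⊗ₜ[k] delta k y 1) =
        leftForm k c (τ * τ' * τ⁻¹) b ⊗ₜ[k] leftForm k c τ a := by
    intro F hF
    rw [map_sum, Finset.sum_eq_single τ]
    · rw [LinearMap.lTensor_tmul, hF, if_pos rfl]
    · intro y _ hy
      rw [LinearMap.lTensor_tmul, hF, if_neg hy, TensorProduct.tmul_zero]
    · simp
  exact key _ fun y => adj_leftForm hρ hw hc y τ a

theorem leftForm_mem_invForms (τ : G) (b : W) :
    leftForm k c τ b ∈ (calculus c hρ hw hc).invForms :=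
  (mem_invForms hρ hw hc).2 (coactL_leftForm τ b)

/-- The symmetric tensors made of the factorizations of a group element. -/
theorem sum_leftForm_mem_symmetricForms (x : G) (b : W) :
    ∑ τ, leftForm k c τ b ⊗ₜ[k] leftForm k c (τ⁻¹ * x) b ∈
      (calculus c hρ hw hc).symmetricForms := by
  refine (BicovariantCalculus.mem_symmetricForms _).2 ⟨Submodule.sum_mem _ fun τ _ =>
    BicovariantCalculus.tmul_mem_range _
    (leftForm_mem_invForms hρ hw hc _ _) (leftForm_mem_invForms hρ hw hc _ _), ?_⟩
  refine (map_sum _ _ _).trans ?_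
  -- The braiding sends the factorization `(τ, τ⁻¹x)` to `(xτ⁻¹, τ)`, so it permutes the summands.
  refine Fintype.sum_equiv ((Equiv.inv G).trans (Equiv.mulLeft x)) _ _ fun τ => ?_
  refine (braiding_leftForm hρ hw hc _ _ _ _).trans ?_
  congr 3 <;> simp

theorem braiding_innerForm (a b : W) :
    (calculus c hρ hw hc).braiding (innerForm k c a ⊗ₜ[k] innerForm k c b) =
      innerForm k c b ⊗ₜ[k] innerForm k c a := by
  have h : ∀ x y : W, innerForm k c x ⊗ₜ[k] innerForm k c y =
      ∑ τ, ∑ τ', leftForm k c τ x ⊗ₜ[k] leftForm k c τ' y := fun x y => by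
    simp only [innerForm_eq_sum_leftForm, TensorProduct.sum_tmul, TensorProduct.tmul_sum]
    exact Finset.sum_comm
  refine (congrArg (calculus c hρ hw hc).braiding (h a b)).trans (Eq.trans ?_ (h b a).symm)
  conv_rhs => rw [Finset.sum_comm]
  refine (map_sum (calculus c hρ hw hc).braiding _ _).trans ?_
  refine Finset.sum_congr rfl fun τ _ => (map_sum (calculus c hρ hw hc).braiding _ _).trans ?_
  refine (Finset.sum_congr rfl fun τ' _ => braiding_leftForm hρ hw hc _ _ _ _).trans ?_
  exact Fintype.sum_equiv (MulAut.conj τ).toEquiv _ _ fun τ' => rfl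

/-- The differential of `calculus` is inner. -/
theorem d_calculus (a : QuantumDouble k G) : (calculus c hρ hw hc).d a =
    (calculus c hρ hw hc).ract a (innerForm k c w) -
      (calculus c hρ hw hc).lact a (innerForm k c w) := rfl

theorem wedgeHom_innerForm (a b : QuantumDouble k G) :
    (calculus c hρ hw hc).wedgeHom ((calculus c hρ hw hc).lact a (innerForm k c w))
      ((calculus c hρ hw hc).ract b (innerForm k c w)) = 0 := by
  have key : ∀ t v : G, (calculus c hρ hw hc).wedgeHom
      ((calculus c hρ hw hc).lact a (innerForm k c w))
      ((calculus c hρ hw hc).ract (delta k t v) (innerForm k c w)) = 0 := by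
    intro t v
    -- The left action by `v` applies `ρ(v)`, so the vector `ρ(v⁻¹) w` is the one that restores `w`.
    obtain ⟨b, hb⟩ : ∃ b, b = ρ v⁻¹ w := ⟨_, rfl⟩
    have hb' : ρ v b = w := by
      rw [hb, ← Module.End.mul_apply, ← map_mul, mul_inv_cancel, map_one, Module.End.one_apply]
    refine BicovariantCalculus.wedgeHom_ract_delta_eq_zero _ (fun τ => leftForm k c τ b)
      (fun t => ?_) (fun x => sum_leftForm_mem_symmetricForms hρ hw hc x b) a t
    refine (ract_innerForm t v w).trans (Finset.sum_congr rfl fun s _ => ?_)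
    refine Eq.trans ?_ (lact_leftForm s v _ b).symm
    rw [hb']; congr 2; group
  have : (calculus c hρ hw hc).wedgeHom ((calculus c hρ hw hc).lact a (innerForm k c w)) ∘ₗ
      (calculus c hρ hw hc).ract.flip (innerForm k c w) = 0 := QuantumDouble.hom_ext key
  exact LinearMap.congr_fun this b

/-- The exterior derivative on the 1-forms of `calculus`. -/
theorem isExteriorDerivative_calculus : (calculus c hρ hw hc).IsExteriorDerivative
    ((calculus c hρ hw hc).innerExteriorD (innerForm k c w)) :=
  (calculus c hρ hw hc).isExteriorDerivative_innerExteriorD (d_calculus hρ hw hc)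
    (wedgeHom_innerForm hρ hw hc)

theorem innerForm_mem_invForms (b : W) : innerForm k c b ∈ (calculus c hρ hw hc).invForms := by
  rw [innerForm_eq_sum_leftForm]
  exact Submodule.sum_mem _ fun τ _ => leftForm_mem_invForms hρ hw hc τ b

/-- Bi-invariant forms are closed. -/
theorem innerExteriorD_innerForm (b : W) :
    (calculus c hρ hw hc).innerExteriorD (innerForm k c w) (innerForm k c b) = 0 := by
  have hz : innerForm k c w ⊗ₜ[k] innerForm k c b + innerForm k c b ⊗ₜ[k] innerForm k c w ∈
      (calculus c hρ hw hc).symmetricForms := by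
    refine (BicovariantCalculus.mem_symmetricForms _).2 ⟨Submodule.add_mem _ ?_ ?_, ?_⟩
    · exact BicovariantCalculus.tmul_mem_range _ (innerForm_mem_invForms hρ hw hc w)
        (innerForm_mem_invForms hρ hw hc b)
    · exact BicovariantCalculus.tmul_mem_range _ (innerForm_mem_invForms hρ hw hc b)
        (innerForm_mem_invForms hρ hw hc w)
    · refine (map_add _ _ _).trans ((congrArg₂ _ (braiding_innerForm hρ hw hc w b)
        (braiding_innerForm hρ hw hc b w)).trans (add_comm _ _))
  have h := (calculus c hρ hw hc).mkQ_rTensor_lact 1 hz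
  have h1 : (calculus c hρ hw hc).lact 1 = LinearMap.id :=
    LinearMap.ext (calculus c hρ hw hc).one_lact
  rw [h1, LinearMap.rTensor_id] at h
  exact h

end Calculus

end PathForms
end

/-! ### Functionals on 2-forms and the closedness equations -/

noncomputable section

namespace BicovariantCalculus

theorem mem_span_tmul {k : Type u} [Field k] {A : Type v} [Ring A] [HopfAlgebra k A]
    (C : BicovariantCalculus.{u, v, w} k A) {z : C.carrier ⊗[k] C.carrier}
    (hz : z ∈ C.symmetricForms) :
    z ∈ Submodule.span k {t | ∃ x ∈ C.invForms, ∃ y ∈ C.invForms, x ⊗ₜ[k] y = t} := by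
  obtain ⟨⟨y, rfl⟩, -⟩ := C.mem_symmetricForms.1 hz
  clear hz
  induction y with
  | zero => rw [map_zero]; exact Submodule.zero_mem _
  | add x y hx hy =>
    rw [map_add]
    exact Submodule.add_mem _ hx hy
  | tmul x y => exact Submodule.subset_span ⟨x, x.2, y, y.2, rfl⟩

end BicovariantCalculus

namespace PathForms

open QuantumDouble

variable {k : Type u} [Field k] {G : Type v} [Group G] [DecidableEq G] [Fintype G]
  {c : ConjClasses G} {W : Type w} [AddCommGroup W] [Module k W] {ρ : Representation k G W}

theorem val_ract_delta (s t u r g : G) (ω : PathForms c W) :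
    val k c s t u (ract (delta k r g) ω) =
      if (u * g⁻¹)⁻¹ * t * (u * g⁻¹) = r then val k c s t (u * g⁻¹) ω else 0 := by
  by_cases h : ConjClasses.mk (s⁻¹ * t) = c
  · have : val k c s t u ∘ₗ ract (c := c) (W := W) (delta k r g) =
        if (u * g⁻¹)⁻¹ * t * (u * g⁻¹) = r then val k c s t (u * g⁻¹) else 0 := by
      refine hom_ext fun s' t' u' _ b => ?_
      rw [LinearMap.comp_apply, ract_path]
      by_cases h1 : s' = s ∧ t' = t ∧ u' = u * g⁻¹
      · obtain ⟨rfl, rfl, rfl⟩ := h1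
        split_ifs
        · simp [val_path h]
        · simp
      · have h2 : val k c s t (u * g⁻¹) (path k c s' t' u' b) = 0 := by
          rw [val_path h]
          split_ifs with h3 h4 h5
          exacts [absurd ⟨h3, h4, h5⟩ h1, rfl, rfl, rfl]
        have h3 : val k c s t u (path k c s' t' (u' * g) b) = 0 := by
          rw [val_path h]
          split_ifs with h3 h4 h5
          exacts [absurd ⟨h3, h4, eq_mul_inv_of_mul_eq h5⟩ h1, rfl, rfl, rfl]
        split_ifs <;> simp [h2, h3]
    rw [← LinearMap.comp_apply, this]
    split_ifs <;> rfl
  · simp [val_of_ne h]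

theorem val_lact_delta (s t u r g : G) (ω : PathForms c W) :
    val k c s t u (lact ρ (delta k r g) ω) =
      if r = s then ρ g (val k c (g⁻¹ * s * g) (g⁻¹ * t * g) (g⁻¹ * u) ω) else 0 := by
  have hcls : ConjClasses.mk ((g⁻¹ * s * g)⁻¹ * (g⁻¹ * t * g)) = ConjClasses.mk (s⁻¹ * t) := by
    rw [← ConjClasses.mk_conj g]; congr 1; group
  by_cases h : ConjClasses.mk (s⁻¹ * t) = c
  · have : val k c s t u ∘ₗ lact ρ (delta k r g) =
        if r = s then ρ g ∘ₗ val k c (g⁻¹ * s * g) (g⁻¹ * t * g) (g⁻¹ * u) else 0 := by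
      refine hom_ext fun s' t' u' _ b => ?_
      have e1 : g * t' * g⁻¹ = t ↔ t' = g⁻¹ * t * g := by
        rw [mul_inv_eq_iff_eq_mul, ← eq_inv_mul_iff_mul_eq, mul_assoc]
      have e2 : g * u' = u ↔ u' = g⁻¹ * u := by rw [eq_inv_mul_iff_mul_eq]
      rw [LinearMap.comp_apply, lact_path]
      by_cases hr : r = s
      · subst hr
        rw [if_pos rfl, LinearMap.comp_apply, val_path (hcls.trans h), apply_ite (val k c r t u),
          val_path h]
        simp only [if_true, e1, e2, eq_comm (a := s'), map_zero, apply_ite (ρ g)]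
      · rw [if_neg hr, apply_ite (val k c s t u), val_path h, if_neg hr]
        simp
    rw [← LinearMap.comp_apply, this]
    split_ifs <;> rfl
  · rw [val_of_ne h, val_of_ne fun h' => h (hcls.symm.trans h'), map_zero, ite_self]

theorem val_path_of_mk {s' t' : G} (h' : ConjClasses.mk (s'⁻¹ * t') = c) (s t u u' : G) (b : W) :
    val k c s t u (path k c s' t' u' b) =
      if s' = s then if t' = t then if u' = u then b else 0 else 0 else 0 := by
  by_cases h : ConjClasses.mk (s⁻¹ * t) = c
  · exact val_path h _ _ _ _ _
  · rw [val_of_ne h]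
    split_ifs with h1 h2 h3
    · subst h1 h2; exact absurd h' h
    all_goals rfl

theorem val_leftForm_of_mk {τ : G} (hτ : ConjClasses.mk τ = c) (s t u : G) (b : W) :
    val k c s t u (leftForm k c τ b) = if s⁻¹ * t = τ then if u = 1 then b else 0 else 0 := by
  by_cases h : ConjClasses.mk (s⁻¹ * t) = c
  · exact val_leftForm h _ _ _
  · rw [val_of_ne h, if_neg fun h' => h (by rw [h', hτ])]

theorem val_innerForm {s t : G} (h : ConjClasses.mk (s⁻¹ * t) = c) (u : G) (b : W) :
    val k c s t u (innerForm k c b) = if u = 1 then b else 0 := by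
  simp only [innerForm, map_sum, val_path h, eq_comm (a := (1 : G))]
  simp

variable (c ρ) in
/-- The coefficient of a tensor at the composable pair of arrows `s → t → s'` with total
decoration `v`, paired with two functionals. -/
def pairing (ξ η : Module.Dual k W) (s t s' v : G) : PathForms c W ⊗[k] PathForms c W →ₗ[k] k :=
  ∑ u, TensorProduct.lift ((LinearMap.mul k k).compl₁₂ (ξ ∘ₗ val k c s t u)
    (η ∘ₗ ρ u ∘ₗ val k c (u⁻¹ * t * u) (u⁻¹ * s' * u) (u⁻¹ * v)))

variable (ξ η : Module.Dual k W) (s t s' v : G)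

theorem pairing_tmul (x y : PathForms c W) : pairing c ρ ξ η s t s' v (x ⊗ₜ y) =
    ∑ u, ξ (val k c s t u x) *
      η (ρ u (val k c (u⁻¹ * t * u) (u⁻¹ * s' * u) (u⁻¹ * v) y)) := by
  simp [pairing, LinearMap.sum_apply]

/-- The sum over the intermediate decoration `u` absorbs a group element moved across the tensor
sign, and the factor `ρ(u)` in the pairing absorbs its action on the second vector. Thus the pairing
descends to the tensor product over `A`. -/
theorem pairing_ract_tmul (a : QuantumDouble k G) (x y : PathForms c W) :
    pairing c ρ ξ η s t s' v (ract a x ⊗ₜ y) = pairing c ρ ξ η s t s' v (x ⊗ₜ lact ρ a y) := by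
  refine LinearMap.congr_fun (f := pairing c ρ ξ η s t s' v ∘ₗ
    (TensorProduct.mk k (PathForms c W) (PathForms c W)).flip y ∘ₗ ract.flip x)
    (g := pairing c ρ ξ η s t s' v ∘ₗ TensorProduct.mk k (PathForms c W) (PathForms c W) x ∘ₗ
      (lact ρ).flip y)
    (QuantumDouble.hom_ext fun r g => ?_) a
  simp only [LinearMap.comp_apply, LinearMap.flip_apply, TensorProduct.mk_apply, pairing_tmul,
    val_ract_delta, val_lact_delta]
  refine Fintype.sum_equiv (Equiv.mulRight g⁻¹) _ _ fun u => ?_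
  rw [Equiv.coe_mulRight]
  by_cases h : (u * g⁻¹)⁻¹ * t * (u * g⁻¹) = r
  · rw [if_pos h, if_pos h.symm, ← Module.End.mul_apply, ← map_mul, inv_mul_cancel_right]
    congr 4 <;> group
  · rw [if_neg h, if_neg (Ne.symm h), map_zero, map_zero, map_zero, zero_mul, mul_zero]

theorem pairing_path_tmul_leftForm {g r τ τ' : G} (hτ : ConjClasses.mk τ = c)
    (hτ' : ConjClasses.mk τ' = c) (a b : W) :
    pairing c ρ ξ η s t s' v (path k c r (r * (g * τ * g⁻¹)) g a ⊗ₜ leftForm k c τ' b) =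
      if r = s ∧ r * (g * τ * g⁻¹) = t ∧ g = v ∧ r * (g * (τ * τ') * g⁻¹) = s' then
        ξ a * η (ρ g b) else 0 := by
  have hr : ConjClasses.mk (r⁻¹ * (r * (g * τ * g⁻¹))) = c := by
    rw [inv_mul_cancel_left, ConjClasses.mk_conj, hτ]
  rw [pairing_tmul, Finset.sum_eq_single g]
  · rw [val_path_of_mk hr, val_leftForm_of_mk hτ']
    by_cases h1 : r = s
    · by_cases h2 : r * (g * τ * g⁻¹) = t
      · by_cases h3 : g = v
        · have e : (g⁻¹ * t * g)⁻¹ * (g⁻¹ * s' * g) = τ' ↔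
              r * (g * (τ * τ') * g⁻¹) = s' := by
            subst h2
            rw [inv_mul_eq_iff_eq_mul]
            constructor
            · intro h
              calc _ = g * (g⁻¹ * (r * (g * τ * g⁻¹)) * g * τ') * g⁻¹ := by group
                _ = s' := by rw [← h]; group
            · rintro rfl; group
          simp only [h1, h2, h3, e, if_true, true_and, inv_mul_cancel]
          subst h1 h3
          split_ifs with h4 h5 h6 <;> simp_all
        · have h3' : ¬ g⁻¹ * v = 1 := fun h => h3 (inv_mul_eq_one.1 h)
          simp [h3, h3']
      · simp [h2]
    · simp [h1]
  · intro u _ hu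
    rw [val_path_of_mk hr]
    simp [Ne.symm hu]
  · simp

section Calculus

variable (hρ : ρ.IsSimple) {w : W} (hw : w ≠ 0) (hc : c = ConjClasses.mk 1 → ∃ g, ρ g w ≠ w)

/-- The braiding keeps the endpoints and the total decoration of a two-step path and exchanges the
two vectors. If its output has midpoint `t`, then its input has midpoint `st⁻¹s'`. -/
theorem pairing_lact_braiding_leftForm (r g τ τ' : G) (a b : W) :
    pairing c ρ ξ η s t s' v ((lact ρ (delta k r g)).rTensor (PathForms c W)
      (leftForm k c (τ * τ' * τ⁻¹) b ⊗ₜ leftForm k c τ a)) =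
    pairing c ρ η ξ s (s * t⁻¹ * s') s' v ((lact ρ (delta k r g)).rTensor (PathForms c W)
      (leftForm k c τ a ⊗ₜ leftForm k c τ' b)) := by
  rw [LinearMap.rTensor_tmul, LinearMap.rTensor_tmul, lact_leftForm, lact_leftForm]
  by_cases hτ : ConjClasses.mk τ = c
  · by_cases hτ' : ConjClasses.mk τ' = c
    · rw [pairing_path_tmul_leftForm _ _ _ _ _ _ ((ConjClasses.mk_conj _ _).trans hτ') hτ,
        pairing_path_tmul_leftForm _ _ _ _ _ _ hτ hτ', mul_comm]
      refine if_congr (and_congr_right fun h1 => ?_) rfl rfl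
      subst h1
      have e1 : r * (g * (τ * τ' * τ⁻¹ * τ) * g⁻¹) = r * (g * (τ * τ') * g⁻¹) := by group
      rw [e1, and_left_comm, and_left_comm (a := r * (g * τ * g⁻¹) = _)]
      refine and_congr_right fun h2 => ?_
      rw [and_comm, and_comm (a := r * (g * τ * g⁻¹) = _)]
      refine and_congr_right fun h3 => ?_
      rw [← h3, mul_assoc r t⁻¹, mul_right_inj, eq_inv_mul_iff_mul_eq]
      constructor
      · rintro rfl; group
      · intro h
        have : t = r * (g * (τ * τ') * g⁻¹) * (g * τ * g⁻¹)⁻¹ := by rw [← h]; group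
        rw [this]; group
    · rw [leftForm_of_ne hτ', path_of_ne]
      · simp
      · intro h; apply hτ'
        rw [← h, inv_mul_cancel_left, ConjClasses.mk_conj, ConjClasses.mk_conj]
  · have h : ConjClasses.mk (r⁻¹ * (r * (g * τ * g⁻¹))) ≠ c := by
      rwa [inv_mul_cancel_left, ConjClasses.mk_conj]
    rw [leftForm_of_ne hτ, path_of_ne h, TensorProduct.tmul_zero, TensorProduct.zero_tmul,
      map_zero, map_zero]

theorem mem_span_leftForm_tmul_leftForm {z : PathForms c W ⊗[k] PathForms c W}
    (hz : z ∈ (calculus c hρ hw hc).symmetricForms) : z ∈ Submodule.span k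
      {x | ∃ τ τ' a b, leftForm k c τ a ⊗ₜ[k] leftForm k c τ' b = x} := by
  have h : Submodule.span k {x : PathForms c W ⊗[k] PathForms c W |
      ∃ ω ∈ (calculus c hρ hw hc).invForms, ∃ η ∈ (calculus c hρ hw hc).invForms,
        ω ⊗ₜ[k] η = x} ≤ Submodule.span k
      {x | ∃ τ τ' a b, leftForm k c τ a ⊗ₜ[k] leftForm k c τ' b = x} := by
    have key : ∀ f g : G → W, (∑ τ, leftForm k c τ (f τ)) ⊗ₜ[k] (∑ τ, leftForm k c τ (g τ)) ∈
        Submodule.span k {x | ∃ τ τ' a b, leftForm k c τ a ⊗ₜ[k] leftForm k c τ' b = x} := by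
      intro f g
      rw [TensorProduct.sum_tmul]
      refine Submodule.sum_mem _ fun τ _ => ?_
      rw [TensorProduct.tmul_sum]
      exact Submodule.sum_mem _ fun τ' _ => Submodule.subset_span ⟨_, _, _, _, rfl⟩
    refine Submodule.span_le.2 ?_
    rintro _ ⟨ω, hω, η, hη, rfl⟩
    rw [eq_sum_leftForm ((mem_invForms hρ hw hc).1 hω),
      eq_sum_leftForm ((mem_invForms hρ hw hc).1 hη)]
    exact key _ _
  exact h ((calculus c hρ hw hc).mem_span_tmul hz)

theorem pairing_lact_symmetric (a : QuantumDouble k G) {z : PathForms c W ⊗[k] PathForms c W}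
    (hz : z ∈ (calculus c hρ hw hc).symmetricForms) :
    pairing c ρ ξ η s t s' v ((lact ρ a).rTensor (PathForms c W) z) =
      pairing c ρ η ξ s (s * t⁻¹ * s') s' v ((lact ρ a).rTensor (PathForms c W) z) := by
  -- Naming the braiding as a map between path tensors hides the carrier type of the calculus, so
  -- that linearity rewrites apply.
  obtain ⟨B, hB⟩ : ∃ B : PathForms c W ⊗[k] PathForms c W →ₗ[k] PathForms c W ⊗[k] PathForms c W,
      B = (calculus c hρ hw hc).braiding := ⟨_, rfl⟩
  have hBl : ∀ τ τ' a b, B (leftForm k c τ a ⊗ₜ leftForm k c τ' b) =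
      leftForm k c (τ * τ' * τ⁻¹) b ⊗ₜ leftForm k c τ a := fun τ τ' a b => by
    rw [hB]; exact braiding_leftForm hρ hw hc τ τ' a b
  have hBz : B z = z := by rw [hB]; exact ((BicovariantCalculus.mem_symmetricForms _).1 hz).2
  have key : ∀ y ∈ Submodule.span k
      {x | ∃ τ τ' a b, leftForm k c τ a ⊗ₜ[k] leftForm k c τ' b = x},
      pairing c ρ ξ η s t s' v ((lact ρ a).rTensor (PathForms c W) (B y)) =
      pairing c ρ η ξ s (s * t⁻¹ * s') s' v ((lact ρ a).rTensor (PathForms c W) y) := by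
    intro y hy
    induction hy using Submodule.span_induction with
    | mem x hx =>
      obtain ⟨τ, τ', b, b', rfl⟩ := hx
      rw [hBl]
      refine LinearMap.congr_fun (f := pairing c ρ ξ η s t s' v ∘ₗ
        LinearMap.flip (LinearMap.rTensorHom (PathForms c W))
          (leftForm k c (τ * τ' * τ⁻¹) b' ⊗ₜ leftForm k c τ b) ∘ₗ lact ρ)
        (g := pairing c ρ η ξ s (s * t⁻¹ * s') s' v ∘ₗ
        LinearMap.flip (LinearMap.rTensorHom (PathForms c W))
          (leftForm k c τ b ⊗ₜ leftForm k c τ' b') ∘ₗ lact ρ)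
        (QuantumDouble.hom_ext fun r g => ?_) a
      exact pairing_lact_braiding_leftForm _ _ _ _ _ _ r g _ _ _ _
    | zero => simp only [map_zero]
    | add x y _ _ hx hy => simp only [map_add, hx, hy]
    | smul r x _ hx => simp only [map_smul, hx]
  have := key z (mem_span_leftForm_tmul_leftForm hρ hw hc hz)
  rwa [hBz] at this

/-- The difference of the two pairings is therefore a functional on `Ω²`: each pairing respects the
relations over `A`, and braid-invariant tensors give equal values. -/
theorem pairing_eq_of_mem_relations {z : PathForms c W ⊗[k] PathForms c W}
    (hz : z ∈ (calculus c hρ hw hc).relations) :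
    pairing c ρ ξ η s t s' v z = pairing c ρ η ξ s (s * t⁻¹ * s') s' v z := by
  suffices h : (calculus c hρ hw hc).relations ≤
      LinearMap.ker (pairing c ρ ξ η s t s' v - pairing c ρ η ξ s (s * t⁻¹ * s') s' v) from
    sub_eq_zero.1 (h hz)
  refine sup_le (Submodule.span_le.2 ?_) (Submodule.span_le.2 ?_)
  · have h : ∀ (ξ η : Module.Dual k W) t a (x y : PathForms c W), pairing c ρ ξ η s t s' v
        (ract a x ⊗ₜ y - x ⊗ₜ lact ρ a y) = 0 := fun ξ η t a x y => by
      rw [map_sub, pairing_ract_tmul, sub_self]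
    rintro _ ⟨a, x, y, rfl⟩
    exact sub_eq_zero.2 ((h _ _ _ _ _ _).trans (h _ _ _ _ _ _).symm)
  · rintro _ ⟨a, z, hz, rfl⟩
    exact sub_eq_zero.2 (pairing_lact_symmetric ξ η s t s' v hρ hw hc a hz)

/-- The coefficients of a closed form. -/
theorem val_of_closed {ω : PathForms c W}
    (hω : (calculus c hρ hw hc).innerExteriorD (innerForm k c w) ω = 0)
    (h1 : ConjClasses.mk (s⁻¹ * t) = c) (h2 : ConjClasses.mk (t⁻¹ * s') = c) :
    ξ w * η (val k c t s' v ω) + ξ (val k c s t v ω) * η (ρ v w) =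
      η w * ξ (val k c (s * t⁻¹ * s') s' v ω) + η (val k c s (s * t⁻¹ * s') v ω) * ξ (ρ v w) := by
  have hz : (innerForm k c w ⊗ₜ ω + ω ⊗ₜ innerForm k c w : PathForms c W ⊗[k] PathForms c W) ∈
      (calculus c hρ hw hc).relations :=
    (Submodule.Quotient.mk_eq_zero _).1 hω
  have hp : ∀ ξ η : Module.Dual k W, ∀ t, ConjClasses.mk (s⁻¹ * t) = c →
      ConjClasses.mk (t⁻¹ * s') = c → pairing c ρ ξ η s t s' v
        (innerForm k c w ⊗ₜ ω + ω ⊗ₜ innerForm k c w) =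
      ξ w * η (val k c t s' v ω) + ξ (val k c s t v ω) * η (ρ v w) := by
    intro ξ η t h1 h2
    have h2' : ∀ u : G, ConjClasses.mk ((u⁻¹ * t * u)⁻¹ * (u⁻¹ * s' * u)) = c := fun u => by
      rw [← h2, ← ConjClasses.mk_conj u]; congr 1; group
    rw [map_add, pairing_tmul, pairing_tmul]
    -- A bi-invariant form has decoration `e`. Only `u = 1` contributes when it is the first factor,
    -- and only `u = v` when it is the second.
    congr 1
    · rw [Finset.sum_eq_single 1]
      · rw [val_innerForm h1, if_pos rfl]; simp
      · intro u _ hu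
        rw [val_innerForm h1, if_neg hu, map_zero, zero_mul]
      · simp
    · rw [Finset.sum_eq_single v]
      · rw [val_innerForm (h2' v), if_pos (inv_mul_cancel v)]
      · intro u _ hu
        rw [val_innerForm (h2' u), if_neg fun h => hu (inv_mul_eq_one.1 h), map_zero, map_zero,
          mul_zero]
      · simp
  have h3 : ConjClasses.mk (s⁻¹ * (s * t⁻¹ * s')) = c := by rw [← h2]; congr 1; group
  have h4 : ConjClasses.mk ((s * t⁻¹ * s')⁻¹ * s') = c := by
    rw [← h1, ← ConjClasses.mk_conj (s'⁻¹ * s) (s⁻¹ * t)]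
    congr 1; group
  rw [← hp ξ η t h1 h2, ← hp η ξ _ h3 h4]
  exact pairing_eq_of_mem_relations ξ η s t s' v hρ hw hc hz

end Calculus

end PathForms
end

/-! ### Discrete potentials on `S₃` -/

noncomputable section

open QuantumDouble BicovariantCalculus PathForms

namespace S3

open Equiv.Perm

variable {k : Type u} [Field k]

-- For `x`, `x'` of one sign and `t` of the other, `x t⁻¹ x' = t (x⁻¹x')`: the change of midpoint is
-- right multiplication by a rotation. Its cube is trivial, and if `x ≠ x'` it permutes the three
-- possible midpoints transitively.
set_option maxRecDepth 100000 in
theorem cyclic_apply_three : ∀ x x' t : S3, sign x = sign x' → sign t ≠ sign x →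
    x * (x * (x * t⁻¹ * x')⁻¹ * x')⁻¹ * x' = t := by decide

set_option maxRecDepth 100000 in
theorem cyclic_transitive : ∀ x x' t t' : S3, sign x = sign x' → x ≠ x' → sign t ≠ sign x →
    sign t' ≠ sign x → t' = t ∨ t' = x * t⁻¹ * x' ∨ t' = x * (x * t⁻¹ * x')⁻¹ * x' := by decide

/-- Two functions on the permutations of the sign opposite to that of `x` and `x'` that are
exchanged by `t ↦ x t⁻¹ x'` agree, and are constant if `x ≠ x'`. -/
theorem eq_of_cyclic {F G : S3 → k} {x x' : S3} (hx : sign x = sign x')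
    (h : ∀ t, sign t ≠ sign x → F t = G (x * t⁻¹ * x'))
    (h' : ∀ t, sign t ≠ sign x → G t = F (x * t⁻¹ * x')) :
    (∀ t, sign t ≠ sign x → F t = G t) ∧
      (x ≠ x' → ∀ t t', sign t ≠ sign x → sign t' ≠ sign x → F t = F t') := by
  have h1 : ∀ t, sign t ≠ sign x → sign (x * t⁻¹ * x') ≠ sign x := by
    intro t ht h
    rw [map_mul, map_mul, ← hx, mul_eq_right] at h
    rw [map_inv, mul_inv_eq_one] at h
    exact ht h.symm
  have hFG : ∀ t, sign t ≠ sign x → F t = G t := by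
    intro t ht
    rw [h t ht, h' _ (h1 t ht), h _ (h1 _ (h1 t ht)), cyclic_apply_three x x' t hx ht]
  have hF : ∀ t, sign t ≠ sign x → F t = F (x * t⁻¹ * x') := fun t ht =>
    (h t ht).trans (hFG _ (h1 t ht)).symm
  refine ⟨hFG, fun hne t t' ht ht' => ?_⟩
  rcases cyclic_transitive x x' t t' hx hne ht ht' with rfl | rfl | rfl
  · rfl
  · exact hF t ht
  · exact (hF t ht).trans (hF _ (h1 t ht))

/-- Here `α` and `β` are the `stdX` and `stdY` coefficients of a closed form at a decoration acting
on `stdX` by `r`. Independence of the midpoint splits `α` into a function of the target and a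
function of the source, up to a constant. The relation on `β` transports its value along consecutive
arrows with factor `r`. -/
theorem exists_potential_of_rotation [CharZero k] {r : k} (hr : r ^ 3 = 1) {α β : S3 → S3 → k}
    (hα : ∀ x t t' x', sign x = sign x' → sign t ≠ sign x → sign t' ≠ sign x → x ≠ x' →
      α t x' + r * α x t = α t' x' + r * α x t')
    (hβ : ∀ x t x', sign x = sign x' → sign t ≠ sign x → β t x' = r * β x t) :
    ∃ (a : S3 → k) (c b : k), (r ≠ 1 → c = 0 ∧ b = 0) ∧ ∀ x t, sign t ≠ sign x →
      α x t = a t - r * a x + c ∧ β x t = b := by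
  have hr1 : 1 + r ≠ 0 := by
    intro h
    have : r = -1 := by linear_combination h
    rw [this] at hr
    norm_num at hr
  have hs : sign (1 : S3) ≠ sign s := by decide
  have hrot : ∀ x : S3, sign (x * u) = sign x ∧ sign (x * u ^ 2) = sign x ∧ x ≠ x * u ∧
      x * u ^ 2 ≠ x ∧ x * u ≠ x * u ^ 2 := by decide
  -- the relation for all endpoints of the same sign
  have hα' : ∀ x t t' x', sign x = sign x' → sign t ≠ sign x → sign t' ≠ sign x →
      α t x' + r * α x t = α t' x' + r * α x t' := by
    intro x t t' x' hx ht ht'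
    by_cases hne : x = x'
    · subst hne
      -- The case of equal endpoints follows from three cases with distinct endpoints among `x`,
      -- `xu`, `xu²`.
      obtain ⟨h1, h2, h3, h4, h5⟩ := hrot x
      have e1 := hα (x * u) t t' x h1 (by rwa [h1]) (by rwa [h1]) h3.symm
      have e2 := hα (x * u) t t' (x * u ^ 2) (h1.trans h2.symm) (by rwa [h1]) (by rwa [h1]) h5
      have e3 := hα x t t' (x * u ^ 2) h2.symm ht ht' h4.symm
      linear_combination e1 - e2 + e3
    · exact hα x t t' x' hx ht ht' hne
  have hsign : ∀ x : S3, sign x = sign (1 : S3) ∨ sign x = sign s := by decide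
  -- The potential is read from arrows out of `1` on odd permutations and out of `s` on even ones.
  -- The shift `κ` makes the additive constants for the two orientations agree; `1 + r ≠ 0` because
  -- `r³ = 1`.
  obtain ⟨κ, hκ⟩ : ∃ κ, κ = r * (α 1 s - α s 1) / (1 + r) := ⟨_, rfl⟩
  have hκ' : κ * (1 + r) = r * (α 1 s - α s 1) := by rw [hκ]; field_simp
  obtain ⟨a, ha⟩ : ∃ a : S3 → k, a = fun t => if sign t = sign s then α 1 t else α s t + κ :=
    ⟨_, rfl⟩
  have hodd : ∀ t, sign t = sign s → a t = α 1 t := fun t ht => by rw [ha]; exact if_pos ht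
  have heven : ∀ t, sign t = sign (1 : S3) → a t = α s t + κ := fun t ht => by
    rw [ha]; exact if_neg (by rw [ht]; exact hs)
  have hα0 : ∀ x t, sign t ≠ sign x → α x t = a t - r * a x + (r * α 1 s - κ) := by
    intro x t ht
    rcases hsign x with hx | hx
    · have ht' : sign t = sign s := (hsign t).resolve_left fun h => ht (h.trans hx.symm)
      rw [hodd t ht', heven x hx]
      have := hα' s x 1 t ht'.symm (by rw [hx]; exact hs) hs
      linear_combination this + hκ'
    · have ht' : sign t = sign (1 : S3) := (hsign t).resolve_right fun h => ht (h.trans hx.symm)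
      rw [heven t ht', hodd x hx]
      have := hα' 1 x s t ht'.symm (by rw [hx]; exact hs.symm) hs.symm
      linear_combination this
  -- the second coefficient
  by_cases hr1' : r = 1
  · subst hr1'
    have h1 : ∀ t, sign t = sign s → ∀ x, sign t ≠ sign x → β x t = β 1 s := by
      intro t ht x hx
      have hx' : sign x = sign (1 : S3) := (hsign x).resolve_right fun h => hx (ht.trans h.symm)
      have e1 := hβ x t 1 hx' hx
      have e2 := hβ t 1 s ht (by rw [ht]; exact hs)
      linear_combination -e2 - e1
    refine ⟨a, _, β 1 s, fun h => absurd rfl h, fun x t ht => ⟨hα0 x t ht, ?_⟩⟩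
    rcases hsign t with h | h
    · have hx : sign x = sign s := (hsign x).resolve_left fun h' => ht (h.trans h'.symm)
      have e1 := hβ x t s hx ht
      rw [h1 s rfl t (by rw [h]; exact hs.symm)] at e1
      linear_combination -e1
    · exact h1 t h x ht
  · have hr2 : 1 - r ≠ 0 := sub_ne_zero.2 (Ne.symm hr1')
    have hr3 : 1 - r ^ 2 ≠ 0 := by
      intro h
      exact hr1' (by linear_combination hr + r * h)
    -- For `r ≠ 1` shifting the potential by a constant changes `a t - r a x` by `1 - r` times it,
    -- which absorbs the additive term. Going along an arrow and back multiplies `β` by `r² ≠ 1`.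
    refine ⟨fun t => a t + (r * α 1 s - κ) / (1 - r), 0, 0, fun _ => ⟨rfl, rfl⟩,
      fun x t ht => ⟨?_, ?_⟩⟩
    · rw [hα0 x t ht]
      field_simp
      ring
    · have e1 := hβ x t x rfl ht
      have e2 := hβ t x t rfl ht.symm
      have : β x t * (1 - r ^ 2) = 0 := by linear_combination e2 + r * e1
      exact (mul_eq_zero.1 this).resolve_right hr3

/-- For a reflection the `stdX` coefficient depends on the target only, since the source can be
varied freely; the mixed relation then expresses the `stdY` coefficient through the same function at
the source. -/
theorem exists_potential_of_reflection {r : k} {α β : S3 → S3 → k}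
    (hα : ∀ x t t' x', sign x = sign x' → sign t ≠ sign x → sign t' ≠ sign x → x ≠ x' →
      α t x' = α t' x')
    (hβ : ∀ x t x', sign x = sign x' → sign t ≠ sign x → β t x' + α x t * r = 0) :
    ∃ a : S3 → k, ∀ x t, sign t ≠ sign x → α x t = a t ∧ β x t = - r * a x := by
  have hnb : ∀ x : S3, sign (x * s) ≠ sign x := by decide
  have hrot : ∀ x : S3, sign (x * u) = sign x ∧ x * u ≠ x := by decide
  have h1 : ∀ x t, sign t ≠ sign x → α x t = α (t * s) t := by
    intro x t ht
    obtain ⟨h2, h3⟩ := hrot t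
    exact hα (t * u) x (t * s) t h2 (by rw [h2]; exact ht.symm) (by rw [h2]; exact hnb t) h3
  refine ⟨fun t => α (t * s) t, fun x t ht => ⟨h1 x t ht, ?_⟩⟩
  have := hβ t x t rfl ht.symm
  rw [h1 t x ht.symm] at this
  linear_combination this

end S3
end

/-! ### Closed forms and `H¹` of the 6-dimensional calculus -/

noncomputable section

open QuantumDouble BicovariantCalculus PathForms

namespace S3

open Equiv.Perm

variable {k : Type u} [Field k] [CharZero k] {q : k} (hq : 1 + q + q ^ 2 = 0)

/-- The exterior derivative on the 1-forms of the 6-dimensional calculus. -/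
def connectedD : (connectedCalculus hq).carrier →ₗ[k] (connectedCalculus hq).TwoForms :=
  (connectedCalculus hq).innerExteriorD (innerForm k (ConjClasses.mk s) (stdX hq))

theorem isExteriorDerivative_connectedD :
    (connectedCalculus hq).IsExteriorDerivative (connectedD hq) :=
  isExteriorDerivative_calculus _ _ _

/-- The closedness equations are tested on `coordX` with itself and on `coordX` with `coordY`. The
rotation or reflection type of the decoration `v` then decides which potential lemma applies. A
nonexact remainder can occur only at `v = 1`. -/
theorem exists_val_eq_of_closed {ω : PathForms (ConjClasses.mk s) (stdSpace k)}
    (hω : connectedD hq ω = 0) (v : S3) : ∃ (a : S3 → k) (c b : k), (v ≠ 1 → c = 0 ∧ b = 0) ∧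
      ∀ x t, sign x ≠ sign t → val k (ConjClasses.mk s) x t v ω =
        a t • stdX hq - a x • stdRep k v (stdX hq) + c • stdX hq + b • stdY hq := by
  have hval : ∀ (ξ η : Module.Dual k (stdSpace k)) (x t x' : S3), sign x = sign x' →
      sign t ≠ sign x → ξ (stdX hq) * η (val k (ConjClasses.mk s) t x' v ω) +
        ξ (val k (ConjClasses.mk s) x t v ω) * η (stdRep k v (stdX hq)) =
      η (stdX hq) * ξ (val k (ConjClasses.mk s) (x * t⁻¹ * x') x' v ω) +
        η (val k (ConjClasses.mk s) x (x * t⁻¹ * x') v ω) * ξ (stdRep k v (stdX hq)) := by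
    intro ξ η x t x' hx ht
    exact val_of_closed ξ η x t x' v (isSimple_stdRep hq) (stdX_ne_zero hq)
      (fun h => absurd h mk_one_ne_mk_s.symm) hω (mk_inv_mul_eq_mk_s.2 ht.symm)
      (mk_inv_mul_eq_mk_s.2 (by rwa [← hx]))
  -- The function `z` is the pairing of `Dω` along `x → t → x'`. Closedness says that exchanging the
  -- functionals and rotating the midpoint leaves it unchanged, which is the input of
  -- `eq_of_cyclic`.
  obtain ⟨z, hz⟩ : ∃ z : Module.Dual k (stdSpace k) → Module.Dual k (stdSpace k) →
      S3 → S3 → S3 → k, ∀ ξ η x t x', z ξ η x t x' =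
        ξ (stdX hq) * η (val k (ConjClasses.mk s) t x' v ω) +
        ξ (val k (ConjClasses.mk s) x t v ω) * η (stdRep k v (stdX hq)) :=
    ⟨_, fun _ _ _ _ _ => rfl⟩
  have hsym : ∀ ξ η x x', sign x = sign x' →
      (∀ t, sign t ≠ sign x → z ξ η x t x' = z η ξ x t x') ∧
      (x ≠ x' → ∀ t t', sign t ≠ sign x → sign t' ≠ sign x → z ξ η x t x' = z ξ η x t' x') := by
    intro ξ η x x' hx
    refine eq_of_cyclic hx (fun t ht => ?_) (fun t ht => ?_)
    · rw [hz, hz]; exact hval ξ η x t x' hx ht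
    · rw [hz, hz]; exact hval η ξ x t x' hx ht
  have hX := coordX_stdX hq
  have hY := coordY_stdX hq
  have hX' := coordX_stdY hq
  have hY' := coordY_stdY hq
  rcases stdRep_cases hq v with ⟨r, hr, hv, hrX, -⟩ | ⟨r, hr, hrX, -⟩
  · obtain ⟨a, c, b, hcb, h⟩ := exists_potential_of_rotation (r := r) hr
      (α := fun x t => coordX q (val k (ConjClasses.mk s) x t v ω))
      (β := fun x t => coordY q (val k (ConjClasses.mk s) x t v ω))
      (fun x t t' x' hx ht ht' hne => by
        have := (hsym (coordX q) (coordX q) x x' hx).2 hne t t' ht ht'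
        simp only [hz, hrX, map_smul, hX, smul_eq_mul] at this
        linear_combination this)
      (fun x t x' hx ht => by
        have := (hsym (coordX q) (coordY q) x x' hx).1 t ht
        simp only [hz, hrX, map_smul, hX, hY, smul_eq_mul] at this
        linear_combination this)
    refine ⟨a, c, b, fun h1 => hcb (hv.resolve_left h1), fun x t hxt => ?_⟩
    obtain ⟨h1, h2⟩ := h x t hxt.symm
    rw [eq_stdX_add_stdY hq (val k (ConjClasses.mk s) x t v ω), h1, h2, hrX]
    module
  · obtain ⟨a, h⟩ := exists_potential_of_reflection (r := r)
      (α := fun x t => coordX q (val k (ConjClasses.mk s) x t v ω))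
      (β := fun x t => coordY q (val k (ConjClasses.mk s) x t v ω))
      (fun x t t' x' hx ht ht' hne => by
        have := (hsym (coordX q) (coordX q) x x' hx).2 hne t t' ht ht'
        simp only [hz, hrX, map_smul, hX, hX', smul_eq_mul] at this
        linear_combination this)
      (fun x t x' hx ht => by
        have := (hsym (coordX q) (coordY q) x x' hx).1 t ht
        simp only [hz, hrX, map_smul, hX, hY, hX', hY', smul_eq_mul] at this
        linear_combination this)
    refine ⟨a, 0, 0, fun _ => ⟨rfl, rfl⟩, fun x t hxt => ?_⟩
    obtain ⟨h1, h2⟩ := h x t hxt.symm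
    rw [eq_stdX_add_stdY hq (val k (ConjClasses.mk s) x t v ω), h1, h2, hrX]
    module

/-- A closed form is exact up to bi-invariant forms. -/
theorem exists_eq_of_closed {ω : PathForms (ConjClasses.mk s) (stdSpace k)}
    (hω : connectedD hq ω = 0) : ∃ (a : QuantumDouble k S3) (c b : k),
      ω = innerD (stdRep k) (stdX hq) a + (c • innerForm k (ConjClasses.mk s) (stdX hq) +
        b • innerForm k (ConjClasses.mk s) (stdY hq)) := by
  choose a c b hcb h using exists_val_eq_of_closed hq hω
  -- The potentials found separately for each decoration are the coordinates of a single element of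
  -- `D(S₃)`.
  refine ⟨basis.equivFun.symm fun p => a p.2 p.1, c 1, b 1, ext (k := k) fun x t v hxt => ?_⟩
  have hcoord : ∀ t, basis.coord (t, v) (basis.equivFun.symm fun p : S3 × S3 => a p.2 p.1) =
      a v t := fun t => by
    rw [Module.Basis.coord_apply, Module.Basis.equivFun_symm_apply, Module.Basis.repr_sum_self]
  rw [map_add, map_add, map_smul, map_smul, val_innerD hxt, val_innerForm hxt, val_innerForm hxt,
    hcoord, hcoord, h v x t (mk_inv_mul_eq_mk_s.1 hxt)]
  by_cases hv : v = 1
  · subst hv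
    simp [add_assoc]
  · obtain ⟨h1, h2⟩ := hcb v hv
    simp [hv, h1, h2]

/-- At decoration `e` an exact form has no `stdY` component, and its `stdX` coefficient changes sign
when an arrow is reversed, whereas a bi-invariant form has equal coefficients on both. As `2 ≠ 0`,
no nonzero combination is exact. -/
theorem cls_innerForm_independent : LinearIndependent k
    ![(connectedCalculus hq).cls (innerForm k (ConjClasses.mk s) (stdX hq)),
      (connectedCalculus hq).cls (innerForm k (ConjClasses.mk s) (stdY hq))] := by
  rw [LinearIndependent.pair_iff]
  intro c b h
  obtain ⟨a, ha⟩ : c • innerForm k (ConjClasses.mk s) (stdX hq) +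
      b • innerForm k (ConjClasses.mk s) (stdY hq) ∈
        LinearMap.range (innerD (stdRep k) (c := ConjClasses.mk s) (stdX hq)) :=
    (Submodule.Quotient.mk_eq_zero _).1 h
  have hval : ∀ x t : S3, sign x ≠ sign t →
      basis.coord (t, 1) a • stdX hq - basis.coord (x, 1) a • stdX hq =
        c • stdX hq + b • stdY hq := by
    intro x t hxt
    have hxt' := mk_inv_mul_eq_mk_s.2 hxt
    have := congrArg (val k (ConjClasses.mk s) x t 1) ha
    rwa [val_innerD hxt', map_add, map_smul, map_smul, val_innerForm hxt', val_innerForm hxt',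
      if_pos rfl, if_pos rfl, map_one, Module.End.one_apply] at this
  have h1 := hval 1 s (by decide)
  have h2 := hval s 1 (by decide)
  have e1 := congrArg (coordX q) h1
  have e2 := congrArg (coordX q) h2
  have e3 := congrArg (coordY q) h1
  simp only [map_sub, map_add, map_smul, coordX_stdX, coordX_stdY, coordY_stdX, coordY_stdY,
    smul_eq_mul, mul_one, mul_zero, add_zero, zero_add, sub_zero] at e1 e2 e3
  refine ⟨?_, e3.symm⟩
  have : 2 * c = 0 := by linear_combination -e1 - e2
  exact (mul_eq_zero.1 this).resolve_left two_ne_zero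

theorem H1_connectedCalculus : (connectedCalculus hq).H1 (connectedD hq) = Submodule.span k
    {(connectedCalculus hq).cls (innerForm k (ConjClasses.mk s) (stdX hq)),
      (connectedCalculus hq).cls (innerForm k (ConjClasses.mk s) (stdY hq))} := by
  refine le_antisymm ?_ (Submodule.span_le.2 ?_)
  · rintro _ ⟨ω, hω, rfl⟩
    obtain ⟨a, c, b, hab⟩ := exists_eq_of_closed hq hω
    refine Submodule.mem_span_pair.2 ⟨c, b, ?_⟩
    have h : (connectedCalculus hq).cls ω = (connectedCalculus hq).cls
        ((connectedCalculus hq).d a) + (c • (connectedCalculus hq).cls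
          (innerForm k (ConjClasses.mk s) (stdX hq)) + b • (connectedCalculus hq).cls
          (innerForm k (ConjClasses.mk s) (stdY hq))) := by
      rw [hab]; rfl
    have h0 : (connectedCalculus hq).cls ((connectedCalculus hq).d a) = 0 :=
      (Submodule.Quotient.mk_eq_zero _).2 (LinearMap.mem_range_self _ a)
    rw [h, h0, zero_add]
  · rintro _ (rfl | rfl)
    · exact ⟨_, innerExteriorD_innerForm _ _ _ _, rfl⟩
    · exact ⟨_, innerExteriorD_innerForm _ _ _ _, rfl⟩

/-- The nontrivial pairs of a conjugacy class and an irreducible representation. -/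
def pairs : Fin 8 → {p : Fin 3 × Fin 3 // p.1 ≠ 0 ∨ p.2 ≠ 0} :=
  ![⟨(0, 1), by decide⟩, ⟨(0, 2), by decide⟩, ⟨(1, 0), by decide⟩, ⟨(1, 1), by decide⟩,
    ⟨(1, 2), by decide⟩, ⟨(2, 0), by decide⟩, ⟨(2, 1), by decide⟩, ⟨(2, 2), by decide⟩]

theorem bijective_pairs : Function.Bijective pairs := by decide

end S3

end

theorem mainTheorem11 {k : Type u} [Field k] [CharZero k] (q : k) (hq : IsPrimitiveRoot q 3) :
    ∃ C : Fin 8 → BicovariantCalculus.{u, u, u} k (QuantumDouble k S3),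
      -- the eight irreducible calculi, and their dimensions
      (∀ i, (C i).IsIrreducible) ∧
      (∀ i j, (C i).Equivalent (C j) → i = j) ∧
      (∀ C' : BicovariantCalculus.{u, u, w} k (QuantumDouble k S3), C'.IsIrreducible →
        ∃ i, C'.Equivalent (C i)) ∧
      (∀ i, (C i).dim = (![1, 2, 2, 2, 4, 3, 3, 6] : Fin 8 → ℕ) i) ∧
      -- the last one is the calculus with tangent space spanned by `f₀, …, f₅`
      (C 7).tangentSpace = Submodule.span k (Set.range (tangentBasis q)) ∧
      -- up to equivalence it is the only one with `H⁰ = k.1`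
      (C 7).H0 = Submodule.span k {1} ∧
      (∀ C' : BicovariantCalculus.{u, u, w} k (QuantumDouble k S3), C'.IsIrreducible →
        C'.H0 = Submodule.span k {1} → C'.Equivalent (C 7)) ∧
      -- its first cohomology, with `e` the basis of `Λ¹` dual to the basis of the tangent space
      ∃ (e : Fin 6 → (C 7).carrier) (D : (C 7).carrier →ₗ[k] (C 7).TwoForms),
        (∀ a, (C 7).maurerCartan a = ∑ i, tangentBasis q i a • e i) ∧
        (C 7).IsExteriorDerivative D ∧
        LinearIndependent k
          ![(C 7).cls (e 0 + q • e 1 + q ^ 2 • e 2),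
            (C 7).cls (e 3 + q⁻¹ • e 4 + (q⁻¹) ^ 2 • e 5)] ∧
        (C 7).H1 D = Submodule.span k
          {(C 7).cls (e 0 + q • e 1 + q ^ 2 • e 2),
            (C 7).cls (e 3 + q⁻¹ • e 4 + (q⁻¹) ^ 2 • e 5)} := by
  have hq0 : 1 + q + q ^ 2 = 0 := by
    have h := hq.geom_sum_eq_zero (by norm_num)
    simpa [Finset.sum_range_succ] using h
  have h7 : ∀ p : {p : Fin 3 × Fin 3 // p.1 ≠ 0 ∨ p.2 ≠ 0}, p.1 = (2, 2) → p = S3.pairs 7 :=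
    fun p hp => Subtype.ext hp
  -- The entry with index `7` is the pair (reflections, 2-dimensional), whose `pairCalculus` is
  -- definitionally `connectedCalculus`.
  refine ⟨fun i => S3.pairCalculus hq0 (S3.pairs i), fun i => S3.isIrreducible_pairCalculus hq0 _,
    fun i j h => S3.bijective_pairs.1 (S3.pairCalculus_eq_of_equivalent hq0 h), fun C' hC' => ?_,
    fun i => ?_, S3.tangentSpace_connectedCalculus hq0, S3.H0_connectedCalculus hq0,
    fun C' hC' hH => ?_, S3.dualForm hq0, S3.connectedD hq0, S3.maurerCartan_connectedCalculus hq0,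
    S3.isExteriorDerivative_connectedD hq0, ?_, ?_⟩
  · obtain ⟨p, hp⟩ := S3.exists_equivalent hq0 hC'
    obtain ⟨i, rfl⟩ := S3.bijective_pairs.2 p
    exact ⟨i, hp⟩
  · rw [S3.dim_pairCalculus]
    fin_cases i <;> rfl
  · obtain ⟨p, hp⟩ := S3.exists_equivalent hq0 hC'
    rw [h7 p (S3.eq_of_H0_eq hq0 hp hH)] at hp
    exact hp
  · have h := S3.cls_innerForm_independent hq0
    rw [S3.innerForm_stdX, S3.innerForm_stdY] at h
    exact h
  · have h := S3.H1_connectedCalculus hq0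
    rw [S3.innerForm_stdX, S3.innerForm_stdY] at h
    exact h
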